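/- Let $M$ be a set and let $d:M\times M\to[0,\infty)$ be a quasimetric, i.e. $d(x,y)=0\iff x=y$ and $d(x,z)\le d(x,y)+d(y,z)$, with symmetry not required. Endow $M$ with the topology of the metric $\max\{d(x,y),d(y,x)\}$ (the usual topology if $d$ is a metric), and let $\mu$ be a locally finite Borel measure on $M$ with full support. For $x\in M$, $\rho>0$ put $B_\rho(x)=\{y\in M: d(x,y)<\rho\}$, and assume that $(M,d)$ is proper: every closed subset of $M$ contained in some ball $B_R(x)$ is compact. For an open set $\Omega\subseteq M$ let ${\rm Lip}_0(\Omega)$ be the set of functions $u:\Omega\to\mathbb R$ with compact support in $\Omega$ for which there is $L$ such that $u(y)-u(x)\le L\,d(x,y)$ for all $x,y\in\Omega$. For $u\in{\rm Lip}_0(\Omega)$ let $|\nabla u|_d(x)=\limsup_{y\to x,\,y\ne x}\frac{u(y)-u(x)}{d(x,y)}$ (equal to $0$ if $x$ is isolated), and $$\lambda_{1,d}(\Omega)=\inf_{u\in {\rm Lip}_0(\Omega)\setminus\{0\}}\frac{\int_\Omega|\nabla u|_d^2\,d\mu}{\int_\Omega u^2\,d\mu}.$$ For $x_0\in M$ and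 $\rho>0$ let $${\sf A}^\mu_\rho(x_0)=\limsup_{\delta\to0^+}\frac{\mu(B_{\rho+\delta}(x_0)\setminus B_\rho(x_0))}{\delta}.$$ For an integer $n\ge2$ and $\kappa>0$, let $\mathbb H^n_{-\kappa^2}$ be the hyperbolic space of constant curvature $-\kappa^2$ in the Poincaré ball model, i.e. $\{x\in\mathbb R^n:|x|<1\}$ with the Riemannian metric $\frac{4}{\kappa^2(1-|x|^2)^2}\delta_{ij}$, its distance $d_h$ and its Riemannian volume. Let $B^\kappa_\rho=\{x: d_h(0,x)<\rho\}$, let $V^\kappa_\rho$ be the volume of $B^\kappa_\rho$, and let $\lambda_{1,d_h}(B^\kappa_\rho)$ be defined as above for $d_h$ and the Riemannian volume. Let $\omega_n$ be the volume of the Euclidean unit ball of $\mathbb R^n$. Assume that for some $x_0\in M$, $\kappa>0$ and some integer $n\ge2$ * $({\bf D})^n_{x_0}$: $\displaystyle\liminf_{\rho\to0^+}\frac{{\sf A}^\mu_\rho(x_0)}{n\omega_n\rho^{n-1}}=1$, and * $({\bf BG})^{n,\kappa}_{x_0}$: the function $\rho\mapsto\dfrac{{\sf A}^\mu_\rho(x_0)}{\sinh^{n-1}(\kappa\rho)}$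 is non-increasing on $(0,\infty)$. Then for every $r>0$, $$\lambda_{1,d}(B_r(x_0))\le\lambda_{1,d_h}(B^\kappa_r).$$ Moreover, if equality holds for some $r>0$, then $\mu(B_\rho(x_0))=V^\kappa_\rho$ for every $0<\rho<r$. -/

import Mathlib

open Filter Topology MeasureTheory
open scoped ENNReal

noncomputable section

/-- `d` is a quasimetric on `M` (a metric, except that symmetry is not required), and the topology
of `M` is the one which it induces: `U` is open iff each of its points `x` has some `ε > 0` such
that `U` contains all `y` with `d x y < ε` and `d y x < ε`.  If `d` is symmetric, these are the
axioms of a metric together with its usual topology. -/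
structure IsQuasimetric {M : Type*} [TopologicalSpace M] (d : M → M → ℝ) : Prop where
  nonneg : ∀ x y, 0 ≤ d x y
  eq_zero_iff : ∀ x y, d x y = 0 ↔ x = y
  triangle : ∀ x y z, d x z ≤ d x y + d y z
  isOpen_iff : ∀ U : Set M,
    IsOpen U ↔ ∀ x ∈ U, ∃ ε > 0, ∀ y, d x y < ε → d y x < ε → y ∈ U

/-- The ball `B_ρ(x) = {y : d(x, y) < ρ}`. -/
def qball {M : Type*} (d : M → M → ℝ) (x : M) (ρ : ℝ) : Set M := {y | d x y < ρ}

/-- Properness: every closed and bounded set is compact. -/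
def IsProperQuasimetric {M : Type*} [TopologicalSpace M] (d : M → M → ℝ) : Prop :=
  ∀ s : Set M, IsClosed s → (∃ x R, s ⊆ qball d x R) → IsCompact s

/-- `u ∈ Lip₀(Ω)`: `u` is Lipschitz on `Ω` with respect to the quasimetric `d`, with compact support
contained in `Ω` (functions on `Ω` are identified with their extensions by zero).
For symmetric `d` the inequality, being required for `(x, y)` and `(y, x)`, is
`|u y - u x| ≤ L * d x y`. -/
structure IsLipZero {M : Type*} [TopologicalSpace M] (d : M → M → ℝ) (Ω : Set M) (u : M → ℝ) :
    Prop where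
  lipschitz : ∃ L : ℝ, ∀ x ∈ Ω, ∀ y ∈ Ω, u y - u x ≤ L * d x y
  hasCompactSupport : HasCompactSupport u
  tsupport_subset : tsupport u ⊆ Ω

open Classical in
/-- `|∇u|_d(x) = limsup_{y → x} (u y - u x) / d(x, y)`, with values in `[-∞, ∞]`
(and `0` if `x` is an isolated point). -/
def slope_d {M : Type*} [TopologicalSpace M] (d : M → M → ℝ) (u : M → ℝ) (x : M) : EReal :=
  if 𝓝[≠] x = ⊥ then 0
  else limsup (fun y => (((u y - u x) / d x y : ℝ) : EReal)) (𝓝[≠] x)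

/-- The fundamental frequency `λ_{1,d}(Ω)`: the infimum of `∫_Ω |∇u|_d² dμ / ∫_Ω u² dμ` over the
functions `u ∈ Lip₀(Ω)`, `u ≠ 0`. -/
def fundamentalFrequency {M : Type*} [TopologicalSpace M] [MeasurableSpace M] (d : M → M → ℝ)
    (μ : Measure M) (Ω : Set M) : ℝ≥0∞ :=
  ⨅ (u : M → ℝ) (_ : IsLipZero d Ω u ∧ u ≠ 0),
    (∫⁻ x in Ω, (slope_d d u x).abs ^ 2 ∂μ) / (∫⁻ x in Ω, ENNReal.ofReal (u x ^ 2) ∂μ)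

/-- The induced area of the sphere of radius `ρ`,
`A_ρ(x₀) = limsup_{δ → 0} μ(B_{ρ+δ}(x₀) \ B_ρ(x₀)) / δ`. -/
def sphereArea {M : Type*} [MeasurableSpace M] (d : M → M → ℝ) (μ : Measure M) (x₀ : M) (ρ : ℝ) :
    ℝ≥0∞ :=
  limsup (fun δ : ℝ => μ (qball d x₀ (ρ + δ) \ qball d x₀ ρ) / ENNReal.ofReal δ) (𝓝[>] 0)

/-- The local density condition: `liminf_{ρ → 0} A_ρ(x₀) / (n ω_n ρ^{n-1}) = 1`, where `ω_n` is the
volume of the Euclidean unit ball. -/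
def LocalDensity {M : Type*} [MeasurableSpace M] (d : M → M → ℝ) (μ : Measure M) (n : ℕ)
    (x₀ : M) : Prop :=
  liminf (fun ρ : ℝ => sphereArea d μ x₀ ρ /
    (n * volume (Metric.ball (0 : EuclideanSpace ℝ (Fin n)) 1) * ENNReal.ofReal (ρ ^ (n - 1))))
    (𝓝[>] 0) = 1

/-- The Bishop-Gromov-type monotonicity: `ρ ↦ A_ρ(x₀) / sinh^{n-1}(κρ)` is non-increasing on
`(0, ∞)`. -/
def BishopGromov {M : Type*} [MeasurableSpace M] (d : M → M → ℝ) (μ : Measure M) (n : ℕ) (κ : ℝ)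
    (x₀ : M) : Prop :=
  AntitoneOn (fun ρ : ℝ => sphereArea d μ x₀ ρ / ENNReal.ofReal (Real.sinh (κ * ρ) ^ (n - 1)))
    (Set.Ioi 0)

/-- The Poincaré ball `{x ∈ ℝⁿ : |x| < 1}`, the underlying space of the hyperbolic space of
curvature `-κ²`. -/
abbrev PoincareBall (n : ℕ) : Type :=
  {x : EuclideanSpace ℝ (Fin n) // x ∈ Metric.ball (0 : EuclideanSpace ℝ (Fin n)) 1}

/-- The centre of the Poincaré ball. -/
def PoincareBall.origin (n : ℕ) : PoincareBall n := ⟨0, by simp⟩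

/-- The Riemannian distance `d_h` of the metric `p_κ(x)² δ_ij`, `p_κ(x) = 2 / (κ (1 - |x|²))`, on
the Poincaré ball, i.e. `κ d_h(x, y) = 2 arsinh (|x - y| / √((1 - |x|²) (1 - |y|²)))`. -/
def hypDist (n : ℕ) (κ : ℝ) (x y : PoincareBall n) : ℝ :=
  2 / κ * Real.arsinh (‖x.1 - y.1‖ / Real.sqrt ((1 - ‖x.1‖ ^ 2) * (1 - ‖y.1‖ ^ 2)))

/-- The Riemannian volume `p_κ(x)ⁿ dx` of the Poincaré ball. -/
def hypMeasure (n : ℕ) (κ : ℝ) : Measure (PoincareBall n) :=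
  (Measure.comap Subtype.val volume).withDensity
    (fun x => ENNReal.ofReal ((2 / (κ * (1 - ‖x.1‖ ^ 2))) ^ n))

/-- The geodesic ball `B_r^κ` of the hyperbolic space of curvature `-κ²`, centred at the origin. -/
def hypBall (n : ℕ) (κ r : ℝ) : Set (PoincareBall n) :=
  qball (hypDist n κ) (PoincareBall.origin n) r

end

/-! Let `s(t) = sinh^{n-1}(κt)` and let `h` be the first radial Dirichlet eigenfunction of the
hyperbolic ball: `(s h')' = -L s h`, `h(0) = 1`, `h(r) = 0`, `h > 0` on `[0, r)`. It is transplanted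
to `M` through the distance from `x₀`, and Rayleigh quotients are compared.

On the hyperbolic side only the inequality between `L` and the frequency of the ball is needed, `L`
being the smaller. The slope dominates the modulus of the radial derivative, polar coordinates
reduce the claim to rays, and on each ray Picone's inequality with `h` applies
(`ofReal_le_fundamentalFrequency`).

On `M` the test function is `-h(d(x₀, ·))`, truncated to have compact support. By the triangle
inequality its slope is at most `|h'|`. The slope is nonnegative almost everywhere, because a
negative slope only occurs at strict local maxima, which are countably many. Hence `λ ∫ h² dm ≤ ∫
h'² dm`, where `m` is the law of `d(x₀, ·)` on the ball (`fundamentalFrequency_mul_le`).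

The two sides meet in `energy_comparison`. By the Bishop-Gromov and density conditions the area of
spheres is `w s` with `w` nonincreasing. Log-concavity of `s` makes `-h'/h` strictly increasing, so
`g = L h² - h'²` is positive before some `t₀` and negative after it (`exists_sign_change`). Since
`m` dominates `w(t₀) s dt` before `t₀` and is dominated by it afterwards, `∫ g dm ≥ w(t₀) ∫ g s dt`.
The last integral vanishes because `s g = (-s h h')'`. Thus `λ ≤ L`.

In the equality case both dominations are equalities, so `m = w(t₀) s dt` on `(0, r]`. The limit of
`w` at `0`, known from the density condition, then identifies the constant. -/

/-! ### Series solution of the singular equation `(s h')' = -L s h`. -/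

/-- A continuous nondecreasing weight on the line which is positive exactly on `(0, ∞)`. -/
structure IsRadialWeight (s : ℝ → ℝ) : Prop where
  continuous : Continuous s
  monotone : Monotone s
  eq_zero : ∀ t ≤ 0, s t = 0
  pos : ∀ t, 0 < t → 0 < s t

namespace IsRadialWeight

/-- The coefficients `a_k` of the expansion `∑ (-L)^k a_k` of the solution of
`(s h')' = - L s h`, `h(0) = 1`. -/
noncomputable def coeff (s : ℝ → ℝ) : ℕ → ℝ → ℝ
  | 0 => fun _ => 1
  -- Where `s` vanishes, on `(-∞, 0]`, division by zero gives the integrand the value `0`. So the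
  -- coefficients of positive index are `0` there, and the derivatives at `0` below are two-sided.
  | k + 1 => fun t => ∫ x in (0 : ℝ)..t, (∫ τ in (0 : ℝ)..x, s τ * coeff s k τ) / s x

/-- The solution of `(s h')' = - L s h`, `h(0) = 1`. -/
noncomputable def solution (s : ℝ → ℝ) (L t : ℝ) : ℝ := ∑' k, (-L) ^ k * coeff s k t

/-- The flux `- s h'` of the solution of `(s h')' = - L s h`, `h(0) = 1`. -/
noncomputable def flux (s : ℝ → ℝ) (L t : ℝ) : ℝ :=
  L * ∑' k, (-L) ^ k * ∫ τ in (0 : ℝ)..t, s τ * coeff s k τ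

variable {s : ℝ → ℝ}

lemma nonneg (hs : IsRadialWeight s) (t : ℝ) : 0 ≤ s t := by
  rcases le_or_gt t 0 with h | h
  · exact (hs.eq_zero t h).ge
  · exact (hs.pos t h).le

lemma integral_eq_zero (hs : IsRadialWeight s) (a : ℝ → ℝ) {t : ℝ} (ht : t ≤ 0) :
    ∫ τ in (0 : ℝ)..t, s τ * a τ = 0 := by
  rw [intervalIntegral.integral_congr (g := fun _ => (0 : ℝ))]
  · simp
  · intro x hx
    rw [Set.uIcc_of_ge ht] at hx
    simp [hs.eq_zero x hx.2]

lemma integral_bounds (hs : IsRadialWeight s) {a : ℝ → ℝ} (ha : Continuous a) {t B : ℝ}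
    (ht : 0 ≤ t) (h0 : ∀ τ, 0 ≤ a τ) (hB : ∀ τ ≤ t, a τ ≤ B) :
    0 ≤ ∫ τ in (0 : ℝ)..t, s τ * a τ ∧ ∫ τ in (0 : ℝ)..t, s τ * a τ ≤ s t * (t * B) := by
  refine ⟨intervalIntegral.integral_nonneg ht fun u _ => mul_nonneg (hs.nonneg u) (h0 u), ?_⟩
  calc ∫ τ in (0 : ℝ)..t, s τ * a τ ≤ ∫ τ in (0 : ℝ)..t, s t * B := by
        refine intervalIntegral.integral_mono_on ht
          ((hs.continuous.mul ha).intervalIntegrable _ _) (by simp) ?_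
        intro x hx
        exact mul_le_mul (hs.monotone hx.2) (hB x hx.2) (h0 x) (hs.nonneg t)
    _ = s t * (t * B) := by simp [mul_left_comm]

/-- Monotonicity of `s` bounds the integral by `s t * (t * B)`, so dividing by the degenerate weight
costs nothing. This is what tames the singular end point `0`. -/
lemma quotient_bounds (hs : IsRadialWeight s) {a : ℝ → ℝ} (ha : Continuous a) {t B : ℝ}
    (ht : 0 ≤ t) (h0 : ∀ τ, 0 ≤ a τ) (hB : ∀ τ ≤ t, a τ ≤ B) :
    0 ≤ (∫ τ in (0 : ℝ)..t, s τ * a τ) / s t ∧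
      (∫ τ in (0 : ℝ)..t, s τ * a τ) / s t ≤ t * B := by
  have h := hs.integral_bounds ha ht h0 hB
  refine ⟨div_nonneg h.1 (hs.nonneg t), ?_⟩
  exact div_le_of_le_mul₀ (hs.nonneg t) (mul_nonneg ht ((h0 t).trans (hB t le_rfl)))
    (by linarith [h.2])

lemma continuous_quotient (hs : IsRadialWeight s) {a : ℝ → ℝ} (ha : Continuous a)
    (h0 : ∀ τ, 0 ≤ a τ) (hB : ∀ R : ℝ, 0 ≤ R → ∃ B, ∀ τ ≤ R, a τ ≤ B) :
    Continuous fun t => (∫ τ in (0 : ℝ)..t, s τ * a τ) / s t := by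
  have hc : Continuous fun t => ∫ τ in (0 : ℝ)..t, s τ * a τ :=
    intervalIntegral.continuous_primitive
      (fun _ _ => (hs.continuous.mul ha).intervalIntegrable _ _) 0
  rw [continuous_iff_continuousAt]
  intro t
  rcases lt_trichotomy t 0 with ht | rfl | ht
  · refine (continuousAt_const (y := (0 : ℝ))).congr ?_
    filter_upwards [Iio_mem_nhds ht] with x hx
    rw [hs.integral_eq_zero a (le_of_lt hx), zero_div]
  · obtain ⟨B, hB⟩ := hB 1 zero_le_one
    have h00 : (∫ τ in (0 : ℝ)..0, s τ * a τ) / s 0 = 0 := by simp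
    rw [ContinuousAt, h00]
    have hlim : Tendsto (fun t : ℝ => |t| * B) (𝓝 0) (𝓝 0) := by
      have : Continuous fun t : ℝ => |t| * B := by fun_prop
      simpa using this.tendsto 0
    refine squeeze_zero_norm' ?_ hlim
    filter_upwards [Iio_mem_nhds (zero_lt_one' ℝ)] with x hx
    rcases le_or_gt x 0 with h | h
    · rw [hs.integral_eq_zero a h, zero_div, norm_zero]
      exact mul_nonneg (abs_nonneg _) ((h0 0).trans (hB 0 zero_le_one))
    · have := hs.quotient_bounds ha h.le h0 (fun τ hτ => hB τ (hτ.trans (le_of_lt hx)))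
      rw [Real.norm_of_nonneg this.1, abs_of_pos h]
      exact this.2
  · exact hc.continuousAt.div hs.continuous.continuousAt (hs.pos t ht).ne'

/-- Each recursion step gains two powers of `t` and a factor `1 / (2k + 2)`. Keeping only `1 / (k +
1)` already gives the factorial, hence convergence for every `L`. -/
lemma coeff_spec (hs : IsRadialWeight s) (k : ℕ) :
    Continuous (coeff s k) ∧ (∀ t, 0 ≤ coeff s k t) ∧
      ∀ R : ℝ, 0 ≤ R → ∀ t ≤ R, coeff s k t ≤ (R ^ 2) ^ k / k.factorial := by
  induction k with
  | zero => simp [coeff, continuous_const]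
  | succ k ih =>
    obtain ⟨hc, h0, hB⟩ := ih
    have hq := hs.continuous_quotient hc h0 (fun R hR => ⟨_, hB R hR⟩)
    have hneg : ∀ x ≤ 0, (∫ τ in (0 : ℝ)..x, s τ * coeff s k τ) / s x = 0 := fun x hx => by
      rw [hs.integral_eq_zero _ hx, zero_div]
    have hnn : ∀ x, 0 ≤ (∫ τ in (0 : ℝ)..x, s τ * coeff s k τ) / s x := fun x => by
      rcases le_or_gt x 0 with h | h
      · exact (hneg x h).ge
      · exact (hs.quotient_bounds hc h.le h0 (hB x h.le)).1
    have hz : ∀ t ≤ 0, coeff s (k + 1) t = 0 := fun t ht => by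
      simp only [coeff]
      rw [intervalIntegral.integral_congr (g := fun _ => (0 : ℝ))]
      · simp
      · intro x hx
        rw [Set.uIcc_of_ge ht] at hx
        exact hneg x hx.2
    refine ⟨?_, fun t => ?_, fun R hR t htR => ?_⟩
    · exact intervalIntegral.continuous_primitive (fun _ _ => hq.intervalIntegrable _ _) 0
    · rcases le_or_gt t 0 with h | h
      · exact (hz t h).ge
      · exact intervalIntegral.integral_nonneg h.le fun x _ => hnn x
    · rcases le_or_gt t 0 with h | h
      · rw [hz t h]; positivity
      · have h1 : coeff s (k + 1) t ≤ ∫ x in (0 : ℝ)..t, x ^ (2 * k + 1) / k.factorial := by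
          refine intervalIntegral.integral_mono_on h.le (hq.intervalIntegrable _ _)
            ((by fun_prop : Continuous fun x : ℝ =>
              x ^ (2 * k + 1) / (k.factorial : ℝ)).intervalIntegrable _ _) ?_
          intro x hx
          refine (hs.quotient_bounds hc hx.1 h0 (hB x hx.1)).2.trans (le_of_eq ?_)
          rw [← pow_mul]; ring
        refine h1.trans ?_
        rw [intervalIntegral.integral_div, integral_pow, Nat.factorial_succ]
        have h2 : t ^ (2 * k + 1 + 1) ≤ (R ^ 2) ^ (k + 1) := by
          rw [← pow_mul]
          exact pow_le_pow_left₀ h.le htR _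
        push_cast
        rw [zero_pow (by omega), sub_zero, div_div]
        have hf : (0 : ℝ) < k.factorial := by positivity
        refine div_le_div₀ (by positivity) h2 (by positivity) ?_
        have hk : (0 : ℝ) ≤ k := by positivity
        nlinarith

lemma continuous_coeff (hs : IsRadialWeight s) (k : ℕ) : Continuous (coeff s k) :=
  (hs.coeff_spec k).1

lemma coeff_nonneg (hs : IsRadialWeight s) (k : ℕ) (t : ℝ) : 0 ≤ coeff s k t :=
  (hs.coeff_spec k).2.1 t

lemma coeff_le (hs : IsRadialWeight s) (k : ℕ) {R t : ℝ} (hR : 0 ≤ R) (h : t ≤ R) :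
    coeff s k t ≤ (R ^ 2) ^ k / k.factorial :=
  (hs.coeff_spec k).2.2 R hR t h

lemma summable_bound (L R : ℝ) : Summable fun k : ℕ => |L| ^ k * ((R ^ 2) ^ k / k.factorial) := by
  have := Real.summable_pow_div_factorial (|L| * R ^ 2)
  refine this.congr fun k => ?_
  rw [mul_pow, mul_div_assoc]

lemma norm_term_le {L B x y : ℝ} (hL : |L| ≤ B) (k : ℕ) (h0 : 0 ≤ x) (h1 : x ≤ y) :
    ‖(-L) ^ k * x‖ ≤ |B| ^ k * y := by
  rw [norm_mul, norm_pow, norm_neg, Real.norm_eq_abs, Real.norm_of_nonneg h0]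
  have : |L| ≤ |B| := hL.trans (le_abs_self B)
  exact mul_le_mul (pow_le_pow_left₀ (abs_nonneg L) this k) h1 h0 (by positivity)

lemma quotient_coeff_bounds (hs : IsRadialWeight s) (k : ℕ) {R t : ℝ} (hR : 0 ≤ R) (h : t ≤ R) :
    0 ≤ (∫ τ in (0 : ℝ)..t, s τ * coeff s k τ) / s t ∧
      (∫ τ in (0 : ℝ)..t, s τ * coeff s k τ) / s t ≤ R * ((R ^ 2) ^ k / k.factorial) := by
  rcases le_or_gt t 0 with ht | ht
  · rw [hs.integral_eq_zero _ ht, zero_div]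
    exact ⟨le_rfl, by positivity⟩
  · have h1 := hs.quotient_bounds (hs.continuous_coeff k) ht.le (hs.coeff_nonneg k)
      (fun τ hτ => hs.coeff_le k hR (hτ.trans h))
    exact ⟨h1.1, h1.2.trans (mul_le_mul_of_nonneg_right h (by positivity))⟩

/-- Joint continuity in `L` and `t` is what makes the set of zeros compact in the choice of the
eigenvalue. -/
lemma continuousOn_solution (hs : IsRadialWeight s) {B R : ℝ} (hR : 0 ≤ R) :
    ContinuousOn (fun p : ℝ × ℝ => solution s p.1 p.2) {p | |p.1| ≤ B ∧ p.2 ≤ R} := by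
  refine continuousOn_tsum (fun k => ?_) (summable_bound B R) ?_
  · have := hs.continuous_coeff k
    fun_prop
  · rintro k ⟨L, t⟩ ⟨h1, h2⟩
    exact norm_term_le h1 k (hs.coeff_nonneg k t) (hs.coeff_le k hR h2)

lemma hasDerivAt_flux (hs : IsRadialWeight s) (L t : ℝ) :
    HasDerivAt (flux s L) (L * (s t * solution s L t)) t := by
  obtain ⟨R, hR0, hR⟩ : ∃ R : ℝ, 0 < R ∧ t < R := ⟨max t 0 + 1, by positivity, by
    linarith [le_max_left t 0]⟩
  -- Termwise differentiation on the half-line below `R`, where the coefficients have common bounds.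
  -- It contains `0`, at which every term vanishes.
  have key := hasDerivAt_tsum_of_isPreconnected (𝕜 := ℝ)
    (g := fun k t => (-L) ^ k * ∫ τ in (0 : ℝ)..t, s τ * coeff s k τ)
    (g' := fun k t => (-L) ^ k * (s t * coeff s k t))
    (u := fun k => |(|L|)| ^ k * (s R * ((R ^ 2) ^ k / k.factorial))) (t := Set.Iio R) (y := t)
    (y₀ := 0) ?_ isOpen_Iio isPreconnected_Iio ?_ ?_ hR0 ?_ hR
  · rw [show s t * solution s L t = ∑' k, (-L) ^ k * (s t * coeff s k t) by
      rw [solution, ← tsum_mul_left]; congr 1; ext k; ring]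
    exact key.const_mul L
  · refine ((summable_bound (|L|) R).mul_left (s R)).congr fun k => ?_
    ring
  · intro k y _
    refine HasDerivAt.const_mul _ ?_
    have hc := hs.continuous.mul (hs.continuous_coeff k)
    exact intervalIntegral.integral_hasDerivAt_right (hc.intervalIntegrable _ _)
      hc.stronglyMeasurable.stronglyMeasurableAtFilter hc.continuousAt
  · intro k y hy
    refine norm_term_le le_rfl k (mul_nonneg (hs.nonneg y) (hs.coeff_nonneg k y)) ?_
    exact mul_le_mul (hs.monotone (le_of_lt hy)) (hs.coeff_le k hR0.le (le_of_lt hy))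
      (hs.coeff_nonneg k y) (hs.nonneg R)
  · simp

/-- Splitting off the constant term matches the derivative of coefficient `k + 1` with the `k`-th
term of the flux. -/
lemma solution_eq (hs : IsRadialWeight s) (L t : ℝ) :
    solution s L t = 1 - L * ∑' k, (-L) ^ k * coeff s (k + 1) t := by
  have hsum : Summable fun k => (-L) ^ k * coeff s k t := by
    refine Summable.of_norm_bounded (summable_bound (|L|) (max t 0)) fun k => ?_
    exact norm_term_le le_rfl k (hs.coeff_nonneg k t)
      (hs.coeff_le k (le_max_right t 0) (le_max_left t 0))
  rw [solution, hsum.tsum_eq_zero_add, ← tsum_mul_left, sub_eq_add_neg, ← tsum_neg]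
  congr 1
  · simp [coeff]
  · congr 1
    ext k
    ring

lemma hasDerivAt_solution (hs : IsRadialWeight s) (L t : ℝ) :
    HasDerivAt (solution s L) (-(flux s L t / s t)) t := by
  obtain ⟨R, hR0, hR⟩ : ∃ R : ℝ, 0 < R ∧ t < R := ⟨max t 0 + 1, by positivity, by
    linarith [le_max_left t 0]⟩
  have key := hasDerivAt_tsum_of_isPreconnected (𝕜 := ℝ)
    (g := fun k t => (-L) ^ k * coeff s (k + 1) t)
    (g' := fun k t => (-L) ^ k * ((∫ τ in (0 : ℝ)..t, s τ * coeff s k τ) / s t))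
    (u := fun k => |(|L|)| ^ k * (R * ((R ^ 2) ^ k / k.factorial))) (t := Set.Iio R) (y := t)
    (y₀ := 0) ?_ isOpen_Iio isPreconnected_Iio ?_ ?_ hR0 ?_ hR
  · rw [show solution s L = fun t => 1 - L * ∑' k, (-L) ^ k * coeff s (k + 1) t from
      funext (hs.solution_eq L)]
    refine ((key.const_mul L).const_sub 1).congr_deriv ?_
    rw [flux, mul_div_assoc, ← tsum_div_const]
    simp only [mul_div_assoc]
  · refine ((summable_bound (|L|) R).mul_left R).congr fun k => ?_
    ring
  · intro k y _
    refine HasDerivAt.const_mul _ ?_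
    have hc := hs.continuous_quotient (hs.continuous_coeff k) (hs.coeff_nonneg k)
      (fun R hR => ⟨_, fun τ hτ => hs.coeff_le k hR hτ⟩)
    exact intervalIntegral.integral_hasDerivAt_right (hc.intervalIntegrable _ _)
      hc.stronglyMeasurable.stronglyMeasurableAtFilter hc.continuousAt
  · intro k y hy
    have := hs.quotient_coeff_bounds k hR0.le (le_of_lt hy)
    exact norm_term_le le_rfl k this.1 this.2
  · simp [coeff]

lemma solution_zero_right (hs : IsRadialWeight s) (L : ℝ) : solution s L 0 = 1 := by
  rw [hs.solution_eq]
  simp [coeff]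

lemma solution_zero_left (hs : IsRadialWeight s) (t : ℝ) : solution s 0 t = 1 := by
  rw [hs.solution_eq]
  simp

lemma flux_zero_right (L : ℝ) : flux s L 0 = 0 := by simp [flux]

end IsRadialWeight

/-! ### Picone's inequality for Lipschitz functions on an interval. -/

lemma LipschitzOnWith.intervalIntegrable_mul_deriv_sq {a f : ℝ → ℝ} {ε R : ℝ} {K : NNReal}
    (hεR : ε ≤ R) (ha : ContinuousOn a (Set.Icc ε R)) (hf : LipschitzOnWith K f (Set.Icc ε R)) :
    IntervalIntegrable (fun t => a t * deriv f t ^ 2) volume ε R := by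
  have hac := (LipschitzOnWith.absolutelyContinuousOnInterval (f := f) (a := ε) (b := R) (K := K)
    (by rwa [Set.uIcc_of_le hεR]))
  have h1 := hac.intervalIntegrable_deriv
  refine IntervalIntegrable.continuousOn_mul (g := a) ?_ (by rwa [Set.uIcc_of_le hεR])
  rw [intervalIntegrable_iff_integrableOn_Ioo_of_le hεR] at h1 ⊢
  simp only [pow_two]
  refine h1.bdd_mul (c := K) h1.aestronglyMeasurable ?_
  filter_upwards [ae_restrict_mem measurableSet_Ioo] with x hx
  exact norm_deriv_le_of_lipschitzOn (Icc_mem_nhds hx.1 hx.2) hf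

/-- **Picone's inequality** on an interval: a positive solution of `(a h')' = - L b h`,
nonincreasing at the left end point, bounds the Rayleigh quotients of the functions which vanish
at the right end point. -/
theorem picone_inequality {a b h P f : ℝ → ℝ} {L ε R : ℝ} {K : NNReal} (hεR : ε ≤ R)
    (ha : ContinuousOn a (Set.Icc ε R)) (ha0 : ∀ t ∈ Set.Icc ε R, 0 < a t)
    (hb : ContinuousOn b (Set.Icc ε R))
    (hh : ∀ t ∈ Set.Icc ε R, HasDerivAt h (-(P t / a t)) t)
    (hP : ∀ t ∈ Set.Icc ε R, HasDerivAt P (L * (b t * h t)) t)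
    (hpos : ∀ t ∈ Set.Icc ε R, 0 < h t) (hP0 : 0 ≤ P ε)
    (hf : LipschitzOnWith K f (Set.Icc ε R)) (hfR : f R = 0) :
    ∫ t in ε..R, L * (b t * f t ^ 2) ≤ ∫ t in ε..R, a t * deriv f t ^ 2 := by
  have huIcc : Set.uIcc ε R = Set.Icc ε R := Set.uIcc_of_le hεR
  have hhc : ContinuousOn h (Set.Icc ε R) := fun t ht =>
    (hh t ht).continuousAt.continuousWithinAt
  have hPc : ContinuousOn P (Set.Icc ε R) := fun t ht =>
    (hP t ht).continuousAt.continuousWithinAt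
  -- `v = P / h = -a h' / h` solves the Riccati equation `v' = L b + v² / a`.
  have hv : ∀ t ∈ Set.Icc ε R, HasDerivAt (fun t => P t / h t)
      (L * b t + P t ^ 2 / (a t * h t ^ 2)) t := by
    intro t ht
    have hane := (ha0 t ht).ne'
    have hhne := (hpos t ht).ne'
    refine ((hP t ht).div (hh t ht) hhne).congr_deriv ?_
    field_simp
    ring
  have hv'c : ContinuousOn (fun t => L * b t + P t ^ 2 / (a t * h t ^ 2)) (Set.Icc ε R) := by
    refine (continuousOn_const.mul hb).add ((hPc.pow 2).div (ha.mul (hhc.pow 2)) ?_)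
    intro t ht
    have := ha0 t ht
    have := hpos t ht
    positivity
  obtain ⟨C, hC⟩ := isCompact_Icc.exists_bound_of_continuousOn hv'c
  have hvL : LipschitzOnWith (Real.toNNReal C) (fun t => P t / h t) (Set.Icc ε R) := by
    refine (convex_Icc ε R).lipschitzOnWith_of_nnnorm_hasDerivWithin_le
      (fun t ht => (hv t ht).hasDerivWithinAt) fun t ht => ?_
    rw [← NNReal.coe_le_coe, coe_nnnorm]
    exact (hC t ht).trans (Real.le_coe_toNNReal C)
  have hfac := LipschitzOnWith.absolutelyContinuousOnInterval (f := f) (a := ε) (b := R) (K := K)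
    (by rwa [huIcc])
  have hvac := LipschitzOnWith.absolutelyContinuousOnInterval (f := fun t => P t / h t)
    (a := ε) (b := R) (K := Real.toNNReal C) (by rwa [huIcc])
  -- As `f` is only Lipschitz, `f² v` is integrated as an absolutely continuous function.
  have hac := (hfac.mul hfac).mul hvac
  have hFTC := hac.integral_deriv_eq_sub
  -- The boundary term at `R` vanishes with `f`, and the one at `ε` has a sign because `v ε ≥ 0`.
  have hle : ∫ t in ε..R, deriv (f * f * fun t => P t / h t) t ≤ 0 := by
    rw [hFTC]
    simp only [Pi.mul_apply, hfR]
    have h1 := div_nonneg hP0 (hpos ε ⟨le_rfl, hεR⟩).le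
    nlinarith [mul_nonneg (mul_self_nonneg (f ε)) h1]
  have hfc : ContinuousOn f (Set.Icc ε R) := hf.continuousOn
  have hi1 : IntervalIntegrable (fun t => L * (b t * f t ^ 2)) volume ε R := by
    refine ContinuousOn.intervalIntegrable ?_
    rw [huIcc]
    exact continuousOn_const.mul (hb.mul (hfc.pow 2))
  have hi2 := hf.intervalIntegrable_mul_deriv_sq hεR ha
  have hi3 := hac.intervalIntegrable_deriv
  suffices hmono : ∫ t in ε..R, (L * (b t * f t ^ 2) - a t * deriv f t ^ 2) ≤
      ∫ t in ε..R, deriv (f * f * fun t => P t / h t) t by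
    rw [intervalIntegral.integral_sub hi1 hi2] at hmono
    linarith
  refine intervalIntegral.integral_mono_ae_restrict hεR (hi1.sub hi2) hi3 ?_
  filter_upwards [ae_restrict_mem measurableSet_Icc, ae_restrict_of_ae hfac.ae_differentiableAt]
    with t ht hd
  have hft := (hd (by rwa [huIcc])).hasDerivAt
  have hΨ := (hft.mul hft).mul (hv t ht)
  rw [hΨ.deriv]
  have hat := ha0 t ht
  have hht := hpos t ht
  have hsq : 0 ≤ (a t * deriv f t + f t * (P t / h t)) ^ 2 / a t := by positivity
  -- Completing the square: `(f² v)' = L b f² - a f'² + (a f' + f v)² / a`.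
  have heq : (deriv f t * f t + f t * deriv f t) * (P t / h t) +
      (f * f) t * (L * b t + P t ^ 2 / (a t * h t ^ 2)) -
      (L * (b t * f t ^ 2) - a t * deriv f t ^ 2) =
      (a t * deriv f t + f t * (P t / h t)) ^ 2 / a t := by
    simp only [Pi.mul_apply]
    field_simp
    ring
  linarith

theorem picone_inequality_lintegral {a b h P f : ℝ → ℝ} {L ε R : ℝ} {K : NNReal} (hεR : ε ≤ R)
    (hL : 0 ≤ L)
    (ha : ContinuousOn a (Set.Icc ε R)) (ha0 : ∀ t ∈ Set.Icc ε R, 0 < a t)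
    (hb : ContinuousOn b (Set.Icc ε R)) (hb0 : ∀ t ∈ Set.Icc ε R, 0 ≤ b t)
    (hh : ∀ t ∈ Set.Icc ε R, HasDerivAt h (-(P t / a t)) t)
    (hP : ∀ t ∈ Set.Icc ε R, HasDerivAt P (L * (b t * h t)) t)
    (hpos : ∀ t ∈ Set.Icc ε R, 0 < h t) (hP0 : 0 ≤ P ε)
    (hf : LipschitzOnWith K f (Set.Icc ε R)) (hfR : f R = 0) :
    ∫⁻ t in Set.Ioc ε R, ENNReal.ofReal (L * (b t * f t ^ 2)) ≤
      ∫⁻ t in Set.Ioc ε R, ENNReal.ofReal (a t * deriv f t ^ 2) := by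
  have hi1 : IntervalIntegrable (fun t => L * (b t * f t ^ 2)) volume ε R := by
    refine ContinuousOn.intervalIntegrable ?_
    rw [Set.uIcc_of_le hεR]
    exact continuousOn_const.mul (hb.mul (hf.continuousOn.pow 2))
  have hi2 := hf.intervalIntegrable_mul_deriv_sq hεR ha
  rw [← ofReal_integral_eq_lintegral_ofReal hi1.1, ← ofReal_integral_eq_lintegral_ofReal hi2.1]
  · refine ENNReal.ofReal_le_ofReal ?_
    rw [← intervalIntegral.integral_of_le hεR, ← intervalIntegral.integral_of_le hεR]
    exact picone_inequality hεR ha ha0 hb hh hP hpos hP0 hf hfR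
  · filter_upwards [ae_restrict_mem measurableSet_Ioc] with t ht
    exact mul_nonneg (ha0 t (Set.Ioc_subset_Icc_self ht)).le (sq_nonneg _)
  · filter_upwards [ae_restrict_mem measurableSet_Ioc] with t ht
    exact mul_nonneg hL (mul_nonneg (hb0 t (Set.Ioc_subset_Icc_self ht)) (sq_nonneg _))

/-! ### Existence of the radial ground state. -/

/-- `h` is a positive solution on `[0, r)` of `(s h')' = - L s h`, `h 0 = 1`, `h r = 0`, and
`P = - s h'`. -/
structure IsRadialGroundState (s : ℝ → ℝ) (r L : ℝ) (h P : ℝ → ℝ) : Prop where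
  pos_eigenvalue : 0 < L
  map_zero : h 0 = 1
  map_radius : h r = 0
  pos : ∀ t ∈ Set.Ico 0 r, 0 < h t
  hasDerivAt : ∀ t, HasDerivAt h (-(P t / s t)) t
  flux_zero : P 0 = 0
  hasDerivAt_flux : ∀ t, HasDerivAt P (L * (s t * h t)) t

namespace IsRadialWeight

variable {s : ℝ → ℝ}

lemma monotoneOn_flux (hs : IsRadialWeight s) {L r : ℝ} (hL : 0 ≤ L)
    (h : ∀ t ∈ Set.Icc 0 r, 0 ≤ solution s L t) : MonotoneOn (flux s L) (Set.Icc 0 r) := by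
  refine monotoneOn_of_deriv_nonneg (convex_Icc 0 r)
    (fun t _ => (hs.hasDerivAt_flux L t).continuousAt.continuousWithinAt)
    (fun t _ => (hs.hasDerivAt_flux L t).differentiableAt.differentiableWithinAt) ?_
  intro t ht
  rw [interior_Icc] at ht
  rw [(hs.hasDerivAt_flux L t).deriv]
  exact mul_nonneg hL (mul_nonneg (hs.nonneg t) (h t ⟨ht.1.le, ht.2.le⟩))

/-- By Picone, a positive solution makes `L` a lower bound for Rayleigh quotients, and that of `r -
t` does not depend on `L`. The interval `[r / 2, r]` keeps the weight positive. -/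
lemma exists_bound_of_pos (hs : IsRadialWeight s) {r : ℝ} (hr : 0 < r) :
    ∃ B : ℝ, ∀ L, 0 ≤ L → (∀ t ∈ Set.Icc 0 r, 0 < solution s L t) → L ≤ B := by
  refine ⟨(∫ t in r / 2..r, s t) / ∫ t in r / 2..r, s t * (r - t) ^ 2, fun L hL hpos => ?_⟩
  have hr2 : r / 2 ≤ r := by linarith
  have hsub : Set.Icc (r / 2) r ⊆ Set.Icc 0 r := Set.Icc_subset_Icc_left (by linarith)
  have hsp : ∀ t ∈ Set.Icc (r / 2) r, 0 < s t := fun t ht => hs.pos t (by linarith [ht.1])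
  have key := picone_inequality (a := s) (b := s) (h := solution s L) (P := flux s L)
    (f := fun t => r - t) (K := 1) (L := L) hr2
    hs.continuous.continuousOn hsp hs.continuous.continuousOn (fun t _ => hs.hasDerivAt_solution L t)
    (fun t _ => hs.hasDerivAt_flux L t) (fun t ht => hpos t (hsub ht)) ?_ ?_ (sub_self r)
  · have hd : ∀ t, deriv (fun t : ℝ => r - t) t = -1 := fun t => by simp
    simp only [hd, intervalIntegral.integral_const_mul] at key
    have hp : 0 < ∫ t in r / 2..r, s t * (r - t) ^ 2 := by
      refine intervalIntegral.intervalIntegral_pos_of_pos_on ?_ ?_ (by linarith)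
      · have := hs.continuous
        exact Continuous.intervalIntegrable (by fun_prop) _ _
      · intro x hx
        have h1 := hsp x ⟨hx.1.le, hx.2.le⟩
        have h2 : 0 < r - x := by linarith [hx.2]
        positivity
    rw [le_div_iff₀ hp]
    simpa using key
  · have := hs.monotoneOn_flux hL (fun t ht => (hpos t ht).le)
      (Set.left_mem_Icc.2 hr.le) (hsub (Set.left_mem_Icc.2 hr2)) (by linarith)
    rwa [flux_zero_right] at this
  · refine LipschitzWith.lipschitzOnWith (LipschitzWith.of_dist_le_mul fun x y => ?_)
    rw [Real.dist_eq, Real.dist_eq, show r - x - (r - y) = -(x - y) by ring, abs_neg]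
    simp

/-- Existence of the first radial Dirichlet eigenfunction. -/
theorem exists_groundState (hs : IsRadialWeight s) {r : ℝ} (hr : 0 < r) :
    ∃ L h P, IsRadialGroundState s r L h P := by
  obtain ⟨B₀, hB₀⟩ := hs.exists_bound_of_pos hr
  set B := max B₀ 0 + 1 with hB
  have hBpos : 0 < B := by positivity
  have hcont := hs.continuousOn_solution (B := B) hr.le
  have hsub : Set.Icc (0 : ℝ) B ×ˢ Set.Icc 0 r ⊆ {p : ℝ × ℝ | |p.1| ≤ B ∧ p.2 ≤ r} := by
    rintro ⟨L, t⟩ ⟨h1, h2⟩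
    exact ⟨by rw [abs_of_nonneg h1.1]; exact h1.2, h2.2⟩
  -- The eigenvalue is the least `L` for which the solution fails to be positive somewhere on `[0,
  -- r]`. Such `L` exist because `B` exceeds the bound `B₀` for positive solutions.
  set K := (Set.Icc (0 : ℝ) B ×ˢ Set.Icc 0 r) ∩
    (fun p : ℝ × ℝ => solution s p.1 p.2) ⁻¹' Set.Iic 0 with hK
  have hKc : IsCompact K := by
    refine (isCompact_Icc.prod isCompact_Icc).of_isClosed_subset ?_ Set.inter_subset_left
    exact (hcont.mono hsub).preimage_isClosed_of_isClosed
      (isClosed_Icc.prod isClosed_Icc) isClosed_Iic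
  have hKne : K.Nonempty := by
    by_contra hne
    rw [Set.not_nonempty_iff_eq_empty] at hne
    have := hB₀ B hBpos.le fun t ht => by
      by_contra hcon
      have : (B, t) ∈ K := ⟨⟨⟨hBpos.le, le_rfl⟩, ht⟩, not_lt.1 hcon⟩
      simp [hne] at this
    linarith [le_max_left B₀ 0]
  obtain ⟨⟨L, t₁⟩, hmem, hmin⟩ := hKc.exists_isMinOn hKne continuous_fst.continuousOn
  have hlt : ∀ L' ∈ Set.Ico 0 L, ∀ t ∈ Set.Icc 0 r, 0 < solution s L' t := by
    intro L' hL' t ht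
    by_contra hcon
    have : (L', t) ∈ K := ⟨⟨⟨hL'.1, hL'.2.le.trans hmem.1.1.2⟩, ht⟩, not_lt.1 hcon⟩
    have := hmin this
    simp only [Set.mem_ofPred_eq] at this
    linarith [hL'.2]
  have hL0 : 0 < L := by
    refine lt_of_le_of_ne hmem.1.1.1 fun h0 => ?_
    have := hmem.2
    simp only [Set.mem_preimage, ← h0, hs.solution_zero_left, Set.mem_Iic] at this
    linarith
  -- Nonnegativity is the limit of positivity as `L'` increases to `L`.
  have hnn : ∀ t ∈ Set.Icc 0 r, 0 ≤ solution s L t := by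
    intro t ht
    have hcl : closure (Set.Ico 0 L) = Set.Icc 0 L := closure_Ico hL0.ne
    refine le_on_closure (s := Set.Ico 0 L) (f := fun _ => (0 : ℝ)) (g := fun L' => solution s L' t)
      (fun L' hL' => (hlt L' hL' t ht).le) continuousOn_const ?_ (x := L)
      (by rw [hcl]; exact ⟨hL0.le, le_rfl⟩)
    rw [hcl]
    refine ContinuousOn.comp (g := fun p : ℝ × ℝ => solution s p.1 p.2) (f := fun L' => (L', t))
      (hcont.mono hsub) (by fun_prop) ?_
    intro L' hL'
    exact ⟨⟨hL'.1, hL'.2.trans hmem.1.1.2⟩, ht⟩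
  have hmono := hs.monotoneOn_flux hL0.le hnn
  -- A zero before `r` would be a local minimum, so the flux would vanish there. Being monotone and
  -- zero at `0`, the flux would vanish on all of `[0, t]`, and the solution could not drop from `1`
  -- to `0`.
  have hzero : ∀ t ∈ Set.Icc 0 r, solution s L t = 0 → t = r := by
    intro t ht h0
    by_contra hne
    have htr : t < r := lt_of_le_of_ne ht.2 hne
    have ht0 : 0 < t := by
      refine lt_of_le_of_ne ht.1 fun h => ?_
      rw [← h, hs.solution_zero_right] at h0
      exact one_ne_zero h0
    have hlocal : IsLocalMin (solution s L) t := by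
      filter_upwards [Icc_mem_nhds ht0 htr] with x hx
      rw [h0]
      exact hnn x hx
    have hd := hlocal.hasDerivAt_eq_zero (hs.hasDerivAt_solution L t)
    have hfl : flux s L t = 0 := by
      simpa [(hs.pos t ht0).ne'] using hd
    obtain ⟨c, hc, hslope⟩ := exists_hasDerivAt_eq_slope (solution s L) _ ht0
      (fun x _ => (hs.hasDerivAt_solution L x).continuousAt.continuousWithinAt)
      (fun x _ => hs.hasDerivAt_solution L x)
    have hcI : c ∈ Set.Icc 0 r := ⟨hc.1.le, (hc.2.trans htr).le⟩
    have h1 := hmono (Set.left_mem_Icc.2 hr.le) hcI hc.1.le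
    have h2 := hmono hcI ht hc.2.le
    rw [flux_zero_right] at h1
    rw [hfl] at h2
    rw [le_antisymm h2 h1, h0, hs.solution_zero_right, zero_div, neg_zero, zero_sub, sub_zero,
      eq_comm, div_eq_zero_iff] at hslope
    rcases hslope with h | h
    · norm_num at h
    · exact ht0.ne' h
  have ht₁ : solution s L t₁ = 0 := le_antisymm hmem.2 (hnn t₁ hmem.1.2)
  refine ⟨L, solution s L, flux s L, hL0, hs.solution_zero_right L, ?_, ?_,
    hs.hasDerivAt_solution L, flux_zero_right L, hs.hasDerivAt_flux L⟩
  · rw [← hzero t₁ hmem.1.2 ht₁, ht₁]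
  · intro t ht
    refine lt_of_le_of_ne (hnn t ⟨ht.1, ht.2.le⟩) fun h0 => ?_
    exact ht.2.ne (hzero t ⟨ht.1, ht.2.le⟩ h0.symm)

end IsRadialWeight

/-! ### Monotonicity of the ground state and the sign of `L h² - h'²`. -/

namespace IsRadialGroundState

variable {s h P : ℝ → ℝ} {r L : ℝ}

lemma continuous (hg : IsRadialGroundState s r L h P) : Continuous h :=
  continuous_iff_continuousAt.2 fun t => (hg.hasDerivAt t).continuousAt

lemma continuous_flux (hg : IsRadialGroundState s r L h P) : Continuous P :=
  continuous_iff_continuousAt.2 fun t => (hg.hasDerivAt_flux t).continuousAt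

lemma nonneg (hg : IsRadialGroundState s r L h P) {t : ℝ} (ht : t ∈ Set.Icc 0 r) : 0 ≤ h t := by
  rcases ht.2.eq_or_lt with h1 | h1
  · rw [h1, hg.map_radius]
  · exact (hg.pos t ⟨ht.1, h1⟩).le

lemma strictMonoOn_flux (hg : IsRadialGroundState s r L h P) (hs : IsRadialWeight s) :
    StrictMonoOn P (Set.Icc 0 r) := by
  refine strictMonoOn_of_deriv_pos (convex_Icc 0 r) hg.continuous_flux.continuousOn fun t ht => ?_
  rw [interior_Icc] at ht
  rw [(hg.hasDerivAt_flux t).deriv]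
  exact mul_pos hg.pos_eigenvalue (mul_pos (hs.pos t ht.1) (hg.pos t ⟨ht.1.le, ht.2⟩))

lemma flux_pos (hg : IsRadialGroundState s r L h P) (hs : IsRadialWeight s) {t : ℝ}
    (ht : t ∈ Set.Ioc 0 r) : 0 < P t := by
  have := hg.strictMonoOn_flux hs (Set.left_mem_Icc.2 (ht.1.le.trans ht.2)) ⟨ht.1.le, ht.2⟩ ht.1
  rwa [hg.flux_zero] at this

lemma flux_nonneg (hg : IsRadialGroundState s r L h P) (hs : IsRadialWeight s) {t : ℝ}
    (ht : t ∈ Set.Icc 0 r) : 0 ≤ P t := by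
  rcases ht.1.eq_or_lt with h1 | h1
  · rw [← h1, hg.flux_zero]
  · exact (hg.flux_pos hs ⟨h1, ht.2⟩).le

lemma antitoneOn (hg : IsRadialGroundState s r L h P) (hs : IsRadialWeight s) :
    AntitoneOn h (Set.Icc 0 r) := by
  refine antitoneOn_of_deriv_nonpos (convex_Icc 0 r) hg.continuous.continuousOn
    (fun t _ => (hg.hasDerivAt t).differentiableAt.differentiableWithinAt) fun t ht => ?_
  rw [interior_Icc] at ht
  rw [(hg.hasDerivAt t).deriv, neg_nonpos]
  exact div_nonneg (hg.flux_nonneg hs ⟨ht.1.le, ht.2.le⟩) (hs.nonneg t)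

lemma le_one (hg : IsRadialGroundState s r L h P) (hs : IsRadialWeight s) {t : ℝ}
    (ht : t ∈ Set.Icc 0 r) : h t ≤ 1 := by
  rw [← hg.map_zero]
  exact hg.antitoneOn hs (Set.left_mem_Icc.2 (ht.1.trans ht.2)) ht ht.1

/-- The mean value theorem applied to `P`, with `h ≤ 1` and `s` monotone. It controls `|h'| = P / s`
by `L t` up to the singular point `0`. -/
lemma flux_le (hg : IsRadialGroundState s r L h P) (hs : IsRadialWeight s) {t : ℝ}
    (ht : t ∈ Set.Icc 0 r) : P t ≤ L * t * s t := by
  rcases ht.1.eq_or_lt with h1 | h1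
  · rw [← h1, hg.flux_zero]; simp
  obtain ⟨c, hc, hslope⟩ := exists_hasDerivAt_eq_slope P _ h1
      hg.continuous_flux.continuousOn (fun x _ => hg.hasDerivAt_flux x)
  rw [hg.flux_zero, eq_div_iff (by linarith)] at hslope
  have h2 : s c * h c ≤ s t * 1 :=
    mul_le_mul (hs.monotone hc.2.le) (hg.le_one hs ⟨hc.1.le, hc.2.le.trans ht.2⟩)
      (hg.nonneg ⟨hc.1.le, hc.2.le.trans ht.2⟩) (hs.nonneg t)
  have h3 := mul_le_mul_of_nonneg_left h2 hg.pos_eigenvalue.le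
  have h4 := mul_le_mul_of_nonneg_right h3 h1.le
  linarith

lemma slope_nonneg (hg : IsRadialGroundState s r L h P) (hs : IsRadialWeight s) {t : ℝ}
    (ht : t ∈ Set.Icc 0 r) : 0 ≤ P t / s t :=
  div_nonneg (hg.flux_nonneg hs ht) (hs.nonneg t)

lemma slope_le (hg : IsRadialGroundState s r L h P) (hs : IsRadialWeight s) {t : ℝ}
    (ht : t ∈ Set.Icc 0 r) : P t / s t ≤ L * t :=
  div_le_of_le_mul₀ (hs.nonneg t) (mul_nonneg hg.pos_eigenvalue.le ht.1) (hg.flux_le hs ht)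

/-- If the weight is log-concave, there is a radius below which the mass term dominates the energy
term and beyond which it is dominated by it. -/
theorem exists_sign_change (hg : IsRadialGroundState s r L h P) (hs : IsRadialWeight s)
    (hr : 0 < r) {c c' : ℝ → ℝ} (hs' : ∀ t, 0 < t → HasDerivAt s (s t * c t) t)
    (hc' : ∀ t, 0 < t → HasDerivAt c (c' t) t) (hc0 : ∀ t, 0 < t → 0 ≤ c t)
    (hneg : ∀ t, 0 < t → c' t < 0)
    (hlim : Tendsto (fun t => t * (s t * c t)) (𝓝[>] 0) (𝓝 0)) :
    ∃ t₀ ∈ Set.Ioo 0 r, (∀ t ∈ Set.Ioo 0 t₀, (P t / s t) ^ 2 < L * h t ^ 2) ∧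
      (P t₀ / s t₀) ^ 2 = L * h t₀ ^ 2 ∧ ∀ t ∈ Set.Ioc t₀ r, L * h t ^ 2 < (P t / s t) ^ 2 := by
  have hLp := hg.pos_eigenvalue
  -- With `c = s' / s`, `Q` is `s h²` times the derivative of `-h' / h`. The equation collapses its
  -- own derivative to `-P c' h`, which is positive because `c` decreases.
  set Q : ℝ → ℝ := fun t => L * s t * h t ^ 2 - P t * c t * h t + P t ^ 2 / s t with hQ
  have hQ' : ∀ t ∈ Set.Ioo 0 r, HasDerivAt Q (-(P t * c' t * h t)) t := by
    intro t ht
    have hsne := (hs.pos t ht.1).ne'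
    refine ((((hs' t ht.1).const_mul L).mul ((hg.hasDerivAt t).pow 2)).sub
      (((hg.hasDerivAt_flux t).mul (hc' t ht.1)).mul (hg.hasDerivAt t))).add
      (((hg.hasDerivAt_flux t).pow 2).div (hs' t ht.1) hsne) |>.congr_deriv ?_
    simp only [Pi.mul_apply, Pi.pow_apply]
    field_simp
    ring
  have hQmono : StrictMonoOn Q (Set.Ioo 0 r) := by
    refine strictMonoOn_of_deriv_pos (convex_Ioo 0 r)
      (fun t ht => (hQ' t ht).continuousAt.continuousWithinAt) fun t ht => ?_
    rw [interior_Ioo] at ht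
    rw [(hQ' t ht).deriv]
    have h1 := hg.flux_pos hs ⟨ht.1, ht.2.le⟩
    have h2 := hg.pos t ⟨ht.1.le, ht.2⟩
    have h3 := mul_pos (mul_pos h1 (neg_pos.2 (hneg t ht.1))) h2
    linarith
  have hIoo : ∀ᶠ t in 𝓝[>] (0 : ℝ), t ∈ Set.Ioo 0 r := Ioo_mem_nhdsGT hr
  -- Each term is bounded through `P ≤ L t s`. The middle one becomes a multiple of `t s'(t)`, which
  -- `hlim` sends to `0`.
  have hQlim : Tendsto Q (𝓝[>] 0) (𝓝 0) := by
    have hb : Tendsto (fun t => L * s t + L * (t * (s t * c t)) + L ^ 2 * (s t * t ^ 2))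
        (𝓝[>] 0) (𝓝 0) := by
      have e1 : Tendsto s (𝓝[>] 0) (𝓝 0) := by
        have := hs.continuous.tendsto 0
        rw [hs.eq_zero 0 le_rfl] at this
        exact this.mono_left nhdsWithin_le_nhds
      have e2 : Tendsto (fun t : ℝ => t ^ 2) (𝓝[>] 0) (𝓝 0) := by
        have : Tendsto (fun t : ℝ => t ^ 2) (𝓝 0) (𝓝 (0 ^ 2)) := (continuous_pow 2).tendsto 0
        rw [zero_pow two_ne_zero] at this
        exact this.mono_left nhdsWithin_le_nhds
      simpa using ((e1.const_mul L).add (hlim.const_mul L)).add ((e1.mul e2).const_mul (L ^ 2))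
    refine squeeze_zero_norm' ?_ hb
    filter_upwards [hIoo] with t ht
    have hst := hs.pos t ht.1
    have hI : t ∈ Set.Icc 0 r := ⟨ht.1.le, ht.2.le⟩
    have hP0 := hg.flux_nonneg hs hI
    have hP1 := hg.flux_le hs hI
    have hh0 := hg.nonneg hI
    have hh1 := hg.le_one hs hI
    have hct := hc0 t ht.1
    have b1 : L * s t * h t ^ 2 ≤ L * s t :=
      mul_le_of_le_one_right (by positivity) (pow_le_one₀ hh0 hh1)
    have b2 : P t * c t * h t ≤ L * (t * (s t * c t)) := by
      calc P t * c t * h t ≤ P t * c t := mul_le_of_le_one_right (by positivity) hh1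
        _ ≤ L * t * s t * c t := mul_le_mul_of_nonneg_right hP1 hct
        _ = _ := by ring
    have b3 : P t ^ 2 / s t ≤ L ^ 2 * (s t * t ^ 2) := by
      rw [div_le_iff₀ hst]
      calc P t ^ 2 ≤ (L * t * s t) ^ 2 := pow_le_pow_left₀ hP0 hP1 2
        _ = _ := by ring
    have n1 : 0 ≤ L * s t * h t ^ 2 := by positivity
    have n2 : 0 ≤ P t * c t * h t := by positivity
    have n3 : 0 ≤ P t ^ 2 / s t := by positivity
    rw [Real.norm_eq_abs, abs_le]
    constructor <;> simp only [hQ] <;> linarith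
  have hQpos : ∀ t ∈ Set.Ioo 0 r, 0 < Q t := by
    intro t ht
    have ht2 : t / 2 ∈ Set.Ioo 0 r := ⟨by linarith [ht.1], by linarith [ht.1, ht.2]⟩
    have h1 : 0 ≤ Q (t / 2) := by
      refine le_of_tendsto hQlim ?_
      filter_upwards [Ioo_mem_nhdsGT ht2.1] with x hx
      exact (hQmono ⟨hx.1, hx.2.trans ht2.2⟩ ht2 hx.2).le
    exact h1.trans_lt (hQmono ht2 ht (by linarith [ht.1]))
  -- `ψ = -h' / h`, and on `(0, r)` the sign of `L h² - h'²` is that of `L - ψ²`.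
  set ψ : ℝ → ℝ := fun t => P t / (s t * h t) with hψ
  have hψ' : ∀ t ∈ Set.Ioo 0 r, HasDerivAt ψ (Q t / (s t * h t ^ 2)) t := by
    intro t ht
    have hsne := (hs.pos t ht.1).ne'
    have hhne := (hg.pos t ⟨ht.1.le, ht.2⟩).ne'
    refine ((hg.hasDerivAt_flux t).div ((hs' t ht.1).mul (hg.hasDerivAt t))
      (mul_ne_zero hsne hhne)).congr_deriv ?_
    simp only [Pi.mul_apply, hQ]
    field_simp
    ring
  have hψmono : StrictMonoOn ψ (Set.Ioo 0 r) := by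
    refine strictMonoOn_of_deriv_pos (convex_Ioo 0 r)
      (fun t ht => (hψ' t ht).continuousAt.continuousWithinAt) fun t ht => ?_
    rw [interior_Ioo] at ht
    rw [(hψ' t ht).deriv]
    have h1 := hs.pos t ht.1
    have h2 := hg.pos t ⟨ht.1.le, ht.2⟩
    have h3 := hQpos t ht
    positivity
  -- Near `0` one has `ψ h = P / s ≤ L t`, so this inequality puts `ψ t₁` below `√L`.
  obtain ⟨t₁, ht₁, ht₁r⟩ : ∃ t₁ ∈ Set.Ioo 0 r, √L * t₁ < h t₁ := by
    have hc : ∀ᶠ t in 𝓝[>] (0 : ℝ), √L * t < h t := by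
      have h1 : Tendsto (fun t => h t - √L * t) (𝓝 0) (𝓝 (h 0 - √L * 0)) := by
        have := hg.continuous
        exact Continuous.tendsto (by fun_prop) 0
      rw [hg.map_zero, mul_zero, sub_zero] at h1
      filter_upwards [nhdsWithin_le_nhds (h1.eventually_const_lt one_pos)] with t ht
      linarith
    exact ((hIoo.and hc).exists).imp fun t ht => ht
  have hsqrt : √L * √L = L := Real.mul_self_sqrt hLp.le
  have hsqrt0 : 0 < √L := Real.sqrt_pos.2 hLp
  have hkc : ContinuousOn (fun t => P t - √L * s t * h t) (Set.Icc t₁ r) := by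
    have := hg.continuous
    have := hg.continuous_flux
    have := hs.continuous
    exact Continuous.continuousOn (by fun_prop)
  have hk1 : P t₁ - √L * s t₁ * h t₁ < 0 := by
    have h1 := hg.flux_le hs ⟨ht₁.1.le, ht₁.2.le⟩
    have h2 := mul_lt_mul_of_pos_left ht₁r (mul_pos hsqrt0 (hs.pos t₁ ht₁.1))
    have h3 : √L * s t₁ * (√L * t₁) = L * t₁ * s t₁ := by
      linear_combination (t₁ * s t₁) * hsqrt
    linarith
  have hk2 : 0 < P r - √L * s r * h r := by
    rw [hg.map_radius, mul_zero, sub_zero]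
    exact hg.flux_pos hs ⟨hr, le_rfl⟩
  -- The crossing `ψ = √L` is found for `P - √L s h`, which stays continuous at `r`, where `h`
  -- vanishes.
  obtain ⟨t₀, ht₀, hk0⟩ := intermediate_value_Ioo ht₁.2.le hkc ⟨hk1, hk2⟩
  have ht₀I : t₀ ∈ Set.Ioo 0 r := ⟨ht₁.1.trans ht₀.1, ht₀.2⟩
  have hψ0 : ψ t₀ = √L := by
    have h1 := hs.pos t₀ ht₀I.1
    have h2 := hg.pos t₀ ⟨ht₀I.1.le, ht₀I.2⟩
    simp only [hψ]
    rw [div_eq_iff (by positivity)]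
    linarith
  have hrel : ∀ t ∈ Set.Ioo 0 r, P t / s t = ψ t * h t := by
    intro t ht
    have h1 := (hs.pos t ht.1).ne'
    have h2 := (hg.pos t ⟨ht.1.le, ht.2⟩).ne'
    simp only [hψ]
    field_simp
  have hLh : ∀ t, L * h t ^ 2 = (√L * h t) ^ 2 := fun t => by
    rw [mul_pow, Real.sq_sqrt hLp.le]
  refine ⟨t₀, ht₀I, fun t ht => ?_, by rw [hrel t₀ ht₀I, hψ0, hLh], fun t ht => ?_⟩
  · have hI : t ∈ Set.Ioo 0 r := ⟨ht.1, ht.2.trans ht₀I.2⟩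
    have h2 := hg.pos t ⟨hI.1.le, hI.2⟩
    rw [hLh]
    refine pow_lt_pow_left₀ ?_ (hg.slope_nonneg hs ⟨hI.1.le, hI.2.le⟩) two_ne_zero
    rw [hrel t hI, ← hψ0]
    exact mul_lt_mul_of_pos_right (hψmono hI ht₀I ht.2) h2
  · rcases ht.2.eq_or_lt with h1 | h1
    · rw [h1, hg.map_radius]
      have := hg.flux_pos hs ⟨hr, le_rfl⟩
      have := hs.pos r hr
      simp only [ne_eq, OfNat.ofNat_ne_zero, not_false_eq_true, zero_pow, mul_zero]
      positivity
    · have hI : t ∈ Set.Ioo 0 r := ⟨ht₀I.1.trans ht.1, h1⟩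
      have h2 := hg.pos t ⟨hI.1.le, hI.2⟩
      rw [hLh]
      refine pow_lt_pow_left₀ ?_ (by positivity) two_ne_zero
      rw [hrel t hI, ← hψ0]
      exact mul_lt_mul_of_pos_right (hψmono ht₀I hI ht.1) h2

/-- `(h P)' = L s h² - s h'²`. -/
lemma hasDerivAt_mul_flux (hg : IsRadialGroundState s r L h P) (t : ℝ) :
    HasDerivAt (fun t => h t * P t) (L * (s t * h t ^ 2) - P t ^ 2 / s t) t := by
  refine ((hg.hasDerivAt t).mul (hg.hasDerivAt_flux t)).congr_deriv ?_
  ring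

end IsRadialGroundState

/-! ### The hyperbolic weight and integration over hyperbolic balls. -/

/-- The density `sinh^{n-1}(κ t)` of the area of hyperbolic spheres, up to a constant. -/
noncomputable def hyperbolicWeight (n : ℕ) (κ t : ℝ) : ℝ := Real.sinh (κ * max t 0) ^ (n - 1)

lemma hyperbolicWeight_of_nonneg (n : ℕ) (κ : ℝ) {t : ℝ} (ht : 0 ≤ t) :
    hyperbolicWeight n κ t = Real.sinh (κ * t) ^ (n - 1) := by
  rw [hyperbolicWeight, max_eq_left ht]

lemma isRadialWeight_hyperbolicWeight {n : ℕ} (hn : 2 ≤ n) {κ : ℝ} (hκ : 0 < κ) :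
    IsRadialWeight (hyperbolicWeight n κ) where
  continuous := by unfold hyperbolicWeight; fun_prop
  monotone := by
    intro a b hab
    refine pow_le_pow_left₀ (Real.sinh_nonneg_iff.2 (by positivity)) ?_ _
    rw [Real.sinh_le_sinh]
    exact mul_le_mul_of_nonneg_left (max_le_max_right 0 hab) hκ.le
  eq_zero := by
    intro t ht
    rw [hyperbolicWeight, max_eq_right ht, mul_zero, Real.sinh_zero, zero_pow (by omega)]
  pos := by
    intro t ht
    rw [hyperbolicWeight_of_nonneg n κ ht.le]
    exact pow_pos (Real.sinh_pos_iff.2 (mul_pos hκ ht)) _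

theorem IsRadialGroundState.exists_sign_change_hyperbolicWeight {n : ℕ} (hn : 2 ≤ n) {κ : ℝ}
    (hκ : 0 < κ) {r L : ℝ} (hr : 0 < r) {h P : ℝ → ℝ}
    (hg : IsRadialGroundState (hyperbolicWeight n κ) r L h P) :
    ∃ t₀ ∈ Set.Ioo 0 r,
      (∀ t ∈ Set.Ioo 0 t₀, (P t / hyperbolicWeight n κ t) ^ 2 < L * h t ^ 2) ∧
      (P t₀ / hyperbolicWeight n κ t₀) ^ 2 = L * h t₀ ^ 2 ∧
      ∀ t ∈ Set.Ioc t₀ r, L * h t ^ 2 < (P t / hyperbolicWeight n κ t) ^ 2 := by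
  have hn1 : (0 : ℝ) < ((n - 1 : ℕ) : ℝ) := by exact_mod_cast (by omega : 0 < n - 1)
  have hsinh : ∀ t, 0 < t → 0 < Real.sinh (κ * t) := fun t ht =>
    Real.sinh_pos_iff.2 (mul_pos hκ ht)
  have hds : ∀ t, HasDerivAt (fun t => Real.sinh (κ * t)) (Real.cosh (κ * t) * κ) t := fun t => by
    simpa using ((hasDerivAt_id t).const_mul κ).sinh
  have hdc : ∀ t, HasDerivAt (fun t => Real.cosh (κ * t)) (Real.sinh (κ * t) * κ) t := fun t => by
    simpa using ((hasDerivAt_id t).const_mul κ).cosh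
  have hpow : ∀ t, Real.sinh (κ * t) ^ (n - 1) =
      Real.sinh (κ * t) ^ (n - 1 - 1) * Real.sinh (κ * t) := fun t => by
    rw [← pow_succ]
    congr 1
    omega
  -- `c = (n - 1) κ coth(κt)` is the logarithmic derivative of `sinh^{n-1}(κt)`.
  refine hg.exists_sign_change (isRadialWeight_hyperbolicWeight hn hκ) hr
    (c := fun t => ((n - 1 : ℕ) : ℝ) * κ * (Real.cosh (κ * t) / Real.sinh (κ * t)))
    (c' := fun t => -(((n - 1 : ℕ) : ℝ) * κ ^ 2 / Real.sinh (κ * t) ^ 2)) ?_ ?_ ?_ ?_ ?_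
  · intro t ht
    have h1 := (hds t).pow (n - 1)
    have h2 : (fun t => Real.sinh (κ * t)) ^ (n - 1) =ᶠ[𝓝 t] hyperbolicWeight n κ := by
      filter_upwards [Ioi_mem_nhds ht] with x hx
      rw [hyperbolicWeight_of_nonneg n κ (le_of_lt hx), Pi.pow_apply]
    refine (h1.congr_of_eventuallyEq h2.symm).congr_deriv ?_
    rw [hyperbolicWeight_of_nonneg n κ ht.le, hpow t]
    have := (hsinh t ht).ne'
    field_simp
  · intro t ht
    have hne := (hsinh t ht).ne'
    refine (((hdc t).div (hds t) hne).const_mul _).congr_deriv ?_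
    have := Real.cosh_sq (κ * t)
    field_simp
    rw [this]
    ring
  · intro t ht
    have := hsinh t ht
    have := Real.cosh_pos (κ * t)
    positivity
  · intro t ht
    have := hsinh t ht
    rw [neg_lt_zero]
    positivity
  · have hcont : Tendsto (fun t => t * (((n - 1 : ℕ) : ℝ) * κ * Real.cosh (κ * t) *
        Real.sinh (κ * t) ^ (n - 1 - 1))) (𝓝[>] 0) (𝓝 0) := by
      have : Continuous (fun t => t * (((n - 1 : ℕ) : ℝ) * κ * Real.cosh (κ * t) *
        Real.sinh (κ * t) ^ (n - 1 - 1))) := by fun_prop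
      have h1 := this.tendsto 0
      rw [zero_mul] at h1
      exact h1.mono_left nhdsWithin_le_nhds
    refine hcont.congr' ?_
    filter_upwards [self_mem_nhdsWithin] with t ht
    have hne := (hsinh t ht).ne'
    rw [hyperbolicWeight_of_nonneg n κ (le_of_lt ht), hpow t]
    generalize Real.sinh (κ * t) = S at hne ⊢
    field_simp

/-- The hyperbolic distance to the centre of the Poincaré ball of a point of Euclidean norm `R`. -/
noncomputable def hypRadius (κ R : ℝ) : ℝ := 2 / κ * Real.arsinh (R / √(1 - R ^ 2))

/-- The conformal factor of the metric of the Poincaré ball at a point of Euclidean norm `R`. -/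
noncomputable def hypFactor (κ R : ℝ) : ℝ := 2 / (κ * (1 - R ^ 2))

section HypRadius

variable {κ : ℝ}

lemma one_sub_sq_pos {R : ℝ} (hR : R ∈ Set.Ioo (-1) 1) : 0 < 1 - R ^ 2 := by
  nlinarith [hR.1, hR.2]

lemma hypFactor_pos (hκ : 0 < κ) {R : ℝ} (hR : R ∈ Set.Ioo (-1) 1) : 0 < hypFactor κ R := by
  have := one_sub_sq_pos hR
  unfold hypFactor
  positivity

lemma continuousOn_hypFactor (hκ : 0 < κ) : ContinuousOn (hypFactor κ) (Set.Ioo (-1) 1) := by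
  refine continuousOn_const.div (by fun_prop) fun R hR => ?_
  have := one_sub_sq_pos hR
  positivity

lemma sqrt_one_add_sq_div {R : ℝ} (hR : R ∈ Set.Ioo (-1) 1) :
    √(1 + (R / √(1 - R ^ 2)) ^ 2) = 1 / √(1 - R ^ 2) := by
  have h := one_sub_sq_pos hR
  rw [div_pow, Real.sq_sqrt h.le, show 1 + R ^ 2 / (1 - R ^ 2) = 1 / (1 - R ^ 2) by field_simp; ring,
    Real.sqrt_div zero_le_one, Real.sqrt_one]

lemma hasDerivAt_hypRadius (hκ : 0 < κ) {R : ℝ} (hR : R ∈ Set.Ioo (-1) 1) :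
    HasDerivAt (hypRadius κ) (hypFactor κ R) R := by
  have h := one_sub_sq_pos hR
  have hsq : √(1 - R ^ 2) ^ 2 = 1 - R ^ 2 := Real.sq_sqrt h.le
  have hpos : 0 < √(1 - R ^ 2) := Real.sqrt_pos.2 h
  have h1 : HasDerivAt (fun R : ℝ => 1 - R ^ 2) (-(2 * R)) R := by
    simpa using ((hasDerivAt_id R).pow 2).const_sub 1
  have h2 := h1.sqrt h.ne'
  have h3 := (((hasDerivAt_id R).div h2 hpos.ne').arsinh).const_mul (2 / κ)
  refine h3.congr_deriv ?_
  simp only [Pi.div_apply, id, smul_eq_mul]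
  rw [sqrt_one_add_sq_div hR, hypFactor]
  set q := √(1 - R ^ 2)
  rw [← hsq]
  field_simp
  rw [hsq]
  ring

/-- The double-angle formula for `sinh (2 arsinh y)`. It turns the conformally scaled area of a
Euclidean sphere into `sinh^{n-1}` of its hyperbolic radius. -/
lemma sinh_hypRadius (hκ : 0 < κ) {R : ℝ} (hR : R ∈ Set.Ioo (-1) 1) :
    Real.sinh (κ * hypRadius κ R) = κ * R * hypFactor κ R := by
  have h := one_sub_sq_pos hR
  have hsq : √(1 - R ^ 2) ^ 2 = 1 - R ^ 2 := Real.sq_sqrt h.le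
  have hpos : 0 < √(1 - R ^ 2) := Real.sqrt_pos.2 h
  rw [hypRadius, ← mul_assoc, mul_div_cancel₀ _ hκ.ne', Real.sinh_two_mul, Real.sinh_arsinh,
    Real.cosh_arsinh, sqrt_one_add_sq_div hR, hypFactor]
  set q := √(1 - R ^ 2)
  rw [← hsq]
  field_simp

lemma strictMonoOn_hypRadius (hκ : 0 < κ) : StrictMonoOn (hypRadius κ) (Set.Ioo (-1) 1) := by
  refine strictMonoOn_of_deriv_pos (convex_Ioo _ _)
    (fun t ht => (hasDerivAt_hypRadius hκ ht).continuousAt.continuousWithinAt) fun t ht => ?_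
  rw [interior_Ioo] at ht
  rw [(hasDerivAt_hypRadius hκ ht).deriv]
  exact hypFactor_pos hκ ht

lemma hypRadius_zero : hypRadius κ 0 = 0 := by simp [hypRadius]

lemma hypRadius_tanh (hκ : 0 < κ) (r : ℝ) : hypRadius κ (Real.tanh (κ * r / 2)) = r := by
  set x := κ * r / 2 with hx
  have hc := Real.cosh_pos x
  have h1 : 1 - Real.tanh x ^ 2 = (1 / Real.cosh x) ^ 2 := by
    rw [Real.tanh_eq_sinh_div_cosh]
    field_simp
    linarith [Real.cosh_sq x]
  rw [hypRadius, h1, Real.sqrt_sq (by positivity), Real.tanh_eq_sinh_div_cosh,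
    show Real.sinh x / Real.cosh x / (1 / Real.cosh x) = Real.sinh x by field_simp,
    Real.arsinh_sinh, hx]
  field_simp

lemma tanh_radius_mem (hκ : 0 < κ) {r : ℝ} (hr : 0 < r) :
    Real.tanh (κ * r / 2) ∈ Set.Ioo (0 : ℝ) 1 := by
  refine ⟨?_, Real.tanh_lt_one _⟩
  rw [Real.tanh_eq_sinh_div_cosh]
  exact div_pos (Real.sinh_pos_iff.2 (by positivity)) (Real.cosh_pos _)

lemma Ico_zero_one_subset : Set.Ico (0 : ℝ) 1 ⊆ Set.Ioo (-1) 1 := fun _ h =>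
  ⟨by linarith [h.1], h.2⟩

lemma hypRadius_lt_iff (hκ : 0 < κ) {r R : ℝ} (hr : 0 < r) (hR : R ∈ Set.Ico (0 : ℝ) 1) :
    hypRadius κ R < r ↔ R < Real.tanh (κ * r / 2) := by
  have h := tanh_radius_mem hκ hr
  conv_lhs => rw [← hypRadius_tanh hκ r]
  exact (strictMonoOn_hypRadius hκ).lt_iff_lt (Ico_zero_one_subset hR)
    (Ico_zero_one_subset ⟨h.1.le, h.2⟩)

lemma hypRadius_nonneg (hκ : 0 < κ) {R : ℝ} (hR : 0 ≤ R) : 0 ≤ hypRadius κ R := by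
  unfold hypRadius
  have : 0 ≤ Real.arsinh (R / √(1 - R ^ 2)) := Real.arsinh_nonneg_iff.2 (by positivity)
  positivity

lemma hypRadius_pos (hκ : 0 < κ) {R : ℝ} (hR : R ∈ Set.Ioo (0 : ℝ) 1) : 0 < hypRadius κ R := by
  rw [← hypRadius_zero (κ := κ)]
  exact strictMonoOn_hypRadius hκ (by norm_num) (Ico_zero_one_subset ⟨hR.1.le, hR.2⟩) hR.1

lemma hyperbolicWeight_hypRadius (n : ℕ) (hκ : 0 < κ) {R : ℝ} (hR : R ∈ Set.Ico (0 : ℝ) 1) :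
    hyperbolicWeight n κ (hypRadius κ R) = κ ^ (n - 1) * (R * hypFactor κ R) ^ (n - 1) := by
  rw [hyperbolicWeight_of_nonneg n κ (hypRadius_nonneg hκ hR.1),
    sinh_hypRadius hκ (Ico_zero_one_subset hR), mul_assoc, mul_pow]

end HypRadius

lemma hypDist_origin {n : ℕ} (κ : ℝ) (x : PoincareBall n) :
    hypDist n κ (PoincareBall.origin n) x = hypRadius κ ‖x.1‖ := by
  simp [hypDist, PoincareBall.origin, hypRadius]

lemma mem_hypBall_iff {n : ℕ} {κ r : ℝ} (hκ : 0 < κ) (hr : 0 < r) (x : PoincareBall n) :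
    x ∈ hypBall n κ r ↔ ‖x.1‖ < Real.tanh (κ * r / 2) := by
  change hypDist n κ (PoincareBall.origin n) x < r ↔ _
  rw [hypDist_origin]
  exact hypRadius_lt_iff hκ hr ⟨norm_nonneg _, mem_ball_zero_iff.1 x.2⟩

/-- The origin is a null set, and its complement is measurably the product of the unit sphere and a
half-line. -/
theorem lintegral_polar {n : ℕ} (hn : 1 ≤ n) {F : EuclideanSpace ℝ (Fin n) → ℝ≥0∞}
    (hF : Measurable F) :
    ∫⁻ x, F x = ∫⁻ θ, ∫⁻ t in Set.Ioi (0 : ℝ), ENNReal.ofReal (t ^ (n - 1)) * F (t • θ.1)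
      ∂(volume : Measure ℝ) ∂((volume : Measure (EuclideanSpace ℝ (Fin n))).toSphere) := by
  have : Nonempty (Fin n) := ⟨⟨0, by omega⟩⟩
  have hmp := (volume : Measure (EuclideanSpace ℝ (Fin n))).measurePreserving_homeomorphUnitSphereProd
  have hmeas : Measurable fun p : Metric.sphere (0 : EuclideanSpace ℝ (Fin n)) 1 × Set.Ioi (0 : ℝ) =>
      F (p.2.1 • p.1.1) := hF.comp (by fun_prop)
  have h1 := hmp.lintegral_comp hmeas
  have h2 : ∀ x : ({0}ᶜ : Set (EuclideanSpace ℝ (Fin n))),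
      F (((homeomorphUnitSphereProd _ x).2.1) • (homeomorphUnitSphereProd _ x).1.1) = F x := by
    intro x
    have := (homeomorphUnitSphereProd (EuclideanSpace ℝ (Fin n))).symm_apply_apply x
    conv_rhs => rw [← this]
    rfl
  simp only [h2] at h1
  rw [lintegral_subtype_comap (measurableSet_singleton _).compl, restrict_compl_singleton] at h1
  rw [h1, lintegral_prod _ hmeas.aemeasurable]
  refine lintegral_congr fun θ => ?_
  rw [Measure.volumeIoiPow, finrank_euclideanSpace_fin, lintegral_withDensity_eq_lintegral_mul₀]
  · exact lintegral_subtype_comap measurableSet_Ioi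
      (fun t : ℝ => ENNReal.ofReal (t ^ (n - 1)) * F (t • θ.1))
  · exact Measurable.aemeasurable (by fun_prop)
  · exact (hF.comp (by fun_prop)).aemeasurable

/-- Writing `p` for `hypFactor κ` and `ρ` for `hypRadius κ`, the polar density is `t^{n-1} p(t)^n =
κ^{-(n-1)} s(ρ(t)) p(t)`, and `p(t) dt = dρ`. -/
theorem setLIntegral_hypBall {n : ℕ} (hn : 1 ≤ n) {κ r : ℝ} (hκ : 0 < κ) (hr : 0 < r)
    {Φ : EuclideanSpace ℝ (Fin n) → ℝ≥0∞} (hΦ : Measurable Φ) :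
    ∫⁻ x in hypBall n κ r, Φ x.1 ∂hypMeasure n κ = ENNReal.ofReal ((κ ^ (n - 1))⁻¹) *
      ∫⁻ θ, ∫⁻ t in Set.Ioo (0 : ℝ) (Real.tanh (κ * r / 2)),
        ENNReal.ofReal (hyperbolicWeight n κ (hypRadius κ t) * hypFactor κ t) * Φ (t • θ.1)
      ∂(volume : Measure ℝ) ∂((volume : Measure (EuclideanSpace ℝ (Fin n))).toSphere) := by
  set T := Real.tanh (κ * r / 2) with hT
  have hTm := tanh_radius_mem hκ hr
  have hset : hypBall n κ r = Subtype.val ⁻¹' (Metric.ball (0 : EuclideanSpace ℝ (Fin n)) T) := by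
    ext x
    rw [mem_hypBall_iff hκ hr]
    simp [hT]
  have hmeasB : MeasurableSet (Metric.ball (0 : EuclideanSpace ℝ (Fin n)) T) := measurableSet_ball
  have hw : Measurable fun x : EuclideanSpace ℝ (Fin n) =>
      ENNReal.ofReal (hypFactor κ ‖x‖ ^ n) := by
    unfold hypFactor
    fun_prop
  have hms : MeasurableSet (hypBall n κ r) := by
    rw [hset]
    exact measurable_subtype_coe hmeasB
  have e1 : ∫⁻ x in hypBall n κ r, Φ x.1 ∂hypMeasure n κ =
      ∫⁻ x, (Metric.ball (0 : EuclideanSpace ℝ (Fin n)) T).indicator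
        (fun x => ENNReal.ofReal (hypFactor κ ‖x‖ ^ n) * Φ x) x := by
    rw [← lintegral_indicator hms, hypMeasure, lintegral_withDensity_eq_lintegral_mul₀]
    · have e := lintegral_subtype_comap
        (μ := (volume : Measure (EuclideanSpace ℝ (Fin n)))) (s := Metric.ball 0 1)
        measurableSet_ball ((Metric.ball (0 : EuclideanSpace ℝ (Fin n)) T).indicator
        (fun x => ENNReal.ofReal (hypFactor κ ‖x‖ ^ n) * Φ x))
      refine Eq.trans ?_ (e.trans ?_)
      · refine lintegral_congr fun x => ?_
        rw [hset]
        by_cases hx : x.1 ∈ Metric.ball (0 : EuclideanSpace ℝ (Fin n)) T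
        · rw [Set.indicator_of_mem hx, Pi.mul_apply,
            Set.indicator_of_mem (s := Subtype.val ⁻¹' Metric.ball 0 T) hx]
          rfl
        · rw [Set.indicator_of_notMem hx, Pi.mul_apply,
            Set.indicator_of_notMem (s := Subtype.val ⁻¹' Metric.ball 0 T) hx, mul_zero]
      · rw [setLIntegral_indicator hmeasB,
          Set.inter_eq_left.2 (Metric.ball_subset_ball hTm.2.le), ← lintegral_indicator hmeasB]
    · exact (hw.comp measurable_subtype_coe).aemeasurable
    · exact ((hΦ.comp measurable_subtype_coe).indicator hms).aemeasurable
  have hm : Measurable ((Metric.ball (0 : EuclideanSpace ℝ (Fin n)) T).indicator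
      (fun x => ENNReal.ofReal (hypFactor κ ‖x‖ ^ n) * Φ x)) := (hw.mul hΦ).indicator hmeasB
  rw [e1, lintegral_polar hn hm, ← lintegral_const_mul' _ _ (by simp)]
  refine lintegral_congr fun θ => ?_
  rw [← lintegral_const_mul' _ _ (by simp), ← lintegral_indicator measurableSet_Ioi,
    ← lintegral_indicator measurableSet_Ioo]
  refine lintegral_congr fun t => ?_
  by_cases ht0 : t ∈ Set.Ioi (0 : ℝ)
  swap
  · rw [Set.indicator_of_notMem ht0, Set.indicator_of_notMem fun h => ht0 h.1]
  have hnorm : ‖t • θ.1‖ = t := by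
    rw [norm_smul, norm_eq_of_mem_sphere θ, mul_one, Real.norm_of_nonneg (le_of_lt ht0)]
  rw [Set.indicator_of_mem ht0]
  by_cases htT : t < T
  · rw [Set.indicator_of_mem (by simpa [hnorm] using htT), Set.indicator_of_mem (Set.mem_Ioo.2
      ⟨ht0, htT⟩), hnorm, ← mul_assoc, ← mul_assoc, ← ENNReal.ofReal_mul (by
        exact pow_nonneg (le_of_lt ht0) _), ← ENNReal.ofReal_mul (by positivity)]
    congr 2
    rw [hyperbolicWeight_hypRadius n hκ ⟨le_of_lt ht0, htT.trans hTm.2⟩, mul_pow]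
    obtain ⟨m, rfl⟩ : ∃ m, n = m + 1 := ⟨n - 1, by omega⟩
    have : κ ^ m ≠ 0 := by positivity
    simp only [Nat.add_sub_cancel]
    field_simp
    ring
  · rw [Set.indicator_of_notMem (by simpa [hnorm] using htT),
      Set.indicator_of_notMem fun h => htT h.2, mul_zero]

/-- The volume of hyperbolic balls. -/
theorem hypMeasure_hypBall {n : ℕ} (hn : 2 ≤ n) {κ r : ℝ} (hκ : 0 < κ) (hr : 0 < r) :
    hypMeasure n κ (hypBall n κ r) = ENNReal.ofReal ((κ ^ (n - 1))⁻¹) *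
      (n * volume (Metric.ball (0 : EuclideanSpace ℝ (Fin n)) 1)) *
        ENNReal.ofReal (∫ t in (0 : ℝ)..r, hyperbolicWeight n κ t) := by
  have hTm := tanh_radius_mem hκ hr
  have hs := isRadialWeight_hyperbolicWeight hn hκ
  have hI : ∀ t ∈ Set.Icc 0 (Real.tanh (κ * r / 2)), t ∈ Set.Ioo (-1 : ℝ) 1 := fun t ht =>
    ⟨by linarith [ht.1], ht.2.trans_lt hTm.2⟩
  have h := setLIntegral_hypBall (by omega : 1 ≤ n) hκ hr (Φ := fun _ => 1) measurable_const
  simp only [mul_one, lintegral_const, Measure.restrict_apply MeasurableSet.univ, Set.univ_inter,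
    one_mul, Measure.toSphere_apply_univ, finrank_euclideanSpace_fin] at h
  rw [h, mul_comm (∫⁻ _ in _, _), ← mul_assoc]
  congr 1
  have hc : ContinuousOn (fun t => hyperbolicWeight n κ (hypRadius κ t) * hypFactor κ t)
      (Set.Icc 0 (Real.tanh (κ * r / 2))) := by
    refine ContinuousOn.mul ?_ ((continuousOn_hypFactor hκ).mono hI)
    exact hs.continuous.comp_continuousOn fun t ht =>
      (hasDerivAt_hypRadius hκ (hI t ht)).continuousAt.continuousWithinAt
  rw [setLIntegral_congr Ioo_ae_eq_Ioc, ← ofReal_integral_eq_lintegral_ofReal,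
    ← intervalIntegral.integral_of_le hTm.1.le]
  · congr 1
    have := intervalIntegral.integral_comp_mul_deriv' (f := hypRadius κ) (f' := hypFactor κ)
      (g := hyperbolicWeight n κ) (a := 0) (b := Real.tanh (κ * r / 2))
      (fun x hx => hasDerivAt_hypRadius hκ (hI x (by rwa [Set.uIcc_of_le hTm.1.le] at hx)))
      ((continuousOn_hypFactor hκ).mono (by rw [Set.uIcc_of_le hTm.1.le]; exact hI))
      hs.continuous.continuousOn
    rw [hypRadius_zero, hypRadius_tanh hκ] at this
    exact this
  · exact (hc.integrableOn_Icc).mono_set Set.Ioc_subset_Icc_self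
  · filter_upwards [ae_restrict_mem measurableSet_Ioc] with t ht
    exact mul_nonneg (hs.nonneg _) (hypFactor_pos hκ (hI t ⟨ht.1.le, ht.2⟩)).le

/-! ### Slopes and Rayleigh quotients on the Poincaré ball. -/

lemma EReal.ofReal_le_abs_of_le {v : ℝ} {x : EReal} (h : (v : EReal) ≤ x) :
    ENNReal.ofReal v ≤ x.abs := by
  induction x with
  | bot => simp at h
  | top => simp
  | coe x =>
    rw [EReal.abs_def]
    exact ENNReal.ofReal_le_ofReal ((EReal.coe_le_coe_iff.1 h).trans (le_abs_self x))

/-- A curve along which the difference quotients are frequently large bounds the slope from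
below. -/
lemma le_slope_d_abs {M : Type*} [TopologicalSpace M] {d : M → M → ℝ} {u : M → ℝ} {x : M} {v : ℝ}
    (h : ∀ c < v, ∃ᶠ y in 𝓝[≠] x, c ≤ (u y - u x) / d x y) :
    ENNReal.ofReal v ≤ (slope_d d u x).abs := by
  refine EReal.ofReal_le_abs_of_le ?_
  have hne : 𝓝[≠] x ≠ ⊥ := by
    intro hbot
    have := h (v - 1) (by linarith)
    rw [hbot] at this
    simp at this
  rw [slope_d, if_neg hne]
  refine EReal.ge_of_forall_gt_iff_ge.1 fun c hc => ?_
  refine le_limsup_of_frequently_le ?_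
  exact (h c (EReal.coe_lt_coe_iff.1 hc)).mono fun y hy => EReal.coe_le_coe_iff.2 hy

lemma Real.arsinh_le_self {x : ℝ} (hx : 0 ≤ x) : Real.arsinh x ≤ x := by
  have := Real.self_le_sinh_iff.2 (Real.arsinh_nonneg_iff.2 hx)
  rwa [Real.sinh_arsinh] at this

lemma hypDist_nonneg {n : ℕ} {κ : ℝ} (hκ : 0 < κ) (x y : PoincareBall n) : 0 ≤ hypDist n κ x y := by
  have : 0 ≤ Real.arsinh (‖x.1 - y.1‖ / √((1 - ‖x.1‖ ^ 2) * (1 - ‖y.1‖ ^ 2))) :=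
    Real.arsinh_nonneg_iff.2 (by positivity)
  unfold hypDist
  positivity

lemma hypDist_le {n : ℕ} {κ : ℝ} (hκ : 0 < κ) (x y : PoincareBall n) :
    hypDist n κ x y ≤
      2 / κ * (‖x.1 - y.1‖ / √((1 - ‖x.1‖ ^ 2) * (1 - ‖y.1‖ ^ 2))) := by
  unfold hypDist
  exact mul_le_mul_of_nonneg_left (Real.arsinh_le_self (by positivity)) (by positivity)

lemma hypDist_comm {n : ℕ} (κ : ℝ) (x y : PoincareBall n) : hypDist n κ x y = hypDist n κ y x := by
  unfold hypDist
  rw [norm_sub_rev, mul_comm (1 - ‖x.1‖ ^ 2)]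

lemma hypDist_self {n : ℕ} (κ : ℝ) (x : PoincareBall n) : hypDist n κ x x = 0 := by
  simp [hypDist]

lemma PoincareBall.one_sub_norm_sq_pos {n : ℕ} (x : PoincareBall n) : 0 < 1 - ‖x.1‖ ^ 2 := by
  have := mem_ball_zero_iff.1 x.2
  nlinarith [norm_nonneg x.1]

lemma continuous_hypDist {n : ℕ} (κ : ℝ) (x : PoincareBall n) : Continuous (hypDist n κ x) := by
  unfold hypDist
  refine continuous_const.mul (Continuous.arsinh ?_)
  refine Continuous.div (by fun_prop) (by fun_prop) fun y => ?_
  exact (Real.sqrt_pos.2 (mul_pos x.one_sub_norm_sq_pos y.one_sub_norm_sq_pos)).ne'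

section ExtendByZero

variable {n : ℕ}

/-- The extension by zero to `ℝⁿ` of a function on the Poincaré ball. -/
noncomputable def extendByZero (u : PoincareBall n → ℝ) : EuclideanSpace ℝ (Fin n) → ℝ :=
  Function.extend Subtype.val u 0

lemma extendByZero_coe (u : PoincareBall n → ℝ) (x : PoincareBall n) :
    extendByZero u x.1 = u x := Subtype.val_injective.extend_apply _ _ _

/-- The slope at a point of the Poincaré ball is at least the modulus of the radial derivative. -/
theorem ofReal_radial_deriv_le_slope {κ : ℝ} (hκ : 0 < κ) (u : PoincareBall n → ℝ)
    {θ : EuclideanSpace ℝ (Fin n)} (hθ : ‖θ‖ = 1) {t : ℝ} (ht : t ∈ Set.Ioo (0 : ℝ) 1)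
    {x : PoincareBall n} (hx : x.1 = t • θ) :
    ENNReal.ofReal (|deriv (fun t => extendByZero u (t • θ)) t| / hypFactor κ t) ≤
      (slope_d (hypDist n κ) u x).abs := by
  classical
  set f : ℝ → ℝ := fun t => extendByZero u (t • θ) with hf
  -- This also disposes of points of non-differentiability, where `deriv` is `0`.
  by_cases hd0 : deriv f t = 0
  · simp [hd0]
  have hd : HasDerivAt f (deriv f t) t :=
    (differentiableAt_of_deriv_ne_zero hd0).hasDerivAt
  set v := |deriv f t| with hv
  have hv0 : 0 < v := abs_pos.2 hd0
  -- The slope sees increases of `u` only, so the ray is followed in the direction `σ` in which `f`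
  -- grows.
  obtain ⟨σ, hσ, hσv⟩ : ∃ σ : ℝ, |σ| = 1 ∧ deriv f t * σ = v := by
    rcases lt_or_gt_of_ne hd0 with h | h
    · exact ⟨-1, by simp, by rw [hv, abs_of_neg h]; ring⟩
    · exact ⟨1, by simp, by rw [hv, abs_of_pos h]; ring⟩
  have htI : t ∈ Set.Ioo (-1 : ℝ) 1 := ⟨by linarith [ht.1], ht.2⟩
  have hp := hypFactor_pos hκ htI
  have hγ : Tendsto (fun δ : ℝ => t + σ * δ) (𝓝[>] 0) (𝓝 t) := by
    have : Tendsto (fun δ : ℝ => t + σ * δ) (𝓝 0) (𝓝 (t + σ * 0)) :=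
      Continuous.tendsto (by fun_prop) 0
    rw [mul_zero, add_zero] at this
    exact this.mono_left nhdsWithin_le_nhds
  have hφ : Tendsto (fun δ => (f (t + σ * δ) - f t) / δ) (𝓝[>] 0) (𝓝 v) := by
    have h1 : HasDerivAt (fun δ : ℝ => t + σ * δ) σ 0 := by
      simpa using ((hasDerivAt_id (0 : ℝ)).const_mul σ).const_add t
    have h2 : HasDerivAt (fun δ => f (t + σ * δ)) v 0 := by
      rw [← hσv]
      exact HasDerivAt.comp (h₂ := f) 0 (by simpa using hd) h1
    have h3 := h2.tendsto_slope_zero_right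
    refine h3.congr fun δ => ?_
    simp [div_eq_inv_mul]
  -- Since `arsinh y ≤ y`, the distance between the points at `t` and `t + σδ` is at most `δ`
  -- divided by the second factor, which tends to `1 / hypFactor κ t`.
  have hq : Tendsto (fun δ => (f (t + σ * δ) - f t) / δ *
      (κ / 2 * √((1 - t ^ 2) * (1 - (t + σ * δ) ^ 2)))) (𝓝[>] 0) (𝓝 (v / hypFactor κ t)) := by
    have h1 : Tendsto (fun δ => κ / 2 * √((1 - t ^ 2) * (1 - (t + σ * δ) ^ 2))) (𝓝[>] 0)
        (𝓝 (κ / 2 * √((1 - t ^ 2) * (1 - t ^ 2)))) := by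
      have : Continuous fun x : ℝ => κ / 2 * √((1 - t ^ 2) * (1 - x ^ 2)) := by fun_prop
      exact (this.tendsto t).comp hγ
    have h2 := hφ.mul h1
    have h3 := one_sub_sq_pos htI
    rw [Real.sqrt_mul_self h3.le] at h2
    convert! h2 using 2
    unfold hypFactor
    field_simp
  refine le_slope_d_abs fun c hc => ?_
  -- the ray through `x`, parametrized from `x`
  let γ : ℝ → PoincareBall n := fun δ =>
    if h : (t + σ * δ) • θ ∈ Metric.ball (0 : EuclideanSpace ℝ (Fin n)) 1 then ⟨_, h⟩ else x
  have hmem : ∀ᶠ δ in 𝓝[>] (0 : ℝ), t + σ * δ ∈ Set.Ioo (0 : ℝ) 1 :=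
    hγ (Ioo_mem_nhds ht.1 ht.2)
  have hnorm : ∀ s ∈ Set.Ioo (0 : ℝ) 1, ‖s • θ‖ = s := fun s hs => by
    rw [norm_smul, hθ, mul_one, Real.norm_of_nonneg hs.1.le]
  have hγv : ∀ᶠ δ in 𝓝[>] (0 : ℝ), (γ δ).1 = (t + σ * δ) • θ := by
    filter_upwards [hmem] with δ hδ
    have : (t + σ * δ) • θ ∈ Metric.ball (0 : EuclideanSpace ℝ (Fin n)) 1 := by
      rw [mem_ball_zero_iff, hnorm _ hδ]
      exact hδ.2
    simp only [γ, dif_pos this]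
  have hγlim : Tendsto γ (𝓝[>] 0) (𝓝[≠] x) := by
    refine tendsto_nhdsWithin_iff.2 ⟨?_, ?_⟩
    · rw [tendsto_subtype_rng, hx]
      refine Tendsto.congr' (hγv.mono fun δ hδ => hδ.symm) ?_
      exact hγ.smul_const θ
    · filter_upwards [hγv, self_mem_nhdsWithin, hmem] with δ hδ hδ0 hδm hcon
      have h1 : ‖(t + σ * δ) • θ‖ = ‖t • θ‖ := by rw [← hδ, ← hx, hcon]
      rw [hnorm _ hδm, hnorm _ ht] at h1
      have h2 : σ * δ = 0 := by linarith
      rcases mul_eq_zero.1 h2 with h | h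
      · rw [h, abs_zero] at hσ
        exact zero_ne_one hσ
      · exact (ne_of_gt hδ0) h
  refine hγlim.frequently (Eventually.frequently ?_)
  filter_upwards [hγv, self_mem_nhdsWithin, hmem, hq.eventually_const_lt hc,
    hφ.eventually_const_lt hv0] with δ hδ hδ0 hδm hqδ hφδ
  have hδpos : 0 < δ := hδ0
  have e1 : u (γ δ) = f (t + σ * δ) := by rw [← extendByZero_coe u, hδ]
  have e2 : u x = f t := by rw [← extendByZero_coe u, hx]
  have e3 : ‖x.1 - (γ δ).1‖ = δ := by
    rw [hδ, hx, ← sub_smul, norm_smul, hθ, mul_one, Real.norm_eq_abs,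
      show t - (t + σ * δ) = -(σ * δ) by ring, abs_neg, abs_mul, hσ, one_mul, abs_of_pos hδpos]
  have hle := hypDist_le hκ x (γ δ)
  rw [e3, hδ, hx, hnorm _ hδm, hnorm _ ht] at hle
  have hnum : 0 < f (t + σ * δ) - f t := by
    by_contra hcon
    exact absurd hφδ (not_lt.2 (div_nonpos_of_nonpos_of_nonneg (not_lt.1 hcon) hδpos.le))
  have hs1 := one_sub_sq_pos htI
  have hs2 : 0 < 1 - (t + σ * δ) ^ 2 := one_sub_sq_pos ⟨by linarith [hδm.1], hδm.2⟩
  set w := √((1 - t ^ 2) * (1 - (t + σ * δ) ^ 2)) with hw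
  have hw0 : 0 < w := Real.sqrt_pos.2 (mul_pos hs1 hs2)
  have hdpos : 0 < hypDist n κ x (γ δ) := by
    unfold hypDist
    have : 0 < Real.arsinh (‖x.1 - (γ δ).1‖ / √((1 - ‖x.1‖ ^ 2) * (1 - ‖(γ δ).1‖ ^ 2))) := by
      rw [Real.arsinh_pos_iff, e3, hδ, hx, hnorm _ hδm, hnorm _ ht]
      positivity
    positivity
  rw [e1, e2]
  refine hqδ.le.trans ?_
  rw [le_div_iff₀ hdpos]
  calc (f (t + σ * δ) - f t) / δ * (κ / 2 * w) * hypDist n κ x (γ δ)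
      ≤ (f (t + σ * δ) - f t) / δ * (κ / 2 * w) * (2 / κ * (δ / w)) :=
        mul_le_mul_of_nonneg_left hle (by positivity)
    _ = f (t + σ * δ) - f t := by field_simp

end ExtendByZero

lemma setLIntegral_Ioo_le_of_forall {F : ℝ → ℝ≥0∞} {a b : ℝ} {C : ℝ≥0∞}
    (h : ∀ ε, a < ε → ∫⁻ t in Set.Ioo ε b, F t ≤ C) : ∫⁻ t in Set.Ioo a b, F t ≤ C := by
  have hU : Set.Ioo a b = ⋃ k : ℕ, Set.Ioo (a + 1 / ((k : ℝ) + 1)) b := by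
    ext t
    simp only [Set.mem_Ioo, Set.mem_iUnion]
    constructor
    · rintro ⟨h1, h2⟩
      obtain ⟨k, hk⟩ := exists_nat_one_div_lt (sub_pos.2 h1)
      exact ⟨k, by linarith, h2⟩
    · rintro ⟨k, h1, h2⟩
      have : 0 < 1 / ((k : ℝ) + 1) := by positivity
      exact ⟨by linarith, h2⟩
  rw [hU, setLIntegral_iUnion_of_directed]
  · refine iSup_le fun k => h _ ?_
    have : 0 < 1 / ((k : ℝ) + 1) := by positivity
    linarith
  · refine Monotone.directed_le (f := fun k : ℕ => Set.Ioo (a + 1 / ((k : ℝ) + 1)) b) ?_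
    intro i j hij
    refine Set.Ioo_subset_Ioo_left ?_
    have : 1 / ((j : ℝ) + 1) ≤ 1 / ((i : ℝ) + 1) := Nat.one_div_le_one_div hij
    linarith

/-- The one-dimensional Rayleigh quotient bound along a ray of the Poincaré ball. -/
theorem IsRadialGroundState.lintegral_ray_le {s : ℝ → ℝ} {κ r L : ℝ} {h P : ℝ → ℝ}
    (hg : IsRadialGroundState s r L h P) (hs : IsRadialWeight s) (hκ : 0 < κ) (hr : 0 < r)
    {f : ℝ → ℝ} {K : NNReal} {R : ℝ} (hR : R ∈ Set.Ioo 0 (Real.tanh (κ * r / 2)))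
    (hf : LipschitzOnWith K f (Set.Icc 0 R)) (hf0 : ∀ t, R ≤ t → f t = 0) :
    ENNReal.ofReal L * ∫⁻ t in Set.Ioo (0 : ℝ) (Real.tanh (κ * r / 2)),
        ENNReal.ofReal (s (hypRadius κ t) * hypFactor κ t) * ENNReal.ofReal (f t ^ 2) ≤
      ∫⁻ t in Set.Ioo (0 : ℝ) (Real.tanh (κ * r / 2)),
        ENNReal.ofReal (s (hypRadius κ t) * hypFactor κ t) *
          ENNReal.ofReal (|deriv f t| / hypFactor κ t) ^ 2 := by
  set T := Real.tanh (κ * r / 2) with hT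
  have hTm := tanh_radius_mem hκ hr
  have hLp := hg.pos_eigenvalue
  rw [← lintegral_const_mul' _ _ (by simp)]
  -- The weight degenerates at `0`, so Picone is used on `[ε, R]` for every `ε > 0`.
  refine setLIntegral_Ioo_le_of_forall fun ε hε => ?_
  have hzero : ∀ t, R ≤ t → ENNReal.ofReal L *
      (ENNReal.ofReal (s (hypRadius κ t) * hypFactor κ t) * ENNReal.ofReal (f t ^ 2)) = 0 :=
    fun t ht => by simp [hf0 t ht]
  rcases lt_or_ge ε R with hεR | hεR
  swap
  · rw [setLIntegral_congr_fun (g := fun _ => (0 : ℝ≥0∞)) measurableSet_Ioo]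
    · simp
    · intro t ht
      exact hzero t (hεR.trans ht.1.le)
  have hI : ∀ t ∈ Set.Icc ε R, t ∈ Set.Ioo (0 : ℝ) 1 := fun t ht =>
    ⟨hε.trans_le ht.1, ht.2.trans_lt (hR.2.trans hTm.2)⟩
  have hI' : Set.Icc ε R ⊆ Set.Ioo (-1 : ℝ) 1 := fun t ht =>
    ⟨by linarith [(hI t ht).1], (hI t ht).2⟩
  have hρc : ContinuousOn (hypRadius κ) (Set.Icc ε R) := fun t ht =>
    (hasDerivAt_hypRadius hκ (hI' ht)).continuousAt.continuousWithinAt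
  have hpc : ContinuousOn (hypFactor κ) (Set.Icc ε R) := (continuousOn_hypFactor hκ).mono hI'
  have hpp : ∀ t ∈ Set.Icc ε R, 0 < hypFactor κ t := fun t ht => hypFactor_pos hκ (hI' ht)
  have hsc : ContinuousOn (fun t => s (hypRadius κ t)) (Set.Icc ε R) :=
    hs.continuous.comp_continuousOn hρc
  have hsp : ∀ t ∈ Set.Icc ε R, 0 < s (hypRadius κ t) := fun t ht =>
    hs.pos _ (hypRadius_pos hκ (hI t ht))
  have hρr : ∀ t ∈ Set.Icc ε R, hypRadius κ t ∈ Set.Ico 0 r := fun t ht =>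
    ⟨hypRadius_nonneg hκ (hI t ht).1.le,
      (hypRadius_lt_iff hκ hr ⟨(hI t ht).1.le, (hI t ht).2⟩).2 (ht.2.trans_lt hR.2)⟩
  -- In the Euclidean radius, with `dρ = p dt`, the equation for `h ∘ ρ` has coefficients `s(ρ) / p`
  -- and `s(ρ) p`. As `R` is below the radius of the ball, `h ∘ ρ` stays positive on `[ε, R]`.
  have key := picone_inequality_lintegral (a := fun t => s (hypRadius κ t) / hypFactor κ t)
    (b := fun t => s (hypRadius κ t) * hypFactor κ t) (h := fun t => h (hypRadius κ t))
    (P := fun t => P (hypRadius κ t)) (f := f) (K := K) (L := L) hεR.le hLp.le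
    (hsc.div hpc fun t ht => (hpp t ht).ne') (fun t ht => div_pos (hsp t ht) (hpp t ht))
    (hsc.mul hpc) (fun t ht => (mul_pos (hsp t ht) (hpp t ht)).le) ?_ ?_
    (fun t ht => hg.pos _ (hρr t ht)) ?_
    (hf.mono (Set.Icc_subset_Icc_left hε.le)) (hf0 R le_rfl)
  · calc ∫⁻ t in Set.Ioo ε T, ENNReal.ofReal L *
          (ENNReal.ofReal (s (hypRadius κ t) * hypFactor κ t) * ENNReal.ofReal (f t ^ 2))
        ≤ ∫⁻ t in Set.Ioc ε R, ENNReal.ofReal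
            (L * (s (hypRadius κ t) * hypFactor κ t * f t ^ 2)) := by
          rw [← lintegral_indicator measurableSet_Ioo, ← lintegral_indicator measurableSet_Ioc]
          refine lintegral_mono fun t => ?_
          by_cases h1 : t ∈ Set.Ioo ε T
          swap
          · rw [Set.indicator_of_notMem h1]; exact zero_le
          rw [Set.indicator_of_mem h1]
          by_cases h2 : t ≤ R
          · have h3 : t ∈ Set.Icc ε R := ⟨h1.1.le, h2⟩
            rw [Set.indicator_of_mem (Set.mem_Ioc.2 ⟨h1.1, h2⟩), ENNReal.ofReal_mul hLp.le,
              ENNReal.ofReal_mul (mul_pos (hsp t h3) (hpp t h3)).le]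
          · rw [hzero t (le_of_not_ge h2)]; exact zero_le
      _ ≤ _ := key
      _ ≤ _ := by
          rw [← lintegral_indicator measurableSet_Ioo, ← lintegral_indicator measurableSet_Ioc]
          refine lintegral_mono fun t => ?_
          by_cases h1 : t ∈ Set.Ioc ε R
          swap
          · rw [Set.indicator_of_notMem h1]; exact zero_le
          have h3 : t ∈ Set.Icc ε R := ⟨h1.1.le, h1.2⟩
          have hp := hpp t h3
          have hs0 := hsp t h3
          rw [Set.indicator_of_mem h1, Set.indicator_of_mem (Set.mem_Ioo.2
            ⟨hε.trans h1.1, h1.2.trans_lt hR.2⟩), ← ENNReal.ofReal_pow (by positivity),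
            ← ENNReal.ofReal_mul (by positivity)]
          refine ENNReal.ofReal_le_ofReal (le_of_eq ?_)
          rw [div_pow, sq_abs]
          field_simp
  · intro t ht
    refine ((hg.hasDerivAt _).comp t (hasDerivAt_hypRadius hκ (hI' ht))).congr_deriv ?_
    have := hpp t ht
    have := hsp t ht
    field_simp
  · intro t ht
    refine ((hg.hasDerivAt_flux _).comp t (hasDerivAt_hypRadius hκ (hI' ht))).congr_deriv ?_
    ring
  · have := hρr ε ⟨le_rfl, hεR.le⟩
    exact hg.flux_nonneg hs ⟨this.1, this.2.le⟩

section LipZero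

variable {n : ℕ} {κ r : ℝ} {u : PoincareBall n → ℝ}

lemma isOpen_hypBall (n : ℕ) (κ r : ℝ) : IsOpen (hypBall n κ r) :=
  isOpen_lt (continuous_hypDist κ _) continuous_const

lemma IsLipZero.eq_zero_of_notMem {M : Type*} [TopologicalSpace M] {d : M → M → ℝ} {Ω : Set M}
    {u : M → ℝ} (hu : IsLipZero d Ω u) {x : M} (hx : x ∉ Ω) : u x = 0 :=
  image_eq_zero_of_notMem_tsupport fun h => hx (hu.tsupport_subset h)

lemma IsLipZero.continuous_hyp (hκ : 0 < κ) (hu : IsLipZero (hypDist n κ) (hypBall n κ r) u) :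
    Continuous u := by
  obtain ⟨L, hL⟩ := hu.lipschitz
  refine continuous_iff_continuousAt.2 fun x => ?_
  by_cases hx : x ∈ tsupport u
  · have hxΩ := hu.tsupport_subset hx
    have hlim : Tendsto (fun y => |L| * hypDist n κ x y) (𝓝 x) (𝓝 0) := by
      have := ((continuous_hypDist κ x).const_mul (|L|)).tendsto x
      rwa [hypDist_self, mul_zero] at this
    rw [ContinuousAt, tendsto_iff_dist_tendsto_zero]
    refine squeeze_zero' (Eventually.of_forall fun _ => dist_nonneg) ?_ hlim
    filter_upwards [(isOpen_hypBall n κ r).mem_nhds hxΩ] with y hy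
    have h0 := hypDist_nonneg hκ x y
    have h1 := hL x hxΩ y hy
    have h2 := hL y hy x hxΩ
    rw [hypDist_comm] at h2
    have h3 := mul_le_mul_of_nonneg_right (le_abs_self L) h0
    rw [Real.dist_eq, abs_le]
    constructor <;> linarith
  · refine (continuousAt_const (y := (0 : ℝ))).congr ?_
    filter_upwards [(isClosed_tsupport u).isOpen_compl.mem_nhds hx] with y hy
    exact (image_eq_zero_of_notMem_tsupport hy).symm

lemma IsLipZero.exists_radius (hκ : 0 < κ) (hr : 0 < r)
    (hu : IsLipZero (hypDist n κ) (hypBall n κ r) u) :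
    ∃ R ∈ Set.Ioo 0 (Real.tanh (κ * r / 2)), ∀ v, R ≤ ‖v‖ → extendByZero u v = 0 := by
  set T := Real.tanh (κ * r / 2) with hT
  have hTm := tanh_radius_mem hκ hr
  obtain ⟨R₀, hR₀, hR⟩ : ∃ R₀ < T, ∀ x ∈ tsupport u, ‖x.1‖ ≤ R₀ := by
    rcases (tsupport u).eq_empty_or_nonempty with he | hne
    · exact ⟨0, hTm.1, by simp [he]⟩
    · obtain ⟨x, hx, hmax⟩ := hu.hasCompactSupport.isCompact.exists_isMaxOn hne
        (f := fun x => ‖x.1‖) (by fun_prop)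
      exact ⟨‖x.1‖, (mem_hypBall_iff hκ hr x).1 (hu.tsupport_subset hx), fun y hy => hmax hy⟩
  have hlt : max R₀ 0 < T := max_lt hR₀ hTm.1
  refine ⟨(max R₀ 0 + T) / 2, ⟨?_, by linarith⟩, fun v hv => ?_⟩
  · have := le_max_right R₀ 0
    linarith [hTm.1]
  · by_cases hvB : v ∈ Metric.ball (0 : EuclideanSpace ℝ (Fin n)) 1
    · rw [show v = (⟨v, hvB⟩ : PoincareBall n).1 from rfl, extendByZero_coe]
      refine image_eq_zero_of_notMem_tsupport fun hmem => ?_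
      have := hR _ hmem
      have := le_max_left R₀ 0
      simp only at *
      linarith
    · refine Function.extend_apply' _ _ _ ?_
      rintro ⟨x, hx⟩
      exact hvB (hx ▸ x.2)

lemma IsLipZero.lipschitzOnWith_ray (hκ : 0 < κ) (hr : 0 < r)
    (hu : IsLipZero (hypDist n κ) (hypBall n κ r) u) {R : ℝ}
    (hR : R ∈ Set.Ioo 0 (Real.tanh (κ * r / 2))) :
    ∃ K, ∀ θ : EuclideanSpace ℝ (Fin n), ‖θ‖ = 1 →
      LipschitzOnWith K (fun t : ℝ => extendByZero u (t • θ)) (Set.Icc 0 R) := by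
  have hTm := tanh_radius_mem hκ hr
  obtain ⟨L, hL⟩ := hu.lipschitz
  have hR1 : 0 < 1 - R ^ 2 := one_sub_sq_pos ⟨by linarith [hR.1], hR.2.trans hTm.2⟩
  refine ⟨Real.toNNReal (|L| * (2 / κ / (1 - R ^ 2))), fun θ hθ => ?_⟩
  refine LipschitzOnWith.of_le_add_mul _ fun t ht t' ht' => ?_
  have hnorm : ∀ t ∈ Set.Icc 0 R, ‖t • θ‖ = t := fun t ht => by
    rw [norm_smul, hθ, mul_one, Real.norm_of_nonneg ht.1]
  have hmem : ∀ t ∈ Set.Icc 0 R, t • θ ∈ Metric.ball (0 : EuclideanSpace ℝ (Fin n)) 1 :=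
    fun t ht => by
      rw [mem_ball_zero_iff, hnorm t ht]
      exact ht.2.trans_lt (hR.2.trans hTm.2)
  have hΩ : ∀ (t : ℝ) (ht : t ∈ Set.Icc 0 R), (⟨t • θ, hmem t ht⟩ : PoincareBall n) ∈
      hypBall n κ r := fun t ht => by
    rw [mem_hypBall_iff hκ hr, hnorm t ht]
    exact ht.2.trans_lt hR.2
  have h1 := hL _ (hΩ t' ht') _ (hΩ t ht)
  rw [← extendByZero_coe u, ← extendByZero_coe u] at h1
  have h2 := hypDist_le hκ ⟨t' • θ, hmem t' ht'⟩ ⟨t • θ, hmem t ht⟩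
  have h0 := hypDist_nonneg hκ ⟨t' • θ, hmem t' ht'⟩ ⟨t • θ, hmem t ht⟩
  simp only [hnorm t ht, hnorm t' ht'] at h1 h2
  rw [← sub_smul, norm_smul, hθ, mul_one, Real.norm_eq_abs] at h2
  have h3 : 1 - R ^ 2 ≤ √((1 - t' ^ 2) * (1 - t ^ 2)) := by
    refine Real.le_sqrt_of_sq_le ?_
    have e1 : t ^ 2 ≤ R ^ 2 := pow_le_pow_left₀ ht.1 ht.2 2
    have e2 : t' ^ 2 ≤ R ^ 2 := pow_le_pow_left₀ ht'.1 ht'.2 2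
    rw [pow_two]
    exact mul_le_mul (by linarith) (by linarith) hR1.le (by linarith)
  have h4 : |t' - t| / √((1 - t' ^ 2) * (1 - t ^ 2)) ≤ |t' - t| / (1 - R ^ 2) :=
    div_le_div_of_nonneg_left (abs_nonneg _) hR1 h3
  have h5 := h2.trans (mul_le_mul_of_nonneg_left h4 (by positivity))
  have h6 := mul_le_mul_of_nonneg_right (le_abs_self L) h0
  have h7 := mul_le_mul_of_nonneg_left h5 (abs_nonneg L)
  rw [Real.coe_toNNReal _ (by positivity), Real.dist_eq, abs_sub_comm]
  have h8 : |L| * (2 / κ * (|t' - t| / (1 - R ^ 2))) = |L| * (2 / κ / (1 - R ^ 2)) * |t' - t| := by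
    ring
  linarith

lemma IsLipZero.lintegral_sq_ne_zero_hyp (hκ : 0 < κ)
    (hu : IsLipZero (hypDist n κ) (hypBall n κ r) u) (hne : u ≠ 0) :
    ∫⁻ x in hypBall n κ r, ENNReal.ofReal (u x ^ 2) ∂hypMeasure n κ ≠ 0 := by
  have hcont := hu.continuous_hyp hκ
  intro h0
  rw [lintegral_eq_zero_iff (by fun_prop)] at h0
  set U := {x : PoincareBall n | u x ≠ 0} with hU
  have hUopen : IsOpen U := isOpen_ne_fun hcont continuous_const
  have h1 : hypMeasure n κ U = 0 := by
    rw [EventuallyEq, ae_restrict_iff' (isOpen_hypBall n κ r).measurableSet, ae_iff] at h0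
    refine measure_mono_null (fun x hx => ?_) h0
    have hxΩ : x ∈ hypBall n κ r := by
      by_contra hcon
      exact hx (hu.eq_zero_of_notMem hcon)
    have : 0 < u x ^ 2 := by
      have : u x ≠ 0 := hx
      positivity
    have hx' : u x ≠ 0 := hx
    simpa [hxΩ] using hx'
  rw [hypMeasure, withDensity_apply_eq_zero (by fun_prop)] at h1
  have h2 : {x : PoincareBall n | ENNReal.ofReal ((2 / (κ * (1 - ‖x.1‖ ^ 2))) ^ n) ≠ 0} ∩ U = U := by
    refine Set.inter_eq_right.2 fun x _ => ?_
    have := x.one_sub_norm_sq_pos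
    have : 0 < (2 / (κ * (1 - ‖x.1‖ ^ 2))) ^ n := by positivity
    simpa using this
  rw [h2, comap_subtype_coe_apply measurableSet_ball] at h1
  have h3 : IsOpen (Subtype.val '' U) := Metric.isOpen_ball.isOpenMap_subtype_val U hUopen
  rw [h3.measure_eq_zero_iff (μ := volume), Set.image_eq_empty] at h1
  refine hne (funext fun x => ?_)
  by_contra hx
  have : x ∈ U := hx
  rw [h1] at this
  exact this

lemma IsLipZero.lintegral_sq_ne_top_hyp (hn : 2 ≤ n) (hκ : 0 < κ) (hr : 0 < r)
    (hu : IsLipZero (hypDist n κ) (hypBall n κ r) u) :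
    ∫⁻ x in hypBall n κ r, ENNReal.ofReal (u x ^ 2) ∂hypMeasure n κ ≠ ⊤ := by
  obtain ⟨C, hC⟩ := hu.hasCompactSupport.exists_bound_of_continuous (hu.continuous_hyp hκ)
  have h1 : ∫⁻ x in hypBall n κ r, ENNReal.ofReal (u x ^ 2) ∂hypMeasure n κ ≤
      ∫⁻ x in hypBall n κ r, ENNReal.ofReal (C ^ 2) ∂hypMeasure n κ := by
    refine lintegral_mono fun x => ENNReal.ofReal_le_ofReal ?_
    rw [← sq_abs]
    exact pow_le_pow_left₀ (abs_nonneg _) (hC x) 2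
  refine ne_top_of_le_ne_top ?_ h1
  rw [setLIntegral_const, hypMeasure_hypBall hn hκ hr]
  have : volume (Metric.ball (0 : EuclideanSpace ℝ (Fin n)) 1) ≠ ⊤ := measure_ball_lt_top.ne
  finiteness

end LipZero

/-- The first radial eigenvalue is a lower bound for the fundamental frequency of a hyperbolic
ball. -/
theorem IsRadialGroundState.ofReal_le_fundamentalFrequency {n : ℕ} (hn : 2 ≤ n) {κ r L : ℝ}
    (hκ : 0 < κ) (hr : 0 < r) {h P : ℝ → ℝ}
    (hg : IsRadialGroundState (hyperbolicWeight n κ) r L h P) :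
    ENNReal.ofReal L ≤
      fundamentalFrequency (hypDist n κ) (hypMeasure n κ) (hypBall n κ r) := by
  refine le_iInf₂ fun u ⟨hu, hne⟩ => ?_
  have hs := isRadialWeight_hyperbolicWeight hn hκ
  have hTm := tanh_radius_mem hκ hr
  have hcont := hu.continuous_hyp hκ
  have hecont : Continuous (extendByZero u) :=
    HasCompactSupport.continuous_extend_zero Metric.isOpen_ball hcont hu.hasCompactSupport
  rw [ENNReal.le_div_iff_mul_le (Or.inl (hu.lintegral_sq_ne_zero_hyp hκ hne))
    (Or.inl (hu.lintegral_sq_ne_top_hyp hn hκ hr))]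
  -- `G v` is `‖v‖` times the radial derivative of `u`. In this form it is a derivative depending on
  -- the parameter `v`, hence measurable.
  set G : EuclideanSpace ℝ (Fin n) → ℝ := fun v => deriv (fun σ : ℝ => extendByZero u (σ • v)) 1
    with hG
  have hGm : Measurable G := by
    have h1 := measurable_deriv_with_param (𝕜 := ℝ)
      (f := fun (v : EuclideanSpace ℝ (Fin n)) (σ : ℝ) => extendByZero u (σ • v))
      (by unfold Function.uncurry; fun_prop)
    exact h1.comp (by fun_prop : Measurable fun v : EuclideanSpace ℝ (Fin n) => (v, (1 : ℝ)))
  set Φ : EuclideanSpace ℝ (Fin n) → ℝ≥0∞ := fun v =>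
    ENNReal.ofReal (|G v| / (‖v‖ * hypFactor κ ‖v‖)) ^ 2 with hΦ
  have hΦm : Measurable Φ := by
    have : Measurable fun v : EuclideanSpace ℝ (Fin n) => ‖v‖ * hypFactor κ ‖v‖ := by
      unfold hypFactor
      fun_prop
    exact ((hGm.abs.div this).ennreal_ofReal).pow_const 2
  have hGray : ∀ (θ : EuclideanSpace ℝ (Fin n)) (t : ℝ), ‖θ‖ = 1 → 0 < t → Φ (t • θ) =
      ENNReal.ofReal (|deriv (fun t => extendByZero u (t • θ)) t| / hypFactor κ t) ^ 2 := by
    intro θ t hθ ht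
    have e1 : ‖t • θ‖ = t := by rw [norm_smul, hθ, mul_one, Real.norm_of_nonneg ht.le]
    have e2 : G (t • θ) = t * deriv (fun t => extendByZero u (t • θ)) t := by
      have := deriv_comp_mul_left t (fun t : ℝ => extendByZero u (t • θ)) 1
      rw [mul_one, smul_eq_mul] at this
      rw [← this]
      simp only [hG, smul_smul, mul_comm t]
    simp only [hΦ]
    rw [e1, e2, abs_mul, abs_of_pos ht, mul_div_mul_left _ _ ht.ne']
  -- Monotonicity of the integral suffices here, so the slope need not be measurable.
  have hnum : ∫⁻ x in hypBall n κ r, Φ x.1 ∂hypMeasure n κ ≤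
      ∫⁻ x in hypBall n κ r, (slope_d (hypDist n κ) u x).abs ^ 2 ∂hypMeasure n κ := by
    refine lintegral_mono fun x => ?_
    by_cases hx : x.1 = 0
    · have : Φ x.1 = 0 := by simp [hΦ, hx]
      rw [this]
      exact zero_le
    have hx0 : 0 < ‖x.1‖ := norm_pos_iff.2 hx
    have hdec : x.1 = ‖x.1‖ • (‖x.1‖⁻¹ • x.1) := by
      rw [smul_smul, mul_inv_cancel₀ hx0.ne', one_smul]
    have hθ : ‖‖x.1‖⁻¹ • x.1‖ = 1 := by
      rw [norm_smul, norm_inv, norm_norm, inv_mul_cancel₀ hx0.ne']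
    have h1 := ofReal_radial_deriv_le_slope hκ u hθ ⟨hx0, mem_ball_zero_iff.1 x.2⟩ hdec
    have h2 := hGray _ _ hθ hx0
    rw [← hdec] at h2
    rw [h2]
    gcongr
  refine le_trans ?_ hnum
  have hden : ∫⁻ x in hypBall n κ r, ENNReal.ofReal (u x ^ 2) ∂hypMeasure n κ =
      ∫⁻ x in hypBall n κ r, ENNReal.ofReal (extendByZero u x.1 ^ 2) ∂hypMeasure n κ := by
    simp only [extendByZero_coe]
  rw [hden, setLIntegral_hypBall (by omega) hκ hr hΦm,
    setLIntegral_hypBall (Φ := fun v => ENNReal.ofReal (extendByZero u v ^ 2)) (by omega) hκ hr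
      (by fun_prop), mul_left_comm,
    ← lintegral_const_mul' _ _ (by simp)]
  gcongr with θ
  obtain ⟨R, hR, hR0⟩ := hu.exists_radius hκ hr
  obtain ⟨K, hK⟩ := hu.lipschitzOnWith_ray hκ hr hR
  have hθ : ‖θ.1‖ = 1 := norm_eq_of_mem_sphere θ
  have hray := hg.lintegral_ray_le hs hκ hr hR (hK θ.1 hθ) fun t ht => hR0 _ (by
    rw [norm_smul, hθ, mul_one, Real.norm_of_nonneg (hR.1.le.trans ht)]
    exact ht)
  refine hray.trans (le_of_eq ?_)
  refine setLIntegral_congr_fun measurableSet_Ioo fun t ht => ?_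
  rw [hGray θ.1 t hθ ht.1]

/-! ### Strict local maxima and the topology of a proper quasimetric space. -/

/-- In a second countable space, a function has countably many strict local maxima. -/
theorem countable_setOf_strict_local_max {M : Type*} [TopologicalSpace M]
    [SecondCountableTopology M] (f : M → ℝ) :
    {x | ∀ᶠ y in 𝓝[≠] x, f y < f x}.Countable := by
  have hB := TopologicalSpace.isBasis_countableBasis M
  have hch : ∀ x, ∃ U, (∀ᶠ y in 𝓝[≠] x, f y < f x) →
      U ∈ TopologicalSpace.countableBasis M ∧ x ∈ U ∧ ∀ y ∈ U, y ≠ x → f y < f x := by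
    intro x
    by_cases hx : ∀ᶠ y in 𝓝[≠] x, f y < f x
    · rw [eventually_nhdsWithin_iff, hB.nhds_hasBasis.eventually_iff] at hx
      obtain ⟨U, ⟨hU, hxU⟩, hmax⟩ := hx
      exact ⟨U, fun _ => ⟨hU, hxU, fun y hy hne => hmax hy hne⟩⟩
    · exact ⟨∅, fun h => absurd h hx⟩
  choose U hU using hch
  -- A basic open set in which `x` is the unique strict maximum determines `x`.
  refine Set.MapsTo.countable_of_injOn (f := U) (t := TopologicalSpace.countableBasis M)
    (fun x hx => (hU x hx).1) ?_ (TopologicalSpace.countable_countableBasis M)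
  intro x hx y hy hxy
  by_contra hne
  have h1 := (hU x hx).2.2 y (hxy ▸ (hU y hy).2.1) (Ne.symm hne)
  have h2 := (hU y hy).2.2 x (hxy ▸ (hU x hx).2.1) hne
  exact lt_asymm h1 h2

lemma EReal.abs_le_ofReal {q : ℝ} {x : EReal} (h0 : 0 ≤ x) (h : x ≤ (q : EReal)) :
    x.abs ≤ ENNReal.ofReal q := by
  induction x with
  | bot => simp at h0
  | top => simp at h
  | coe x =>
    rw [EReal.abs_def, abs_of_nonneg (EReal.coe_nonneg.1 h0)]
    exact ENNReal.ofReal_le_ofReal (EReal.coe_le_coe_iff.1 h)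

namespace IsQuasimetric

variable {M : Type*} [TopologicalSpace M] {d : M → M → ℝ}

lemma dist_self (hd : IsQuasimetric d) (x : M) : d x x = 0 := (hd.eq_zero_iff x x).2 rfl

lemma setOf_lt_mem_nhds (hd : IsQuasimetric d) (x : M) {ε : ℝ} (hε : 0 < ε) :
    {y | d x y < ε ∧ d y x < ε} ∈ 𝓝 x := by
  refine IsOpen.mem_nhds ((hd.isOpen_iff _).2 fun y hy => ?_) ?_
  · refine ⟨min (ε - d x y) (ε - d y x), lt_min (by linarith [hy.1]) (by linarith [hy.2]),
      fun z h1 h2 => ⟨?_, ?_⟩⟩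
    · have := hd.triangle x y z
      have := min_le_left (ε - d x y) (ε - d y x)
      linarith
    · have := hd.triangle z y x
      have := min_le_right (ε - d x y) (ε - d y x)
      linarith
  · exact ⟨by rwa [hd.dist_self], by rwa [hd.dist_self]⟩

lemma continuous_dist (hd : IsQuasimetric d) (x₀ : M) : Continuous (d x₀) := by
  refine continuous_iff_continuousAt.2 fun x => Metric.tendsto_nhds.2 fun ε hε => ?_
  filter_upwards [hd.setOf_lt_mem_nhds x hε] with y hy
  have h1 := hd.triangle x₀ x y
  have h2 := hd.triangle x₀ y x
  rw [Real.dist_eq, abs_lt]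
  constructor <;> linarith [hy.1, hy.2]

lemma isOpen_qball (hd : IsQuasimetric d) (x₀ : M) (ρ : ℝ) : IsOpen (qball d x₀ ρ) :=
  isOpen_lt (hd.continuous_dist x₀) continuous_const

lemma isCompact_closedBall (hd : IsQuasimetric d) (hp : IsProperQuasimetric d) (x₀ : M) (ρ : ℝ) :
    IsCompact {y | d x₀ y ≤ ρ} := by
  refine hp _ (isClosed_le (hd.continuous_dist x₀) continuous_const) ⟨x₀, ρ + 1, fun y hy => ?_⟩
  have : d x₀ y ≤ ρ := hy
  change d x₀ y < ρ + 1
  linarith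

lemma measure_qball_lt_top [MeasurableSpace M] (hd : IsQuasimetric d)
    (hp : IsProperQuasimetric d) (μ : Measure M) [IsLocallyFiniteMeasure μ] (x₀ : M) (ρ : ℝ) :
    μ (qball d x₀ ρ) < ⊤ :=
  (measure_mono (fun y (hy : d x₀ y < ρ) => hy.le : qball d x₀ ρ ⊆ {y | d x₀ y ≤ ρ})).trans_lt
    (hd.isCompact_closedBall hp x₀ ρ).measure_lt_top

/-- The topology comes from the metric `max (d x y) (d y x)`, and closed balls around `x₀` exhaust
`M` by compact sets. -/
lemma secondCountableTopology (hd : IsQuasimetric d) (hp : IsProperQuasimetric d) (x₀ : M) :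
    SecondCountableTopology M := by
  let m : PseudoMetricSpace M :=
    { dist := fun x y => max (d x y) (d y x)
      dist_self := fun x => by simp [hd.dist_self]
      dist_comm := fun x y => max_comm _ _
      dist_triangle := fun x y z => by
        have h1 := hd.triangle x y z
        have h2 := hd.triangle z y x
        refine max_le ?_ ?_
        · linarith [le_max_left (d x y) (d y x), le_max_left (d y z) (d z y)]
        · linarith [le_max_right (d x y) (d y x), le_max_right (d y z) (d z y)] }
  have htop : ‹TopologicalSpace M› = m.toUniformSpace.toTopologicalSpace := by
    refine TopologicalSpace.ext_iff.2 fun U => ?_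
    rw [hd.isOpen_iff, Metric.isOpen_iff]
    refine forall₂_congr fun x _ => exists_congr fun ε => and_congr_right fun _ => ?_
    refine ⟨fun h y hy => ?_, fun h y h1 h2 => h ?_⟩
    · have hy' : max (d y x) (d x y) < ε := hy
      exact h y ((le_max_right _ _).trans_lt hy') ((le_max_left _ _).trans_lt hy')
    · exact max_lt h2 h1
  have hσ : SigmaCompactSpace M := by
    refine ⟨fun k : ℕ => {y | d x₀ y ≤ k}, fun k => hd.isCompact_closedBall hp x₀ k, ?_⟩
    refine Set.eq_univ_of_forall fun y => Set.mem_iUnion.2 ?_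
    exact exists_nat_ge (d x₀ y)
  let m' := m.replaceTopology htop
  exact EMetric.secondCountable_of_sigmaCompact M

end IsQuasimetric

/-! ### Radial test functions on the quasimetric space. -/

section TestFunction

variable {s h P : ℝ → ℝ} {r L : ℝ}

lemma IsRadialGroundState.sub_le (hg : IsRadialGroundState s r L h P) (hs : IsRadialWeight s)
    {a b : ℝ} (ha : 0 ≤ a) (hab : a ≤ b) (hb : b ≤ r) : h a - h b ≤ L * r * (b - a) := by
  rcases hab.eq_or_lt with rfl | hlt
  · simp
  obtain ⟨c, hc, hslope⟩ := exists_hasDerivAt_eq_slope h _ hlt hg.continuous.continuousOn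
    (fun x _ => hg.hasDerivAt x)
  have hcI : c ∈ Set.Icc 0 r := ⟨ha.trans hc.1.le, hc.2.le.trans hb⟩
  have h1 := hg.slope_le hs hcI
  have h2 := mul_le_mul_of_nonneg_left hcI.2 hg.pos_eigenvalue.le
  rw [eq_div_iff (by linarith)] at hslope
  have h3 := mul_le_mul_of_nonneg_right (h1.trans h2) (by linarith : 0 ≤ b - a)
  linarith

/-- The truncation `(h - ε)₊` of the ground state, extended by zero beyond the radius `r`. -/
noncomputable def truncatedGroundState (h : ℝ → ℝ) (r ε t : ℝ) : ℝ := max (h (min t r) - ε) 0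

lemma continuous_truncatedGroundState (hg : IsRadialGroundState s r L h P) (ε : ℝ) :
    Continuous (truncatedGroundState h r ε) := by
  have := hg.continuous
  unfold truncatedGroundState
  fun_prop

lemma truncatedGroundState_antitoneOn (hg : IsRadialGroundState s r L h P) (hs : IsRadialWeight s)
    (hr : 0 < r) (ε : ℝ) : AntitoneOn (truncatedGroundState h r ε) (Set.Ici 0) := by
  intro a ha b hb hab
  refine max_le_max_right 0 (sub_le_sub_right ?_ ε)
  exact hg.antitoneOn hs ⟨le_min ha hr.le, min_le_right _ _⟩ ⟨le_min hb hr.le, min_le_right _ _⟩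
    (min_le_min_right r hab)

lemma truncatedGroundState_sub_le_sub (hg : IsRadialGroundState s r L h P) (hs : IsRadialWeight s)
    (hr : 0 < r) (ε : ℝ) {a b : ℝ} (ha : 0 ≤ a) (hab : a ≤ b) :
    truncatedGroundState h r ε a - truncatedGroundState h r ε b ≤ h (min a r) - h (min b r) := by
  have h1 := hg.antitoneOn hs ⟨le_min ha hr.le, min_le_right _ _⟩
    ⟨le_min (ha.trans hab) hr.le, min_le_right _ _⟩ (min_le_min_right r hab)
  have h2 := le_max_left (h (min b r) - ε) 0
  have h3 := le_max_right (h (min b r) - ε) 0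
  unfold truncatedGroundState
  rw [sub_le_iff_le_add]
  exact max_le (by linarith) (by linarith)

lemma truncatedGroundState_sub_le (hg : IsRadialGroundState s r L h P) (hs : IsRadialWeight s)
    (hr : 0 < r) (ε : ℝ) {a b : ℝ} (ha : 0 ≤ a) (hab : a ≤ b) :
    truncatedGroundState h r ε a - truncatedGroundState h r ε b ≤ L * r * (b - a) := by
  have h1 := truncatedGroundState_sub_le_sub hg hs hr ε ha hab
  have h2 := hg.sub_le hs (le_min ha hr.le) (min_le_min_right r hab) (min_le_right b r)
  have h3 : min b r - min a r ≤ b - a := by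
    rcases le_total a r with h | h <;> rcases le_total b r with h' | h' <;> simp [h, h'] <;> linarith
  have h4 := mul_le_mul_of_nonneg_left h3 (mul_nonneg hg.pos_eigenvalue.le hr.le)
  linarith

lemma exists_truncatedGroundState_eq_zero (hg : IsRadialGroundState s r L h P)
    (hs : IsRadialWeight s) (hr : 0 < r) {ε : ℝ} (hε : 0 < ε) :
    ∃ r' < r, ∀ t, r' ≤ t → truncatedGroundState h r ε t = 0 := by
  have h1 : ∀ᶠ t in 𝓝[<] r, h t < ε := by
    have := hg.continuous.tendsto r
    rw [hg.map_radius] at this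
    exact nhdsWithin_le_nhds (this.eventually_lt_const hε)
  obtain ⟨r', hr'⟩ := (h1.and (Ioo_mem_nhdsLT hr)).exists
  refine ⟨r', hr'.2.2, fun t ht => max_eq_right ?_⟩
  have h2 := hg.antitoneOn hs ⟨hr'.2.1.le, hr'.2.2.le⟩
    ⟨le_min (hr'.2.1.le.trans ht) hr.le, min_le_right t r⟩ (le_min ht hr'.2.2.le)
  linarith [hr'.1]

variable {M : Type*} [TopologicalSpace M] {d : M → M → ℝ}

/-- The test function `-(h - ε)₊ ∘ d(x₀, ·)`. -/
noncomputable def radialTestFunction (d : M → M → ℝ) (x₀ : M) (h : ℝ → ℝ) (r ε : ℝ) (x : M) : ℝ :=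
  -truncatedGroundState h r ε (d x₀ x)

lemma isLipZero_radialTestFunction (hd : IsQuasimetric d) (hp : IsProperQuasimetric d) (x₀ : M)
    (hg : IsRadialGroundState s r L h P) (hs : IsRadialWeight s) (hr : 0 < r) {ε : ℝ}
    (hε : 0 < ε) : IsLipZero d (qball d x₀ r) (radialTestFunction d x₀ h r ε) := by
  -- Subtracting `ε` confines the support to a closed ball of radius `r' < r`, compact by
  -- properness.
  obtain ⟨r', hr', hzero⟩ := exists_truncatedGroundState_eq_zero hg hs hr hε
  have hsub : tsupport (radialTestFunction d x₀ h r ε) ⊆ {y | d x₀ y ≤ r'} := by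
    refine closure_minimal (fun y hy => ?_)
      (isClosed_le (hd.continuous_dist x₀) continuous_const)
    by_contra hcon
    refine hy ?_
    rw [radialTestFunction, hzero _ (le_of_not_ge hcon), neg_zero]
  refine ⟨⟨L * r, fun x _ y _ => ?_⟩, ?_, fun y hy => (hsub hy).trans_lt hr'⟩
  · have hpos : 0 ≤ L * r := mul_nonneg hg.pos_eigenvalue.le hr.le
    unfold radialTestFunction
    rcases le_total (d x₀ y) (d x₀ x) with hle | hle
    · have := truncatedGroundState_antitoneOn hg hs hr ε (hd.nonneg x₀ y) (hd.nonneg x₀ x) hle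
      have := mul_nonneg hpos (hd.nonneg x y)
      linarith
    · have h1 := truncatedGroundState_sub_le hg hs hr ε (hd.nonneg x₀ x) hle
      have h2 := hd.triangle x₀ x y
      have h3 := mul_le_mul_of_nonneg_left (by linarith : d x₀ y - d x₀ x ≤ d x y) hpos
      linarith
  · exact (hd.isCompact_closedBall hp x₀ r').of_isClosed_subset (isClosed_tsupport _) hsub

/-- The test function grows only away from `x₀`, at rate at most `|h'|` in `d(x₀, y) - d(x₀, x)`,
which is at most `d(x, y)`. A quasimetric offers the triangle inequality in this order only, whence
the minus sign in `radialTestFunction`. -/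
lemma slope_radialTestFunction_le (hd : IsQuasimetric d) (x₀ : M)
    (hg : IsRadialGroundState s r L h P) (hs : IsRadialWeight s) (hr : 0 < r) (ε : ℝ)
    {x : M} (hx : x ∈ qball d x₀ r) :
    slope_d d (radialTestFunction d x₀ h r ε) x ≤ ((P (d x₀ x) / s (d x₀ x) : ℝ) : EReal) := by
  set ρ := d x₀ x with hρ
  have hρ0 : 0 ≤ ρ := hd.nonneg x₀ x
  have hρr : ρ < r := hx
  have hq := hg.slope_nonneg hs ⟨hρ0, hρr.le⟩
  by_cases hbot : 𝓝[≠] x = ⊥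
  · rw [slope_d, if_pos hbot]
    exact_mod_cast hq
  rw [slope_d, if_neg hbot]
  refine EReal.le_of_forall_lt_iff_le.1 fun c hc => ?_
  have hc' : P ρ / s ρ < c := EReal.coe_lt_coe_iff.1 hc
  have hc0 : 0 < c := hq.trans_lt hc'
  refine limsup_le_of_le (h := ?_)
  have h1 : ∀ᶠ t in 𝓝[>] ρ, h ρ - h t ≤ c * (t - ρ) := by
    have h2 := (hasDerivAt_iff_tendsto_slope.1 (hg.hasDerivAt ρ)).mono_left
      (nhdsWithin_mono ρ (fun t ht => ne_of_gt ht : Set.Ioi ρ ⊆ {ρ}ᶜ))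
    filter_upwards [h2.eventually_const_lt (by linarith : -c < -(P ρ / s ρ)),
      self_mem_nhdsWithin] with t ht ht0
    have ht0' : 0 < t - ρ := sub_pos.2 ht0
    rw [slope_def_field, lt_div_iff₀ ht0'] at ht
    linarith
  have h2 : ∀ᶠ t in 𝓝 ρ, ρ < t → h ρ - h t ≤ c * (t - ρ) := eventually_nhdsWithin_iff.1 h1
  have h3 : ∀ᶠ y in 𝓝 x, (ρ < d x₀ y → h ρ - h (d x₀ y) ≤ c * (d x₀ y - ρ)) ∧ d x₀ y < r :=
    ((hd.continuous_dist x₀).tendsto x).eventually (h2.and (Iio_mem_nhds hρr))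
  filter_upwards [nhdsWithin_le_nhds h3] with y hy
  rw [EReal.coe_le_coe_iff]
  unfold radialTestFunction
  rw [← hρ]
  rcases le_or_gt (d x₀ y) ρ with hle | hlt
  · refine le_trans (div_nonpos_of_nonpos_of_nonneg ?_ (hd.nonneg x y)) hc0.le
    have := truncatedGroundState_antitoneOn hg hs hr ε (hd.nonneg x₀ y) hρ0 hle
    linarith
  · refine div_le_of_le_mul₀ (hd.nonneg x y) hc0.le ?_
    have e1 := truncatedGroundState_sub_le_sub hg hs hr ε hρ0 hlt.le
    rw [min_eq_left hρr.le, min_eq_left hy.2.le] at e1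
    have e2 := hy.1 hlt
    have e3 := mul_le_mul_of_nonneg_left
      (by linarith [hd.triangle x₀ x y] : d x₀ y - ρ ≤ d x y) hc0.le
    linarith

/-- An upper bound on the slope does not control its modulus, so negative values must be excluded.
They occur only at strict local maxima, which are countably many; points other than `x₀` are null,
and `x₀` is a minimum of the test function. -/
lemma ae_slope_radialTestFunction_nonneg [MeasurableSpace M] (hd : IsQuasimetric d)
    (hp : IsProperQuasimetric d) (x₀ : M) (μ : Measure M) (hnull : ∀ x, x ≠ x₀ → μ {x} = 0)
    (hg : IsRadialGroundState s r L h P) (hs : IsRadialWeight s) (hr : 0 < r) (ε : ℝ) :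
    ∀ᵐ x ∂μ, 0 ≤ slope_d d (radialTestFunction d x₀ h r ε) x := by
  have := hd.secondCountableTopology hp x₀
  set u := radialTestFunction d x₀ h r ε with hu
  have hsub : {x | ¬0 ≤ slope_d d u x} ⊆ {x | ∀ᶠ y in 𝓝[≠] x, u y < u x} := by
    intro x hx
    have hx' : slope_d d u x < 0 := not_le.1 hx
    by_cases hbot : 𝓝[≠] x = ⊥
    · simp [slope_d, hbot] at hx'
    rw [slope_d, if_neg hbot] at hx'
    have h1 := eventually_lt_of_limsup_lt hx'
    change ∀ᶠ y in 𝓝[≠] x, u y < u x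
    filter_upwards [h1] with y hy
    have hy' : (u y - u x) / d x y < 0 := by exact_mod_cast hy
    by_contra hcon
    exact absurd hy' (not_lt.2 (div_nonneg (by linarith) (hd.nonneg x y)))
  have hcount : {x | ¬0 ≤ slope_d d u x}.Countable :=
    (countable_setOf_strict_local_max u).mono hsub
  rw [ae_iff, measure_null_iff_singleton hcount]
  intro x hx
  refine hnull x fun hxx => ?_
  subst hxx
  have hx' : slope_d d u x < 0 := not_le.1 hx
  by_cases hbot : 𝓝[≠] x = ⊥
  · simp [slope_d, hbot] at hx'
  have : (𝓝[≠] x).NeBot := ⟨hbot⟩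
  have hmax : ∀ᶠ y in 𝓝[≠] x, u y < u x := hsub hx
  obtain ⟨y, hy⟩ := hmax.exists
  have := truncatedGroundState_antitoneOn hg hs hr ε (hd.nonneg x x) (hd.nonneg x y)
    (by rw [hd.dist_self]; exact hd.nonneg x y)
  simp only [hu, radialTestFunction] at hy
  linarith

/-- The radial test functions bound the fundamental frequency of a ball. -/
theorem fundamentalFrequency_mul_le [MeasurableSpace M] [BorelSpace M] (hd : IsQuasimetric d)
    (hp : IsProperQuasimetric d) (x₀ : M) (μ : Measure M) (hnull : ∀ x, x ≠ x₀ → μ {x} = 0)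
    (hg : IsRadialGroundState s r L h P) (hs : IsRadialWeight s) (hr : 0 < r) :
    fundamentalFrequency d μ (qball d x₀ r) *
        ∫⁻ x in qball d x₀ r, ENNReal.ofReal (h (d x₀ x) ^ 2) ∂μ ≤
      ∫⁻ x in qball d x₀ r, ENNReal.ofReal ((P (d x₀ x) / s (d x₀ x)) ^ 2) ∂μ := by
  have hball := (hd.isOpen_qball x₀ r).measurableSet
  have hδ := (hd.continuous_dist x₀).measurable
  have hkey : ∀ ε ∈ Set.Ioo (0 : ℝ) 1, fundamentalFrequency d μ (qball d x₀ r) *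
      ∫⁻ x in qball d x₀ r, ENNReal.ofReal (truncatedGroundState h r ε (d x₀ x) ^ 2) ∂μ ≤
      ∫⁻ x in qball d x₀ r, ENNReal.ofReal ((P (d x₀ x) / s (d x₀ x)) ^ 2) ∂μ := by
    intro ε hε
    set u := radialTestFunction d x₀ h r ε with hu
    have hu0 : u ≠ 0 := by
      intro h0
      have h1 : u x₀ = 0 := by rw [h0]; rfl
      simp only [hu, radialTestFunction, truncatedGroundState, hd.dist_self, min_eq_left hr.le,
        hg.map_zero, neg_eq_zero] at h1
      rw [max_eq_left (by linarith [hε.2])] at h1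
      linarith [hε.2]
    have hinf : fundamentalFrequency d μ (qball d x₀ r) ≤
        (∫⁻ x in qball d x₀ r, (slope_d d u x).abs ^ 2 ∂μ) /
          (∫⁻ x in qball d x₀ r, ENNReal.ofReal (u x ^ 2) ∂μ) :=
      iInf₂_le u ⟨isLipZero_radialTestFunction hd hp x₀ hg hs hr hε.1, hu0⟩
    have h1 := ENNReal.mul_le_of_le_div hinf
    simp only [hu, radialTestFunction, neg_sq] at h1
    refine h1.trans ?_
    refine lintegral_mono_ae ?_
    filter_upwards [ae_restrict_mem hball, ae_restrict_of_ae
      (ae_slope_radialTestFunction_nonneg hd hp x₀ μ hnull hg hs hr ε)] with x hx hx0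
    have h2 := EReal.abs_le_ofReal hx0 (slope_radialTestFunction_le hd x₀ hg hs hr ε hx)
    rw [ENNReal.ofReal_pow (hg.slope_nonneg hs ⟨hd.nonneg x₀ x, le_of_lt hx⟩)]
    exact pow_le_pow_left' h2 2
  set ε : ℕ → ℝ := fun k => 1 / ((k : ℝ) + 2) with hε
  have hεmem : ∀ k, ε k ∈ Set.Ioo (0 : ℝ) 1 := fun k => by
    refine ⟨by positivity, ?_⟩
    simp only [hε]
    rw [div_lt_one (by positivity)]
    have : (0 : ℝ) ≤ k := Nat.cast_nonneg k
    linarith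
  have hεanti : Antitone ε := fun i j hij => by
    simp only [hε]
    have : (i : ℝ) ≤ j := by exact_mod_cast hij
    exact one_div_le_one_div_of_le (by positivity) (by linarith)
  have hεlim : Tendsto ε atTop (𝓝 0) := by
    have h1 := (tendsto_one_div_add_atTop_nhds_zero_nat (𝕜 := ℝ)).comp (tendsto_add_atTop_nat 1)
    refine h1.congr fun k => ?_
    simp only [Function.comp, hε]
    push_cast
    congr 1
    ring
  have hmono : Monotone fun k x => ENNReal.ofReal (truncatedGroundState h r (ε k) (d x₀ x) ^ 2) := by
    intro i j hij x
    refine ENNReal.ofReal_le_ofReal (pow_le_pow_left₀ (le_max_right _ _) ?_ 2)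
    exact max_le_max_right 0 (sub_le_sub_left (hεanti hij) _)
  -- As `ε` decreases to `0` the truncations increase to `h`, so monotone convergence removes the
  -- truncation.
  have hsup : ∫⁻ x in qball d x₀ r, ENNReal.ofReal (h (d x₀ x) ^ 2) ∂μ =
      ⨆ k, ∫⁻ x in qball d x₀ r,
        ENNReal.ofReal (truncatedGroundState h r (ε k) (d x₀ x) ^ 2) ∂μ := by
    rw [← lintegral_iSup (fun k => ?_) hmono]
    · refine setLIntegral_congr_fun hball fun x hx => ?_
      refine (iSup_eq_of_tendsto (fun i j hij => hmono hij x) ?_).symm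
      refine ENNReal.tendsto_ofReal ?_
      have h1 : Tendsto (fun k => max (h (min (d x₀ x) r) - ε k) 0 ^ 2) atTop
          (𝓝 (max (h (min (d x₀ x) r) - 0) 0 ^ 2)) :=
        ((hεlim.const_sub _).max tendsto_const_nhds).pow 2
      have hx' : d x₀ x < r := hx
      rw [min_eq_left hx'.le, sub_zero, max_eq_left (hg.nonneg ⟨hd.nonneg x₀ x, hx'.le⟩)] at h1
      refine h1.congr fun k => ?_
      rw [truncatedGroundState, min_eq_left hx'.le]
    · have := (continuous_truncatedGroundState hg (ε k)).measurable
      fun_prop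
  rw [hsup, ENNReal.mul_iSup]
  exact iSup_le fun k => hkey (ε k) (hεmem k)

end TestFunction

/-! ### The area function and the volume of annuli. -/

/-- The area of the unit sphere of `ℝⁿ` divided by `κ^{n-1}`. -/
noncomputable def hyperbolicAreaConst (n : ℕ) (κ : ℝ) : ℝ :=
  (κ ^ (n - 1))⁻¹ * (n * volume.real (Metric.ball (0 : EuclideanSpace ℝ (Fin n)) 1))

lemma hyperbolicAreaConst_pos {n : ℕ} (hn : 1 ≤ n) {κ : ℝ} (hκ : 0 < κ) :
    0 < hyperbolicAreaConst n κ := by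
  have h1 : 0 < volume.real (Metric.ball (0 : EuclideanSpace ℝ (Fin n)) 1) :=
    ENNReal.toReal_pos (Metric.measure_ball_pos _ _ one_pos).ne' measure_ball_lt_top.ne
  have h2 : (0 : ℝ) < n := by exact_mod_cast hn
  unfold hyperbolicAreaConst
  positivity

lemma ofReal_hyperbolicAreaConst {n : ℕ} {κ : ℝ} (hκ : 0 < κ) :
    ENNReal.ofReal (hyperbolicAreaConst n κ) = ENNReal.ofReal ((κ ^ (n - 1))⁻¹) *
      (n * volume (Metric.ball (0 : EuclideanSpace ℝ (Fin n)) 1)) := by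
  rw [hyperbolicAreaConst, ENNReal.ofReal_mul (by positivity),
    ENNReal.ofReal_mul (Nat.cast_nonneg n), ENNReal.ofReal_natCast, measureReal_def,
    ENNReal.ofReal_toReal measure_ball_lt_top.ne]

lemma tendsto_sinh_div_pow (κ : ℝ) (m : ℕ) :
    Tendsto (fun ρ : ℝ => (Real.sinh (κ * ρ) / ρ) ^ m) (𝓝[>] 0) (𝓝 (κ ^ m)) := by
  have h1 : HasDerivAt (fun t => Real.sinh (κ * t)) κ 0 := by
    simpa using ((hasDerivAt_id (0 : ℝ)).const_mul κ).sinh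
  refine Tendsto.pow ?_ m
  refine h1.tendsto_slope_zero_right.congr fun t => ?_
  simp [div_eq_inv_mul]

lemma monotone_qball {M : Type*} (d : M → M → ℝ) (x₀ : M) : Monotone (qball d x₀) :=
  fun _ _ hab _ hy => lt_of_lt_of_le hy hab

section Area

variable {M : Type*} [MeasurableSpace M] {d : M → M → ℝ} {μ : Measure M} {n : ℕ} {κ : ℝ} {x₀ : M}

/-- The normalized area function of a space with the Bishop-Gromov property. -/
theorem exists_normalized_area (hn : 2 ≤ n) (hκ : 0 < κ) (hD : LocalDensity d μ n x₀)
    (hBG : BishopGromov d μ n κ x₀) :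
    ∃ w : ℝ → ℝ, AntitoneOn w (Set.Ioi 0) ∧ (∀ ρ, 0 < ρ → 0 ≤ w ρ) ∧
      Tendsto w (𝓝[>] 0) (𝓝 (hyperbolicAreaConst n κ)) ∧
      ∀ ρ, 0 < ρ → sphereArea d μ x₀ ρ = ENNReal.ofReal (w ρ * hyperbolicWeight n κ ρ) := by
  set W : ℝ → ℝ≥0∞ := fun ρ =>
    sphereArea d μ x₀ ρ / ENNReal.ofReal (Real.sinh (κ * ρ) ^ (n - 1)) with hW
  set k : ℝ≥0∞ := n * volume (Metric.ball (0 : EuclideanSpace ℝ (Fin n)) 1) with hk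
  have hk0 : k ≠ 0 := mul_ne_zero (by exact_mod_cast (by omega : n ≠ 0))
    (Metric.measure_ball_pos _ _ one_pos).ne'
  have hkt : k ≠ ⊤ := ENNReal.mul_ne_top (ENNReal.natCast_ne_top n) measure_ball_lt_top.ne
  set K : ℝ≥0∞ := ENNReal.ofReal (κ ^ (n - 1)) with hK
  have hK0 : K ≠ 0 := by
    rw [hK, ne_eq, ENNReal.ofReal_eq_zero, not_le]
    positivity
  have hKt : K ≠ ⊤ := ENNReal.ofReal_ne_top
  have hsinh : ∀ ρ, 0 < ρ → 0 < Real.sinh (κ * ρ) ^ (n - 1) := fun ρ hρ =>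
    pow_pos (Real.sinh_pos_iff.2 (mul_pos hκ hρ)) _
  set ℓ := sSup (W '' Set.Ioi 0) with hℓ
  -- Monotonicity provides a limit in `[0, ∞]`, so the lower limit in the density condition is a
  -- limit and determines `ℓ`.
  have hlim : Tendsto W (𝓝[>] 0) (𝓝 ℓ) := AntitoneOn.tendsto_nhdsGT hBG (OrderTop.bddAbove _)
  have hD' : Tendsto (fun ρ : ℝ => sphereArea d μ x₀ ρ / (k * ENNReal.ofReal (ρ ^ (n - 1))))
      (𝓝[>] 0) (𝓝 (ℓ * K / k)) := by
    have h1 := ENNReal.tendsto_ofReal (tendsto_sinh_div_pow κ (n - 1))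
    have h2 := ENNReal.Tendsto.div_const
      (ENNReal.Tendsto.mul hlim (Or.inr hKt) h1 (Or.inl hK0)) (b := k) (Or.inr hk0)
    refine h2.congr' ?_
    filter_upwards [self_mem_nhdsWithin] with ρ hρ
    have hρ0 : 0 < ρ := hρ
    have ha := hsinh ρ hρ0
    have hb : 0 < ρ ^ (n - 1) := pow_pos hρ0 _
    rw [div_pow, ENNReal.ofReal_div_of_pos hb]
    simp only [hW, div_eq_mul_inv]
    rw [ENNReal.mul_inv (Or.inl hk0) (Or.inl hkt), mul_assoc (sphereArea d μ x₀ ρ),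
      ← mul_assoc (ENNReal.ofReal _)⁻¹, ENNReal.inv_mul_cancel (ENNReal.ofReal_pos.2 ha).ne'
      ENNReal.ofReal_ne_top, one_mul]
    ring
  have h1 : ℓ * K / k = 1 := hD'.liminf_eq.symm.trans hD
  rw [ENNReal.div_eq_one_iff hk0 hkt] at h1
  have hℓeq : ℓ = ENNReal.ofReal (hyperbolicAreaConst n κ) := by
    rw [ofReal_hyperbolicAreaConst hκ, ← hk, ← h1, ENNReal.ofReal_inv_of_pos (by positivity), ← hK,
      mul_comm ℓ, ← mul_assoc, ENNReal.inv_mul_cancel hK0 hKt, one_mul]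
  have hℓt : ℓ ≠ ⊤ := by
    rw [hℓeq]
    exact ENNReal.ofReal_ne_top
  -- `ℓ` is the supremum of `W`, so its finiteness makes the area finite at every radius.
  have hWt : ∀ ρ, 0 < ρ → W ρ ≠ ⊤ := fun ρ hρ =>
    ne_top_of_le_ne_top hℓt (le_sSup ⟨ρ, hρ, rfl⟩)
  refine ⟨fun ρ => (W ρ).toReal, fun a ha b hb hab => ?_, fun _ _ => ENNReal.toReal_nonneg, ?_,
    fun ρ hρ => ?_⟩
  · exact ENNReal.toReal_mono (hWt a ha) (hBG ha hb hab)
  · have h2 := (ENNReal.tendsto_toReal hℓt).comp hlim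
    rwa [hℓeq, ENNReal.toReal_ofReal (hyperbolicAreaConst_pos (by omega) hκ).le] at h2
  · rw [ENNReal.ofReal_mul ENNReal.toReal_nonneg, ENNReal.ofReal_toReal (hWt ρ hρ),
      hyperbolicWeight_of_nonneg n κ hρ.le]
    exact (ENNReal.div_mul_cancel (ENNReal.ofReal_pos.2 (hsinh ρ hρ)).ne'
      ENNReal.ofReal_ne_top).symm

lemma measureReal_qball_sdiff (hm : ∀ ρ, MeasurableSet (qball d x₀ ρ))
    (hfin : ∀ ρ, μ (qball d x₀ ρ) ≠ ⊤) {a b : ℝ} (hab : a ≤ b) :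
    μ (qball d x₀ b \ qball d x₀ a) =
      ENNReal.ofReal (μ.real (qball d x₀ b) - μ.real (qball d x₀ a)) := by
  rw [measure_sdiff (monotone_qball d x₀ hab) (hm a).nullMeasurableSet (hfin a),
    ENNReal.ofReal_sub _ measureReal_nonneg, ofReal_measureReal (hfin b),
    ofReal_measureReal (hfin a)]

lemma sphereArea_eq_limsup_slope (hm : ∀ ρ, MeasurableSet (qball d x₀ ρ))
    (hfin : ∀ ρ, μ (qball d x₀ ρ) ≠ ⊤) (ρ : ℝ) :
    sphereArea d μ x₀ ρ =
      limsup (fun z => ENNReal.ofReal (slope (fun t => μ.real (qball d x₀ t)) ρ z)) (𝓝[>] ρ) := by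
  have hmap : 𝓝[>] ρ = map (fun δ => ρ + δ) (𝓝[>] 0) := by
    simp
  rw [hmap, sphereArea]
  refine limsup_congr ?_
  filter_upwards [self_mem_nhdsWithin] with δ hδ
  have hδ0 : 0 < δ := hδ
  rw [measureReal_qball_sdiff hm hfin (by linarith), ← ENNReal.ofReal_div_of_pos hδ0, slope_def_field,
    add_sub_cancel_left]

lemma slope_qball_nonneg (hfin : ∀ ρ, μ (qball d x₀ ρ) ≠ ⊤) {ρ z : ℝ} (h : ρ < z) :
    0 ≤ slope (fun t => μ.real (qball d x₀ t)) ρ z := by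
  rw [slope_def_field]
  exact div_nonneg (sub_nonneg.2 (measureReal_mono (monotone_qball d x₀ h.le) (hfin z)))
    (sub_nonneg.2 h.le)

/-- Continuity from the left holds because a ball is the union of the smaller ones. Continuity from
the right follows from the finiteness of the upper right difference quotient. -/
lemma continuousAt_measureReal_qball (hm : ∀ ρ, MeasurableSet (qball d x₀ ρ))
    (hfin : ∀ ρ, μ (qball d x₀ ρ) ≠ ⊤) {ρ : ℝ} (hA : sphereArea d μ x₀ ρ ≠ ⊤) :
    ContinuousAt (fun t => μ.real (qball d x₀ t)) ρ := by
  set F : ℝ → ℝ := fun t => μ.real (qball d x₀ t) with hF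
  have hmono : Monotone F := fun a b hab => measureReal_mono (monotone_qball d x₀ hab) (hfin b)
  rw [continuousAt_iff_continuous_left'_right']
  constructor
  · have hU : qball d x₀ ρ = ⋃ k : ℕ, qball d x₀ (ρ - 1 / ((k : ℝ) + 1)) := by
      ext y
      simp only [qball, Set.mem_iUnion, Set.mem_ofPred_eq]
      constructor
      · intro hy
        obtain ⟨k, hk⟩ := exists_nat_one_div_lt (sub_pos.2 hy)
        exact ⟨k, by linarith⟩
      · rintro ⟨k, hk⟩
        have : 0 < 1 / ((k : ℝ) + 1) := by positivity
        linarith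
    have hlim : Tendsto (fun k : ℕ => F (ρ - 1 / ((k : ℝ) + 1))) atTop (𝓝 (F ρ)) := by
      have h1 := tendsto_measure_iUnion_atTop (μ := μ)
        (s := fun k : ℕ => qball d x₀ (ρ - 1 / ((k : ℝ) + 1))) fun i j hij =>
          monotone_qball d x₀ (sub_le_sub_left (Nat.one_div_le_one_div hij) ρ)
      rw [← hU] at h1
      exact (ENNReal.tendsto_toReal (hfin ρ)).comp h1
    refine tendsto_order.2 ⟨fun a ha => ?_, fun b hb => ?_⟩
    · obtain ⟨k, hk⟩ := (hlim.eventually_const_lt ha).exists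
      have : ρ - 1 / ((k : ℝ) + 1) < ρ := by
        have : 0 < 1 / ((k : ℝ) + 1) := by positivity
        linarith
      filter_upwards [Ioo_mem_nhdsLT this] with z hz
      exact hk.trans_le (hmono hz.1.le)
    · filter_upwards [self_mem_nhdsWithin] with z hz
      exact (hmono (le_of_lt hz)).trans_lt hb
  · rw [sphereArea_eq_limsup_slope hm hfin] at hA
    obtain ⟨q, hq⟩ := ENNReal.lt_iff_exists_nnreal_btwn.1 (lt_top_iff_ne_top.2 hA)
    have hev := eventually_lt_of_limsup_lt hq.1
    have hlim : Tendsto (fun z => F ρ + q * (z - ρ)) (𝓝[>] ρ) (𝓝 (F ρ)) := by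
      have h1 : Tendsto (fun z => F ρ + q * (z - ρ)) (𝓝 ρ) (𝓝 (F ρ + q * (ρ - ρ))) :=
        Continuous.tendsto (by fun_prop) ρ
      rw [sub_self, mul_zero, add_zero] at h1
      exact h1.mono_left nhdsWithin_le_nhds
    refine tendsto_of_tendsto_of_tendsto_of_le_of_le' tendsto_const_nhds hlim ?_ ?_
    · filter_upwards [self_mem_nhdsWithin] with z hz
      exact hmono (le_of_lt hz)
    · filter_upwards [self_mem_nhdsWithin, hev] with z hz hz2
      have hz0 : 0 < z - ρ := sub_pos.2 hz
      rw [← ENNReal.ofReal_coe_nnreal] at hz2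
      have h2 := ((ENNReal.ofReal_lt_ofReal_iff_of_nonneg (slope_qball_nonneg hfin hz)).1 hz2).le
      rw [slope_def_field, div_le_iff₀ hz0] at h2
      linarith

/-- Two-sided bounds for the volume of an annulus in terms of the normalized area function. -/
theorem measureReal_qball_sub_bounds {s w : ℝ → ℝ} (hs : IsRadialWeight s)
    (hm : ∀ ρ, MeasurableSet (qball d x₀ ρ)) (hfin : ∀ ρ, μ (qball d x₀ ρ) ≠ ⊤)
    (hw : AntitoneOn w (Set.Ioi 0)) (hw0 : ∀ ρ, 0 < ρ → 0 ≤ w ρ)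
    (hA : ∀ ρ, 0 < ρ → sphereArea d μ x₀ ρ = ENNReal.ofReal (w ρ * s ρ)) {a b : ℝ}
    (ha : 0 < a) (hab : a ≤ b) :
    w b * ∫ t in a..b, s t ≤ μ.real (qball d x₀ b) - μ.real (qball d x₀ a) ∧
      μ.real (qball d x₀ b) - μ.real (qball d x₀ a) ≤ w a * ∫ t in a..b, s t := by
  set F : ℝ → ℝ := fun t => μ.real (qball d x₀ t) with hF
  have hFc : ContinuousOn F (Set.Icc a b) := fun t ht =>
    (continuousAt_measureReal_qball hm hfin (by
      rw [hA t (ha.trans_le ht.1)]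
      exact ENNReal.ofReal_ne_top)).continuousWithinAt
  have hS : ∀ t, HasDerivAt (fun t => ∫ τ in a..t, s τ) (s t) t := fun t =>
    intervalIntegral.integral_hasDerivAt_right (hs.continuous.intervalIntegrable _ _)
      hs.continuous.stronglyMeasurable.stronglyMeasurableAtFilter hs.continuous.continuousAt
  have hSc : ∀ c, ContinuousOn (fun t => c * ∫ τ in a..t, s τ) (Set.Icc a b) := fun c t _ =>
    ((hS t).const_mul c).continuousAt.continuousWithinAt
  constructor
  -- Only the upper right Dini derivative of `F` is known, namely `w s`. That of `-F` from below is
  -- `-w s`, which is what the mean value inequality requires.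
  · have key := image_le_of_liminf_slope_right_le_deriv_boundary (f := fun t => -F t)
      (B := fun t => -F a - w b * ∫ τ in a..t, s τ) (B' := fun t => -(w b * s t)) hFc.neg (by simp)
      (continuousOn_const.sub (hSc (w b)))
      (fun t _ => (((hS t).const_mul (w b)).const_sub (-F a)).hasDerivWithinAt) ?_
      (Set.right_mem_Icc.2 hab)
    · linarith
    · intro x hx q hq
      have hneg : ∀ z, slope (fun t => -F t) x z = -slope F x z := fun z => by
        rw [slope_def_field, slope_def_field]
        ring
      have hx0 : 0 < x := ha.trans_le hx.1
      -- Since `ENNReal.ofReal` forgets negative values, `q > 0` is treated apart; there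
      -- monotonicity of `F` suffices.
      by_cases hq0 : 0 < q
      · refine Eventually.frequently ?_
        filter_upwards [self_mem_nhdsWithin] with z hz
        have := slope_qball_nonneg hfin (hz : x < z)
        rw [hneg]
        linarith
      have h1 : ENNReal.ofReal (-q) < ENNReal.ofReal (w x * s x) := by
        refine (ENNReal.ofReal_lt_ofReal_iff_of_nonneg (by linarith)).2 ?_
        have := mul_le_mul_of_nonneg_right
          (hw hx0 (ha.trans_le hab) hx.2.le) (hs.nonneg x)
        linarith
      rw [← hA x hx0, sphereArea_eq_limsup_slope hm hfin] at h1
      refine (frequently_lt_of_lt_limsup (h := h1)).mono fun z hz => ?_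
      have h2 := (ENNReal.ofReal_lt_ofReal_iff_of_nonneg (by linarith)).1 hz
      rw [hneg]
      linarith
  · have key := image_le_of_liminf_slope_right_le_deriv_boundary (f := F)
      (B := fun t => F a + w a * ∫ τ in a..t, s τ) (B' := fun t => w a * s t) hFc (by simp)
      (continuousOn_const.add (hSc (w a)))
      (fun t _ => (((hS t).const_mul (w a)).const_add (F a)).hasDerivWithinAt) ?_
      (Set.right_mem_Icc.2 hab)
    · linarith
    · intro x hx q hq
      have hx0 : 0 < x := ha.trans_le hx.1
      have hwx := mul_nonneg (hw0 x hx0) (hs.nonneg x)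
      have hle := mul_le_mul_of_nonneg_right (hw ha hx0 hx.1) (hs.nonneg x)
      have h1 : ENNReal.ofReal (w x * s x) < ENNReal.ofReal q :=
        (ENNReal.ofReal_lt_ofReal_iff_of_nonneg hwx).2 (by linarith)
      rw [← hA x hx0, sphereArea_eq_limsup_slope hm hfin] at h1
      refine Eventually.frequently ?_
      filter_upwards [self_mem_nhdsWithin, eventually_lt_of_limsup_lt h1] with z hz hz2
      exact (ENNReal.ofReal_lt_ofReal_iff_of_nonneg (slope_qball_nonneg hfin hz)).1 hz2

/-- The sphere lies in every annulus with inner radius `ρ`, and these have measure tending to `0`.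
-/
lemma measure_sphere_eq_zero (hm : ∀ ρ, MeasurableSet (qball d x₀ ρ))
    (hfin : ∀ ρ, μ (qball d x₀ ρ) ≠ ⊤) {ρ : ℝ} (hA : sphereArea d μ x₀ ρ ≠ ⊤) :
    μ {y | d x₀ y = ρ} = 0 := by
  have hc := continuousAt_measureReal_qball hm hfin hA
  have hle : ∀ᶠ z in 𝓝[>] ρ, μ {y | d x₀ y = ρ} ≤
      ENNReal.ofReal (μ.real (qball d x₀ z) - μ.real (qball d x₀ ρ)) := by
    filter_upwards [self_mem_nhdsWithin] with z hz
    rw [← measureReal_qball_sdiff hm hfin (le_of_lt hz)]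
    refine measure_mono fun y hy => ?_
    have hy' : d x₀ y = ρ := hy
    exact ⟨hy'.trans_lt hz, fun h => absurd hy' (ne_of_lt h)⟩
  have hlim : Tendsto (fun z => ENNReal.ofReal (μ.real (qball d x₀ z) - μ.real (qball d x₀ ρ)))
      (𝓝[>] ρ) (𝓝 0) := by
    have h1 := ENNReal.tendsto_ofReal ((hc.mono_left (nhdsWithin_le_nhds (s := Set.Ioi ρ))).sub_const
      (μ.real (qball d x₀ ρ)))
    rwa [sub_self, ENNReal.ofReal_zero] at h1
  exact le_antisymm (ge_of_tendsto hlim hle) zero_le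

end Area

/-! ### Comparison of measures on the line. -/

namespace MeasureTheory.Measure

lemma continuousWithinAt_measureReal_Iic (μ : Measure ℝ) [IsFiniteMeasure μ] (x : ℝ) :
    ContinuousWithinAt (fun x => μ.real (Set.Iic x)) (Set.Ici x) x := by
  rw [← continuousWithinAt_Ioi_iff_Ici]
  have h1 := tendsto_measure_biInter_gt (μ := μ) (s := Set.Iic) (a := x)
    (fun r _ => measurableSet_Iic.nullMeasurableSet) (fun i j _ hij => Set.Iic_subset_Iic.2 hij)
    ⟨x + 1, by simp, measure_ne_top _ _⟩
  have h2 : ⋂ r > x, Set.Iic r = Set.Iic x := by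
    ext y
    simp only [Set.mem_iInter, Set.mem_Iic]
    exact ⟨fun h => le_of_forall_gt_imp_ge_of_dense h, fun h r hr => h.trans (le_of_lt hr)⟩
  rw [h2] at h1
  exact (ENNReal.tendsto_toReal (measure_ne_top _ _)).comp h1

/-- Finite measures on the line are compared on half-open intervals. -/
theorem le_of_Ioc {μ ν : Measure ℝ} [IsFiniteMeasure μ] [IsFiniteMeasure ν]
    (h : ∀ a b, a < b → μ (Set.Ioc a b) ≤ ν (Set.Ioc a b)) : μ ≤ ν := by
  have hIoc : ∀ (ρ : Measure ℝ) [IsFiniteMeasure ρ] (a b : ℝ), a ≤ b →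
      ρ.real (Set.Ioc a b) = ρ.real (Set.Iic b) - ρ.real (Set.Iic a) := by
    intro ρ _ a b hab
    rw [← Set.Iic_union_Ioc_eq_Iic hab, measureReal_union (Set.Iic_disjoint_Ioc le_rfl)
      measurableSet_Ioc]
    ring
  have hreal : ∀ a b, a < b → μ.real (Set.Ioc a b) ≤ ν.real (Set.Ioc a b) := fun a b hab =>
    ENNReal.toReal_mono (measure_ne_top _ _) (h a b hab)
  -- The difference of the distribution functions is nondecreasing and right-continuous, so it
  -- defines the measure that fills the gap between `μ` and `ν`.
  let G : StieltjesFunction ℝ :=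
    { toFun := fun x => ν.real (Set.Iic x) - μ.real (Set.Iic x)
      mono' := by
        intro a b hab
        rcases hab.eq_or_lt with rfl | hlt
        · exact le_rfl
        · have h1 := hreal a b hlt
          rw [hIoc μ a b hab, hIoc ν a b hab] at h1
          linarith
      right_continuous' := fun x => (continuousWithinAt_measureReal_Iic ν x).sub
        (continuousWithinAt_measureReal_Iic μ x) }
  have hsum : ν = μ + G.measure := by
    refine ext_of_Ioc _ _ fun a b hab => ?_
    rw [add_apply, StieltjesFunction.measure_Ioc]
    have h1 : G b - G a = ν.real (Set.Ioc a b) - μ.real (Set.Ioc a b) := by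
      rw [hIoc μ a b hab.le, hIoc ν a b hab.le]
      change (ν.real (Set.Iic b) - μ.real (Set.Iic b)) -
        (ν.real (Set.Iic a) - μ.real (Set.Iic a)) = _
      ring
    rw [h1, ENNReal.ofReal_sub _ measureReal_nonneg, ofReal_measureReal, ofReal_measureReal,
      add_tsub_cancel_of_le (h a b hab)]
  rw [hsum]
  exact Measure.le_add_right le_rfl

lemma isFiniteMeasure_restrict_Ioc_of_isLocallyFinite (μ : Measure ℝ) [IsLocallyFiniteMeasure μ] (s t : ℝ) :
    IsFiniteMeasure (μ.restrict (Set.Ioc s t)) :=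
  ⟨by rw [restrict_apply_univ]; exact measure_Ioc_lt_top⟩

theorem restrict_Ioc_le_restrict_Ioc {μ ν : Measure ℝ} [IsLocallyFiniteMeasure μ]
    [IsLocallyFiniteMeasure ν] {s t : ℝ}
    (h : ∀ a b, s ≤ a → a < b → b ≤ t → μ (Set.Ioc a b) ≤ ν (Set.Ioc a b)) :
    μ.restrict (Set.Ioc s t) ≤ ν.restrict (Set.Ioc s t) := by
  have := isFiniteMeasure_restrict_Ioc_of_isLocallyFinite μ s t
  have := isFiniteMeasure_restrict_Ioc_of_isLocallyFinite ν s t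
  refine le_of_Ioc fun a b _ => ?_
  rw [restrict_apply measurableSet_Ioc, restrict_apply measurableSet_Ioc, Set.Ioc_inter_Ioc]
  rcases lt_or_ge (max a s) (min b t) with hlt | hle
  · exact h _ _ (le_max_right _ _) hlt (min_le_right _ _)
  · simp [Set.Ioc_eq_empty_of_le hle]

/-- The positive measure `ν - μ` gives integral `0` to a function which is nonzero almost
everywhere, so it vanishes. -/
theorem eq_of_le_of_lintegral_le {α : Type*} [MeasurableSpace α] {μ ν : Measure α}
    [IsFiniteMeasure μ] (hle : μ ≤ ν) {g : α → ℝ≥0∞} (hg : Measurable g)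
    (hpos : ∀ᵐ x ∂ν, g x ≠ 0) (hfin : ∫⁻ x, g x ∂μ ≠ ⊤) (h : ∫⁻ x, g x ∂ν ≤ ∫⁻ x, g x ∂μ) :
    ν = μ := by
  have hsub : ν - μ + μ = ν := sub_add_cancel_of_le hle
  have h0 : ∫⁻ x, g x ∂(ν - μ) = 0 := by
    rw [← hsub, lintegral_add_measure] at h
    have h1 : ∫⁻ x, g x ∂(ν - μ) + ∫⁻ x, g x ∂μ ≤ 0 + ∫⁻ x, g x ∂μ := by rwa [zero_add]
    exact le_antisymm ((ENNReal.add_le_add_iff_right hfin).1 h1) zero_le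
  rw [lintegral_eq_zero_iff hg] at h0
  have hpos' : ∀ᵐ x ∂(ν - μ), g x ≠ 0 := ae_mono sub_le hpos
  have hz : ν - μ = 0 := by
    rw [← ae_eq_bot, ← eventually_false_iff_eq_bot]
    filter_upwards [h0, hpos'] with x h1 h2
    exact h2 h1
  rw [← hsub, hz, zero_add]

end MeasureTheory.Measure

lemma lintegral_ofReal_deriv_eq {G g : ℝ → ℝ} {a b : ℝ} (hab : a ≤ b)
    (hG : ∀ t, HasDerivAt G (g t) t) (hg : ∀ t ∈ Set.Ioo a b, 0 ≤ g t) :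
    ∫⁻ t in Set.Ioc a b, ENNReal.ofReal (g t) = ENNReal.ofReal (G b - G a) := by
  have hc : ContinuousOn G (Set.Icc a b) := fun t _ => (hG t).continuousAt.continuousWithinAt
  have hi := intervalIntegral.integrableOn_deriv_of_nonneg hc (fun t _ => hG t) hg
  rw [← ofReal_integral_eq_lintegral_ofReal hi, ← intervalIntegral.integral_of_le hab,
    intervalIntegral.integral_eq_sub_of_hasDerivAt_of_le hab hc (fun t _ => hG t)
      ((intervalIntegrable_iff_integrableOn_Ioc_of_le hab).2 hi)]
  rw [Measure.restrict_congr_set Ioo_ae_eq_Ioc.symm]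
  filter_upwards [ae_restrict_mem measurableSet_Ioo] with t ht
  exact hg t ht

/-- The measure `c s(t) dt`. -/
noncomputable def weightMeasure (s : ℝ → ℝ) (c : ℝ) : Measure ℝ :=
  volume.withDensity fun t => ENNReal.ofReal (c * s t)

section WeightMeasure

variable {s : ℝ → ℝ} {c : ℝ}

lemma isLocallyFiniteMeasure_weightMeasure (hs : IsRadialWeight s) (c : ℝ) :
    IsLocallyFiniteMeasure (weightMeasure s c) := by
  have := hs.continuous
  exact IsLocallyFiniteMeasure.withDensity_ofReal (by fun_prop)

lemma weightMeasure_Ioc (hs : IsRadialWeight s) (hc : 0 ≤ c) {a b : ℝ} (hab : a ≤ b) :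
    weightMeasure s c (Set.Ioc a b) = ENNReal.ofReal (c * ∫ t in a..b, s t) := by
  have h1 := hs.continuous
  rw [weightMeasure, withDensity_apply _ measurableSet_Ioc, ← ofReal_integral_eq_lintegral_ofReal,
    ← intervalIntegral.integral_of_le hab, intervalIntegral.integral_const_mul]
  · exact (Continuous.intervalIntegrable (by fun_prop) a b).1
  · exact Eventually.of_forall fun t => mul_nonneg hc (hs.nonneg t)

lemma setLIntegral_weightMeasure (hs : IsRadialWeight s) (hc : 0 ≤ c) {g : ℝ → ℝ}
    (hg : Measurable g) {E : Set ℝ} (hE : MeasurableSet E) :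
    ∫⁻ t in E, ENNReal.ofReal (g t) ∂weightMeasure s c =
      ENNReal.ofReal c * ∫⁻ t in E, ENNReal.ofReal (s t * g t) := by
  have h1 := hs.continuous
  rw [weightMeasure, setLIntegral_withDensity_eq_setLIntegral_mul _ (by fun_prop) (by fun_prop) hE,
    ← lintegral_const_mul' _ _ (by simp)]
  refine lintegral_congr fun t => ?_
  rw [Pi.mul_apply, ENNReal.ofReal_mul hc, ENNReal.ofReal_mul (hs.nonneg t), mul_assoc]

end WeightMeasure

/-! ### Energy comparison and its equality case. -/

/-- Comparison of the energy and the mass of a ground state with respect to a measure which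
dominates `c s(t) dt` before the sign change and is dominated by it afterwards. -/
theorem IsRadialGroundState.energy_comparison {s h P : ℝ → ℝ} {r L c t₀ : ℝ}
    (hg : IsRadialGroundState s r L h P) (hs : IsRadialWeight s) (hc : 0 ≤ c)
    (ht₀ : t₀ ∈ Set.Ioo 0 r) (hlt : ∀ t ∈ Set.Ioo 0 t₀, (P t / s t) ^ 2 < L * h t ^ 2)
    (heq : (P t₀ / s t₀) ^ 2 = L * h t₀ ^ 2)
    (hgt : ∀ t ∈ Set.Ioc t₀ r, L * h t ^ 2 < (P t / s t) ^ 2)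
    {m : Measure ℝ} [IsFiniteMeasure m] (hm0 : m (Set.Iio 0) = 0) (hmr : m (Set.Ioi r) = 0)
    (hmt : m {t₀} = 0)
    (hlow : (weightMeasure s c).restrict (Set.Ioc 0 t₀) ≤ m.restrict (Set.Ioc 0 t₀))
    (hupp : m.restrict (Set.Ioc t₀ r) ≤ (weightMeasure s c).restrict (Set.Ioc t₀ r)) :
    ∫⁻ t, ENNReal.ofReal ((P t / s t) ^ 2) ∂m ≤
        ENNReal.ofReal L * ∫⁻ t, ENNReal.ofReal (h t ^ 2) ∂m ∧
      (ENNReal.ofReal L * ∫⁻ t, ENNReal.ofReal (h t ^ 2) ∂m ≤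
        ∫⁻ t, ENNReal.ofReal ((P t / s t) ^ 2) ∂m →
          m = (weightMeasure s c).restrict (Set.Ioc 0 r)) := by
  have := isLocallyFiniteMeasure_weightMeasure hs c
  have hLp := hg.pos_eigenvalue
  have hhm : Measurable h := hg.continuous.measurable
  have hPm : Measurable P := hg.continuous_flux.measurable
  have hsm : Measurable s := hs.continuous.measurable
  set g : ℝ → ℝ := fun t => L * h t ^ 2 - (P t / s t) ^ 2 with hgdef
  have hgm : Measurable g := by fun_prop
  -- Here `P 0 / s 0 = 0 / 0 = 0`. An atom of `m` at `0`, that is, positive mass of the point `x₀`,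
  -- is not excluded beforehand, and `g 0 > 0` puts it on the favourable side.
  have hg0 : g 0 = L := by simp [hgdef, hg.map_zero, hg.flux_zero]
  -- Since `s g = (h P)'` and `h P` vanishes at `0` and `r`, the positive and negative parts of `g`
  -- have the same integral `Γ` against `c s dt` on `(0, r]`.
  set Γ : ℝ≥0∞ := ENNReal.ofReal c * ENNReal.ofReal (h t₀ * P t₀) with hΓ
  have hΓt : Γ ≠ ⊤ := ENNReal.mul_ne_top ENNReal.ofReal_ne_top ENNReal.ofReal_ne_top
  have hsg : ∀ t, s t * g t = L * (s t * h t ^ 2) - P t ^ 2 / s t := by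
    intro t
    simp only [hgdef]
    by_cases h0 : s t = 0
    · simp [h0]
    · field_simp
  have hΓ1 : ∫⁻ t in Set.Ioc 0 t₀, ENNReal.ofReal (g t) ∂weightMeasure s c = Γ := by
    rw [setLIntegral_weightMeasure hs hc hgm measurableSet_Ioc,
      lintegral_ofReal_deriv_eq (G := fun t => h t * P t) ht₀.1.le, hg.flux_zero, mul_zero, sub_zero]
    · intro t
      rw [hsg]
      exact hg.hasDerivAt_mul_flux t
    · intro t ht
      exact mul_nonneg (hs.nonneg t) (sub_nonneg.2 (hlt t ht).le)
  have hΓ2 : ∫⁻ t in Set.Ioc t₀ r, ENNReal.ofReal (-g t) ∂weightMeasure s c = Γ := by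
    rw [setLIntegral_weightMeasure hs hc (g := fun t => -g t) hgm.neg measurableSet_Ioc,
      lintegral_ofReal_deriv_eq (G := fun t => -(h t * P t)) ht₀.2.le, hg.map_radius, zero_mul,
      neg_zero, zero_sub, neg_neg]
    · intro t
      rw [mul_neg, hsg]
      exact (hg.hasDerivAt_mul_flux t).neg
    · intro t ht
      refine mul_nonneg (hs.nonneg t) ?_
      have := hgt t ⟨ht.1, ht.2.le⟩
      simp only [hgdef]
      linarith
  have hm0' : ∀ᵐ t ∂m, 0 ≤ t := by
    rw [ae_iff]
    simpa [Set.Iio] using hm0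
  have hmr' : ∀ᵐ t ∂m, t ≤ r := by
    rw [ae_iff]
    simpa [Set.Ioi] using hmr
  have hmt' : ∀ᵐ t ∂m, t ≠ t₀ := by
    rw [ae_iff]
    simpa using hmt
  have hresIoi : m.restrict (Set.Ioi t₀) = m.restrict (Set.Ioc t₀ r) := by
    refine Measure.restrict_congr_set ?_
    filter_upwards [hmr'] with t ht
    exact propext ⟨fun h1 => ⟨h1, ht⟩, fun h1 => h1.1⟩
  have hsplit : m.restrict (Set.Iic t₀) + m.restrict (Set.Ioc t₀ r) = m := by
    rw [← hresIoi, ← Set.compl_Iic]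
    exact Measure.restrict_add_restrict_compl measurableSet_Iic
  have hIocIic : m.restrict (Set.Ioc 0 t₀) ≤ m.restrict (Set.Iic t₀) :=
    Measure.restrict_mono_set m Set.Ioc_subset_Iic_self
  have hp1 : Γ ≤ ∫⁻ t in Set.Iic t₀, ENNReal.ofReal (g t) ∂m := by
    rw [← hΓ1]
    exact lintegral_mono' (hlow.trans hIocIic) le_rfl
  have hp2 : ∫⁻ t in Set.Iic t₀, ENNReal.ofReal (g t) ∂m ≤ ∫⁻ t, ENNReal.ofReal (g t) ∂m :=
    setLIntegral_le_lintegral _ _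
  have hn1 : ∫⁻ t in Set.Ioc t₀ r, ENNReal.ofReal (-g t) ∂m ≤ Γ := by
    rw [← hΓ2]
    exact lintegral_mono' hupp le_rfl
  have hn2 : ∫⁻ t, ENNReal.ofReal (-g t) ∂m = ∫⁻ t in Set.Ioc t₀ r, ENNReal.ofReal (-g t) ∂m := by
    conv_lhs => rw [← hsplit, lintegral_add_measure]
    suffices h0 : ∫⁻ t in Set.Iic t₀, ENNReal.ofReal (-g t) ∂m = 0 by rw [h0, zero_add]
    rw [lintegral_eq_zero_iff (by fun_prop)]
    filter_upwards [ae_restrict_mem measurableSet_Iic, ae_restrict_of_ae hm0'] with t ht1 ht2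
    have h1 : 0 ≤ g t := by
      rcases eq_or_lt_of_le ht2 with h0 | h0
      · rw [← h0, hg0]
        exact hLp.le
      · rcases eq_or_lt_of_le (Set.mem_Iic.1 ht1) with h2 | h2
        · simp only [hgdef]
          rw [h2, heq, sub_self]
        · exact sub_nonneg.2 (hlt t ⟨h0, h2⟩).le
    simp [h1]
  -- `L h² + g⁻ = h'² + g⁺`, which avoids subtraction in `[0, ∞]`.
  have hid : ENNReal.ofReal L * ∫⁻ t, ENNReal.ofReal (h t ^ 2) ∂m +
      ∫⁻ t, ENNReal.ofReal (-g t) ∂m =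
      ∫⁻ t, ENNReal.ofReal ((P t / s t) ^ 2) ∂m + ∫⁻ t, ENNReal.ofReal (g t) ∂m := by
    rw [← lintegral_const_mul' _ _ (by simp), ← lintegral_add_left (by fun_prop),
      ← lintegral_add_left (by fun_prop)]
    refine lintegral_congr fun t => ?_
    rw [← ENNReal.ofReal_mul hLp.le]
    have e : g t = L * h t ^ 2 - (P t / s t) ^ 2 := rfl
    have e1 : 0 ≤ L * h t ^ 2 := by positivity
    rcases le_total 0 (g t) with h1 | h1
    · rw [ENNReal.ofReal_of_nonpos (by linarith : -g t ≤ 0), add_zero,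
        ← ENNReal.ofReal_add (sq_nonneg _) h1]
      congr 1
      linarith
    · rw [ENNReal.ofReal_of_nonpos h1, add_zero, ← ENNReal.ofReal_add e1 (by linarith)]
      congr 1
      linarith
  refine ⟨?_, fun hle => ?_⟩
  · refine (ENNReal.add_le_add_iff_right hΓt).1 ?_
    calc _ ≤ ∫⁻ t, ENNReal.ofReal ((P t / s t) ^ 2) ∂m + ∫⁻ t, ENNReal.ofReal (g t) ∂m := by
          gcongr
          exact hp1.trans hp2
      _ = _ := hid.symm
      _ ≤ _ := by
          gcongr
          rw [hn2]
          exact hn1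
  · have hDfin : ENNReal.ofReal L * ∫⁻ t, ENNReal.ofReal (h t ^ 2) ∂m ≠ ⊤ := by
      refine ENNReal.mul_ne_top ENNReal.ofReal_ne_top (ne_top_of_le_ne_top (measure_ne_top m Set.univ) ?_)
      rw [← lintegral_one]
      refine lintegral_mono_ae ?_
      filter_upwards [hm0', hmr'] with t h1 h2
      rw [← ENNReal.ofReal_one]
      exact ENNReal.ofReal_le_ofReal (pow_le_one₀ (hg.nonneg ⟨h1, h2⟩) (hg.le_one hs ⟨h1, h2⟩))
    -- This closes the chain `Γ ≤ ∫ g⁺ dm ≤ ∫ g⁻ dm ≤ Γ`. As `g` is nonzero almost everywhere on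
    -- either side of `t₀`, both dominations become equalities, and an atom at `0` is ruled out.
    have hpn : ∫⁻ t, ENNReal.ofReal (g t) ∂m ≤ ∫⁻ t, ENNReal.ofReal (-g t) ∂m := by
      refine (ENNReal.add_le_add_iff_left hDfin).1 ?_
      rw [hid]
      gcongr
    have := Measure.isFiniteMeasure_restrict_Ioc_of_isLocallyFinite (weightMeasure s c) 0 t₀
    have e1 : m.restrict (Set.Iic t₀) = (weightMeasure s c).restrict (Set.Ioc 0 t₀) := by
      refine Measure.eq_of_le_of_lintegral_le (hlow.trans hIocIic) (g := fun t => ENNReal.ofReal (g t))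
        (by fun_prop) ?_ (by rw [hΓ1]; exact hΓt) ?_
      · filter_upwards [ae_restrict_mem measurableSet_Iic, ae_restrict_of_ae hm0',
          ae_restrict_of_ae hmt'] with t ht1 ht2 ht3
        rw [ne_eq, ENNReal.ofReal_eq_zero, not_le]
        rcases eq_or_lt_of_le ht2 with h0 | h0
        · rwa [← h0, hg0]
        · exact sub_pos.2 (hlt t ⟨h0, lt_of_le_of_ne ht1 ht3⟩)
      · rw [hΓ1]
        exact hp2.trans (hpn.trans (hn2.le.trans hn1))
    have e2 : (weightMeasure s c).restrict (Set.Ioc t₀ r) = m.restrict (Set.Ioc t₀ r) := by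
      refine Measure.eq_of_le_of_lintegral_le hupp (g := fun t => ENNReal.ofReal (-g t))
        (by fun_prop) ?_ (ne_top_of_le_ne_top hΓt hn1) ?_
      · filter_upwards [ae_restrict_mem measurableSet_Ioc] with t ht
        rw [ne_eq, ENNReal.ofReal_eq_zero, not_le]
        have := hgt t ht
        simp only [hgdef]
        linarith
      · rw [hΓ2, ← hn2]
        exact hp1.trans (hp2.trans hpn)
    rw [← hsplit, e1, ← e2, ← Set.Ioc_union_Ioc_eq_Ioc ht₀.1.le ht₀.2.le,
      Measure.restrict_union (Set.Ioc_disjoint_Ioc_of_le le_rfl) measurableSet_Ioc]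

/-! ### The law of the distance from `x₀` against the weight. -/

/-- The distribution of the distance from `x₀` under the restriction of `μ` to the ball of
radius `r`. -/
noncomputable def distDistribution {M : Type*} [MeasurableSpace M] (d : M → M → ℝ) (μ : Measure M)
    (x₀ : M) (r : ℝ) : Measure ℝ :=
  (μ.restrict (qball d x₀ r)).map (d x₀)

section DistDistribution

variable {M : Type*} [MeasurableSpace M] {d : M → M → ℝ} {μ : Measure M} {x₀ : M}

lemma distDistribution_apply (hδ : Measurable (d x₀)) (r : ℝ) {E : Set ℝ} (hE : MeasurableSet E) :
    distDistribution d μ x₀ r E = μ {y | d x₀ y ∈ E ∧ d x₀ y < r} := by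
  rw [distDistribution, Measure.map_apply hδ hE, Measure.restrict_apply (hδ hE)]
  rfl

lemma lintegral_distDistribution (hδ : Measurable (d x₀)) (r : ℝ) {g : ℝ → ℝ≥0∞}
    (hg : Measurable g) :
    ∫⁻ t, g t ∂distDistribution d μ x₀ r = ∫⁻ y in qball d x₀ r, g (d x₀ y) ∂μ :=
  lintegral_map hg hδ

lemma isFiniteMeasure_distDistribution (hδ : Measurable (d x₀)) {r : ℝ}
    (hfin : μ (qball d x₀ r) ≠ ⊤) : IsFiniteMeasure (distDistribution d μ x₀ r) :=
  ⟨by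
    rw [distDistribution_apply hδ r MeasurableSet.univ]
    exact (measure_mono fun y hy => hy.2).trans_lt hfin.lt_top⟩

lemma distDistribution_Ioc (hδ : Measurable (d x₀)) (hm : ∀ ρ, MeasurableSet (qball d x₀ ρ))
    (hfin : ∀ ρ, μ (qball d x₀ ρ) ≠ ⊤) {a b r : ℝ} (hab : a ≤ b) (hbr : b ≤ r)
    (ha : μ {y | d x₀ y = a} = 0) (hb : μ {y | d x₀ y = b} = 0) :
    distDistribution d μ x₀ r (Set.Ioc a b) =
      ENNReal.ofReal (μ.real (qball d x₀ b) - μ.real (qball d x₀ a)) := by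
  rw [distDistribution_apply hδ r measurableSet_Ioc, ← measureReal_qball_sdiff hm hfin hab]
  have ha' : ∀ᵐ y ∂μ, d x₀ y ≠ a := by simpa [ae_iff] using ha
  have hb' : ∀ᵐ y ∂μ, d x₀ y ≠ b := by simpa [ae_iff] using hb
  refine measure_congr ?_
  filter_upwards [ha', hb'] with y h1 h2
  refine propext ⟨fun h => ⟨lt_of_le_of_ne h.1.2 h2, fun h3 => lt_asymm h3 h.1.1⟩, fun h => ?_⟩
  have h3 : d x₀ y < b := h.1
  exact ⟨⟨lt_of_le_of_ne (not_lt.1 h.2) h1.symm, h3.le⟩, h3.trans_le hbr⟩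

end DistDistribution

section Comparison

variable {M : Type*} [MeasurableSpace M] {d : M → M → ℝ} {μ : Measure M} {x₀ : M} {s w : ℝ → ℝ}
  {r t₀ : ℝ}

/-- Before `t₀` the normalized area is at least `w t₀`. The annulus bounds need a positive inner
radius, so intervals starting at `0` are reached by a limit. -/
lemma weightMeasure_le_distDistribution (hs : IsRadialWeight s) (hδ : Measurable (d x₀))
    (hm : ∀ ρ, MeasurableSet (qball d x₀ ρ)) (hfin : ∀ ρ, μ (qball d x₀ ρ) ≠ ⊤)
    (hw : AntitoneOn w (Set.Ioi 0)) (hw0 : ∀ ρ, 0 < ρ → 0 ≤ w ρ)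
    (hA : ∀ ρ, 0 < ρ → sphereArea d μ x₀ ρ = ENNReal.ofReal (w ρ * s ρ)) (ht₀ : t₀ ∈ Set.Ioo 0 r) :
    (weightMeasure s (w t₀)).restrict (Set.Ioc 0 t₀) ≤
      (distDistribution d μ x₀ r).restrict (Set.Ioc 0 t₀) := by
  have hnull : ∀ ρ, 0 < ρ → μ {y | d x₀ y = ρ} = 0 := fun ρ hρ =>
    measure_sphere_eq_zero hm hfin (by rw [hA ρ hρ]; exact ENNReal.ofReal_ne_top)
  have := isLocallyFiniteMeasure_weightMeasure hs (w t₀)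
  have := isFiniteMeasure_distDistribution hδ (hfin r)
  have hc := hw0 t₀ ht₀.1
  have hpos : ∀ a b, 0 < a → a < b → b ≤ t₀ → ENNReal.ofReal (w t₀ * ∫ t in a..b, s t) ≤
      distDistribution d μ x₀ r (Set.Ioc a b) := by
    intro a b ha hab hb
    rw [distDistribution_Ioc hδ hm hfin hab.le (hb.trans ht₀.2.le) (hnull a ha)
      (hnull b (ha.trans hab))]
    refine ENNReal.ofReal_le_ofReal (le_trans ?_
      (measureReal_qball_sub_bounds hs hm hfin hw hw0 hA ha hab.le).1)
    exact mul_le_mul_of_nonneg_right (hw (ha.trans hab) ht₀.1 hb)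
      (intervalIntegral.integral_nonneg hab.le fun t _ => hs.nonneg t)
  refine Measure.restrict_Ioc_le_restrict_Ioc fun a b ha hab hb => ?_
  rw [weightMeasure_Ioc hs hc hab.le]
  rcases ha.eq_or_lt with rfl | ha
  · have hlim : Tendsto (fun a => ENNReal.ofReal (w t₀ * ∫ t in a..b, s t)) (𝓝[>] 0)
        (𝓝 (ENNReal.ofReal (w t₀ * ∫ t in (0 : ℝ)..b, s t))) := by
      have h1 : Continuous fun a => ∫ t in b..a, s t :=
        intervalIntegral.continuous_primitive (fun a b => hs.continuous.intervalIntegrable a b) b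
      have h2 : Continuous fun a => ENNReal.ofReal (w t₀ * ∫ t in a..b, s t) := by
        simp only [intervalIntegral.integral_symm b]
        exact ENNReal.continuous_ofReal.comp (by fun_prop)
      exact (h2.tendsto 0).mono_left nhdsWithin_le_nhds
    refine le_of_tendsto hlim ?_
    filter_upwards [Ioo_mem_nhdsGT hab] with a' ha'
    exact (hpos a' b ha'.1 ha'.2 hb).trans (measure_mono (Set.Ioc_subset_Ioc_left ha'.1.le))
  · exact hpos a b ha hab hb

lemma distDistribution_le_weightMeasure (hs : IsRadialWeight s) (hδ : Measurable (d x₀))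
    (hm : ∀ ρ, MeasurableSet (qball d x₀ ρ)) (hfin : ∀ ρ, μ (qball d x₀ ρ) ≠ ⊤)
    (hw : AntitoneOn w (Set.Ioi 0)) (hw0 : ∀ ρ, 0 < ρ → 0 ≤ w ρ)
    (hA : ∀ ρ, 0 < ρ → sphereArea d μ x₀ ρ = ENNReal.ofReal (w ρ * s ρ)) (ht₀ : 0 < t₀) :
    (distDistribution d μ x₀ r).restrict (Set.Ioc t₀ r) ≤
      (weightMeasure s (w t₀)).restrict (Set.Ioc t₀ r) := by
  have hnull : ∀ ρ, 0 < ρ → μ {y | d x₀ y = ρ} = 0 := fun ρ hρ =>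
    measure_sphere_eq_zero hm hfin (by rw [hA ρ hρ]; exact ENNReal.ofReal_ne_top)
  have := isLocallyFiniteMeasure_weightMeasure hs (w t₀)
  have := isFiniteMeasure_distDistribution hδ (hfin r)
  refine Measure.restrict_Ioc_le_restrict_Ioc fun a b ha hab hb => ?_
  have ha0 : 0 < a := ht₀.trans_le ha
  rw [weightMeasure_Ioc hs (hw0 t₀ ht₀) hab.le,
    distDistribution_Ioc hδ hm hfin hab.le hb (hnull a ha0) (hnull b (ha0.trans hab))]
  refine ENNReal.ofReal_le_ofReal
    ((measureReal_qball_sub_bounds hs hm hfin hw hw0 hA ha0 hab.le).2.trans ?_)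
  exact mul_le_mul_of_nonneg_right (hw ht₀ ha0 ha)
    (intervalIntegral.integral_nonneg hab.le fun t _ => hs.nonneg t)

lemma measure_qball_of_distDistribution_eq (hs : IsRadialWeight s) (hδ : Measurable (d x₀))
    {c ρ : ℝ} (hc : 0 ≤ c) (hρ : 0 < ρ) (hρr : ρ < r) (hnull : μ {y | d x₀ y = ρ} = 0)
    (h : distDistribution d μ x₀ r = (weightMeasure s c).restrict (Set.Ioc 0 r)) :
    μ (qball d x₀ ρ) = ENNReal.ofReal (c * ∫ t in (0 : ℝ)..ρ, s t) := by
  have h1 : distDistribution d μ x₀ r (Set.Iic ρ) = μ (qball d x₀ ρ) := by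
    rw [distDistribution_apply hδ r measurableSet_Iic]
    have hρ' : ∀ᵐ y ∂μ, d x₀ y ≠ ρ := by simpa [ae_iff] using hnull
    refine measure_congr ?_
    filter_upwards [hρ'] with y hy
    exact propext ⟨fun h => lt_of_le_of_ne h.1 hy,
      fun h => ⟨le_of_lt h, lt_trans (show d x₀ y < ρ from h) hρr⟩⟩
  rw [← h1, h, Measure.restrict_apply measurableSet_Iic, Set.Iic_inter_Ioc_of_le hρr.le,
    weightMeasure_Ioc hs hc hρ.le]

/-- The annulus bounds give `w b ≤ c ≤ w a` for `0 < a < b < r`, so `w` can only tend to `c`. -/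
lemma eq_of_tendsto_normalized_area (hs : IsRadialWeight s)
    (hm : ∀ ρ, MeasurableSet (qball d x₀ ρ)) (hfin : ∀ ρ, μ (qball d x₀ ρ) ≠ ⊤)
    (hw : AntitoneOn w (Set.Ioi 0)) (hw0 : ∀ ρ, 0 < ρ → 0 ≤ w ρ)
    (hA : ∀ ρ, 0 < ρ → sphereArea d μ x₀ ρ = ENNReal.ofReal (w ρ * s ρ)) {c C : ℝ} (hc : 0 ≤ c)
    (hr : 0 < r) (hC : Tendsto w (𝓝[>] 0) (𝓝 C))
    (h : ∀ ρ, 0 < ρ → ρ < r →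
      μ (qball d x₀ ρ) = ENNReal.ofReal (c * ∫ t in (0 : ℝ)..ρ, s t)) : c = C := by
  have hi : ∀ a b, IntervalIntegrable s volume a b := fun a b => hs.continuous.intervalIntegrable a b
  have hreal : ∀ ρ, 0 < ρ → ρ < r → μ.real (qball d x₀ ρ) = c * ∫ t in (0 : ℝ)..ρ, s t := by
    intro ρ hρ hρr
    rw [measureReal_def, h ρ hρ hρr, ENNReal.toReal_ofReal]
    exact mul_nonneg hc (intervalIntegral.integral_nonneg hρ.le fun t _ => hs.nonneg t)
  have hbounds : ∀ a b, 0 < a → a < b → b < r → w b ≤ c ∧ c ≤ w a := by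
    intro a b ha hab hb
    have hI : 0 < ∫ t in a..b, s t := intervalIntegral.intervalIntegral_pos_of_pos_on (hi a b)
      (fun t ht => hs.pos t (ha.trans ht.1)) hab
    obtain ⟨h1, h2⟩ := measureReal_qball_sub_bounds hs hm hfin hw hw0 hA ha hab.le
    rw [hreal a ha (hab.trans hb), hreal b (ha.trans hab) hb, ← mul_sub,
      intervalIntegral.integral_interval_sub_left (hi 0 b) (hi 0 a)] at h1 h2
    exact ⟨le_of_mul_le_mul_right h1 hI, le_of_mul_le_mul_right h2 hI⟩
  refine le_antisymm (ge_of_tendsto hC ?_) (le_of_tendsto hC ?_)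
  · filter_upwards [Ioo_mem_nhdsGT hr] with a ha
    exact (hbounds a ((a + r) / 2) ha.1 (by linarith [ha.2]) (by linarith [ha.2])).2
  · filter_upwards [Ioo_mem_nhdsGT hr] with b hb
    exact (hbounds (b / 2) b (by linarith [hb.1]) (by linarith [hb.1]) hb.2).1

end Comparison

/-! ### The comparison theorem and its rigidity. -/

theorem theorem1p2 {M : Type*} [TopologicalSpace M] [MeasurableSpace M] [BorelSpace M]
    (d : M → M → ℝ) (hd : IsQuasimetric d) (hproper : IsProperQuasimetric d)
    (μ : Measure M) [IsLocallyFiniteMeasure μ] [μ.IsOpenPosMeasure]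
    (n : ℕ) (hn : 2 ≤ n) (κ : ℝ) (hκ : 0 < κ) (x₀ : M)
    (hD : LocalDensity d μ n x₀) (hBG : BishopGromov d μ n κ x₀)
    (r : ℝ) (hr : 0 < r) :
    fundamentalFrequency d μ (qball d x₀ r) ≤
        fundamentalFrequency (hypDist n κ) (hypMeasure n κ) (hypBall n κ r) ∧
      (fundamentalFrequency d μ (qball d x₀ r) =
          fundamentalFrequency (hypDist n κ) (hypMeasure n κ) (hypBall n κ r) →
        ∀ ρ : ℝ, 0 < ρ → ρ < r → μ (qball d x₀ ρ) = hypMeasure n κ (hypBall n κ ρ)) := by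
  have hs := isRadialWeight_hyperbolicWeight hn hκ
  obtain ⟨L, h, P, hg⟩ := hs.exists_groundState hr
  obtain ⟨t₀, ht₀, hlt, heq, hgt⟩ := hg.exists_sign_change_hyperbolicWeight hn hκ hr
  obtain ⟨w, hw, hw0, hwC, hA⟩ := exists_normalized_area hn hκ hD hBG
  have hm : ∀ ρ, MeasurableSet (qball d x₀ ρ) := fun ρ => (hd.isOpen_qball x₀ ρ).measurableSet
  have hfin : ∀ ρ, μ (qball d x₀ ρ) ≠ ⊤ := fun ρ => (hd.measure_qball_lt_top hproper μ x₀ ρ).ne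
  have hδ : Measurable (d x₀) := (hd.continuous_dist x₀).measurable
  have hnull : ∀ ρ, 0 < ρ → μ {y | d x₀ y = ρ} = 0 := fun ρ hρ =>
    measure_sphere_eq_zero hm hfin (by rw [hA ρ hρ]; exact ENNReal.ofReal_ne_top)
  -- A point other than `x₀` lies on a sphere of positive radius, which is null.
  have hpoint : ∀ x, x ≠ x₀ → μ {x} = 0 := fun x hx =>
    measure_mono_null (t := {y | d x₀ y = d x₀ x}) (Set.singleton_subset_iff.2 rfl) (hnull (d x₀ x)
      (lt_of_le_of_ne (hd.nonneg x₀ x) fun h0 => hx ((hd.eq_zero_iff x₀ x).1 h0.symm).symm))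
  set m := distDistribution d μ x₀ r with hmdef
  have := isFiniteMeasure_distDistribution hδ (hfin r)
  have hm0 : m (Set.Iio 0) = 0 := by
    rw [hmdef, distDistribution_apply hδ r measurableSet_Iio]
    refine measure_mono_null (fun y hy => ?_) (measure_empty (μ := μ))
    exact absurd hy.1 (not_lt.2 (hd.nonneg x₀ y))
  have hmr : m (Set.Ioi r) = 0 := by
    rw [hmdef, distDistribution_apply hδ r measurableSet_Ioi]
    refine measure_mono_null (fun y hy => ?_) (measure_empty (μ := μ))
    exact absurd hy.2 (lt_asymm hy.1)
  have hmt : m {t₀} = 0 := by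
    rw [hmdef, distDistribution_apply hδ r (measurableSet_singleton t₀)]
    exact measure_mono_null (fun y hy => hy.1) (hnull t₀ ht₀.1)
  obtain ⟨hE, hEeq⟩ := hg.energy_comparison hs (hw0 t₀ ht₀.1) ht₀ hlt heq hgt hm0 hmr hmt
    (weightMeasure_le_distDistribution hs hδ hm hfin hw hw0 hA ht₀)
    (distDistribution_le_weightMeasure hs hδ hm hfin hw hw0 hA ht₀.1)
  have hhc := hg.continuous
  have hhm := hhc.measurable
  have hPm := hg.continuous_flux.measurable
  have hsm := hs.continuous.measurable
  have hT := fundamentalFrequency_mul_le hd hproper x₀ μ hpoint hg hs hr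
  rw [← lintegral_distDistribution hδ r (g := fun t => ENNReal.ofReal (h t ^ 2)) (by fun_prop),
    ← lintegral_distDistribution hδ r
      (g := fun t => ENNReal.ofReal ((P t / hyperbolicWeight n κ t) ^ 2)) (by fun_prop)] at hT
  have hH := hg.ofReal_le_fundamentalFrequency hn hκ hr
  refine ⟨?_, fun hlam => ?_⟩
  -- The mass of `h` has to be finite and positive, the latter by full support, to be cancelled from
  -- `λ ∫ h² dm ≤ L ∫ h² dm`.
  · have hDtop : ∫⁻ t, ENNReal.ofReal (h t ^ 2) ∂m ≠ ⊤ := by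
      rw [lintegral_distDistribution hδ r (g := fun t => ENNReal.ofReal (h t ^ 2)) (by fun_prop)]
      refine ne_top_of_le_ne_top (hfin r) ?_
      rw [← setLIntegral_one]
      refine setLIntegral_mono measurable_const fun y hy => ?_
      have h1 : d x₀ y ∈ Set.Icc 0 r := ⟨hd.nonneg x₀ y, le_of_lt hy⟩
      rw [← ENNReal.ofReal_one]
      exact ENNReal.ofReal_le_ofReal (pow_le_one₀ (hg.nonneg h1) (hg.le_one hs h1))
    have hD0 : ∫⁻ t, ENNReal.ofReal (h t ^ 2) ∂m ≠ 0 := by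
      rw [lintegral_distDistribution hδ r (g := fun t => ENNReal.ofReal (h t ^ 2)) (by fun_prop)]
      refine (setLIntegral_pos_iff (by fun_prop)).2 ?_ |>.ne'
      refine lt_of_lt_of_le ((hd.isOpen_qball x₀ r).measure_pos μ ⟨x₀, ?_⟩)
        (measure_mono fun y hy => ⟨?_, hy⟩)
      · rw [qball, Set.mem_ofPred_eq, hd.dist_self]
        exact hr
      · have := hg.pos _ ⟨hd.nonneg x₀ y, hy⟩
        rw [Function.mem_support, ne_eq, ENNReal.ofReal_eq_zero, not_le]
        positivity
    exact ((ENNReal.mul_le_mul_iff_left hD0 hDtop).1 (hT.trans hE)).trans hH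
  -- Equality of the frequencies gives `L ≤ λ`, hence `L ∫ h² dm ≤ ∫ h'² dm`: the equality case of
  -- the comparison.
  · have hmeq := hEeq (le_trans (by gcongr; rw [hlam]; exact hH) hT)
    have hball : ∀ ρ, 0 < ρ → ρ < r → μ (qball d x₀ ρ) =
        ENNReal.ofReal (w t₀ * ∫ t in (0 : ℝ)..ρ, hyperbolicWeight n κ t) := fun ρ hρ hρr =>
      measure_qball_of_distDistribution_eq hs hδ (hw0 t₀ ht₀.1) hρ hρr (hnull ρ hρ) hmeq
    have hcC := eq_of_tendsto_normalized_area hs hm hfin hw hw0 hA (hw0 t₀ ht₀.1) hr hwC hball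
    intro ρ hρ hρr
    rw [hball ρ hρ hρr, hcC, hypMeasure_hypBall hn hκ hρ,
      ENNReal.ofReal_mul (hyperbolicAreaConst_pos (by omega) hκ).le, ofReal_hyperbolicAreaConst hκ]
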